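/- Let $\mathcal D$ be a (strict) $2$-category with finite products of $0$-cells (a terminal $0$-cell $1$ and binary products, in the strict $2$-categorical sense: $\mathcal D(X,1)\cong\mathbf 1$ and $\mathcal D(X,A\times B)\cong\mathcal D(X,A)\times\mathcal D(X,B)$ as categories). Eilenberg–Moore objects. A monad in a $2$-category $\mathcal E$ is $(C,S,\eta,\mu)$ with $S:C\to C$, $\eta:1_C\Rightarrow S$, $\mu:S^2\Rightarrow S$ satisfying the usual unit and associativity laws. $\mathrm{Mnd}(\mathcal E)$ is the $2$-category of monads, lax morphisms of monads and transformations: a lax morphism $(C,S)\to(C',S')$ is a $1$-cell $F:C\to C'$ with a $2$-cell $\tau:S'F\Rightarrow FS$ such that $\tau\circ\eta'_F=F(\eta)$ and $\tau\circ\mu'_F=F(\mu)\circ\tau_S\circ S'(\tau)$; a transformation $(F,\tau)\Rightarrow(G,\tau')$ is a $2$-cell $\sigma:F\Rightarrow G$ with $\tau'\circ S'(\sigma)=\sigma_S\circ\tau$. Every $2$-functor $G:\mathcal E\to\mathcal E'$ induces a $2$-functor $\mathrm{Mnd}(G):\mathrm{Mnd}(\mathcal E)\to\mathrm{Mnd}(\mathcal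 E')$. Let $\iota_{\mathcal E}:\mathcal E\to\mathrm{Mnd}(\mathcal E)$ be the $2$-functor sending a $0$-cell to its identity monad; $\mathcal E$ admits Eilenberg–Moore (EM) objects if $\iota_{\mathcal E}$ has a right $2$-adjoint $EM_{\mathcal E}$. If $\mathcal E$ and $\mathcal E'$ admit EM objects and $G:\mathcal E\to\mathcal E'$ is a $2$-functor, then $\mathcal E$ has standard EM objects with respect to $G$ if the canonical comparison $$G\circ EM_{\mathcal E}\Longrightarrow EM_{\mathcal E'}\circ\mathrm{Mnd}(G),$$ that is, the mate of the identity $\mathrm{Mnd}(G)\circ\iota_{\mathcal E}=\iota_{\mathcal E'}\circ G$, is a $2$-natural isomorphism. Monoidal objects. A monoidal object in $\mathcal D$ is a $0$-cell $C$ with $1$-cells $\otimes:C\times C\to C$, $I:1\to C$ and invertible $2$-cells $\alpha:\otimes\circ(1\times\otimes)\Rightarrow\otimes\circ(\otimes\times1)$, $\lambda:\otimes\circ\langle I,1_C\rangle\Rightarrow1_C$, $\rho:\otimes\circ\langle1_C,I\rangle\Rightarrow1_C$ satisfying the pentagon and triangle laws. An oplax monoidal $1$-cell is a $1$-cell $F:C\to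 C'$ with $2$-cells $\varphi:F\circ\otimes\Rightarrow\otimes'\circ(F\times F)$ and $\bar\varphi:F\circ I\Rightarrow I'$ satisfying the usual coherence conditions with $\alpha$, $\lambda$ and $\rho$, and a transformation $(F,\varphi,\bar\varphi)\Rightarrow(G,\psi,\bar\psi)$ of oplax monoidal $1$-cells is a $2$-cell $\sigma:F\Rightarrow G$ with $\otimes'(\sigma,\sigma)\circ\varphi=\psi\circ\sigma_\otimes$ and $\bar\psi\circ\sigma_I=\bar\varphi$. These form a $2$-category $\mathrm{Mon}_{op}(\mathcal D)$ with a forgetful $2$-functor $\mathcal U:\mathrm{Mon}_{op}(\mathcal D)\to\mathcal D$. Theorem. Suppose that $\mathcal D$ is a $2$-category with finite products that admits EM objects. Then the $2$-category $\mathrm{Mon}_{op}(\mathcal D)$ admits EM objects, and it has standard EM objects with respect to $\mathcal U:\mathrm{Mon}_{op}(\mathcal D)\to\mathcal D$. -/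

import Mathlib

open CategoryTheory CategoryTheory.Bicategory

universe w v u w' v' u'

namespace TwoCat

/-! ### Monads in a 2-category and the 2-category of monads with lax morphisms -/

section Monads

/-- A monad `(C, S, η, μ)` in `D`. Composition is written in diagrammatic order,
so `S ∘ F` is `F ≫ S`. -/
structure Mnd (D : Type u) [Bicategory.{w, v} D] where
  obj : D
  endo : obj ⟶ obj
  unit : 𝟙 obj ⟶ endo
  mul : endo ≫ endo ⟶ endo
  unit_mul : unit ▷ endo ≫ mul = (λ_ endo).hom
  mul_unit : endo ◁ unit ≫ mul = (ρ_ endo).hom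
  mul_assoc : mul ▷ endo ≫ mul = (α_ endo endo endo).hom ≫ endo ◁ mul ≫ mul

namespace Mnd

variable {D : Type u} [Bicategory.{w, v} D]

/-- A lax morphism of monads `(F, τ) : (C, S) ⟶ (C', S')`, with `τ : S'F ⟶ FS`. -/
structure Hom (A B : Mnd D) where
  hom : A.obj ⟶ B.obj
  cell : hom ≫ B.endo ⟶ A.endo ≫ hom
  unit_cell : hom ◁ B.unit ≫ cell = (ρ_ hom).hom ≫ (λ_ hom).inv ≫ A.unit ▷ hom
  mul_cell : hom ◁ B.mul ≫ cell =
    (α_ hom B.endo B.endo).inv ≫ cell ▷ B.endo ≫ (α_ A.endo hom B.endo).hom ≫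
      A.endo ◁ cell ≫ (α_ A.endo A.endo hom).inv ≫ A.mul ▷ hom

/-- A transformation of lax morphisms of monads. -/
@[ext]
structure Hom₂ {A B : Mnd D} (F G : Hom A B) where
  hom : F.hom ⟶ G.hom
  comm : hom ▷ B.endo ≫ G.cell = F.cell ≫ A.endo ◁ hom

/-- The identity lax morphism. -/
def Hom.id (A : Mnd D) : Hom A A where
  hom := 𝟙 A.obj
  cell := (λ_ A.endo).hom ≫ (ρ_ A.endo).inv
  unit_cell := by
    simp only [id_whiskerLeft, whiskerRight_id, unitors_equal, unitors_inv_equal]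
    simp
  mul_cell := by
    simp

/-- The composite `(F', τ') ∘ (F, τ) = (F'F, F'(τ) ∘ τ'_F)`. -/
def Hom.comp {A B C : Mnd D} (F : Hom A B) (G : Hom B C) : Hom A C where
  hom := F.hom ≫ G.hom
  cell := (α_ F.hom G.hom C.endo).hom ≫ F.hom ◁ G.cell ≫ (α_ F.hom B.endo G.hom).inv ≫
    F.cell ▷ G.hom ≫ (α_ A.endo F.hom G.hom).hom
  unit_cell := by
    calc
      _ = 𝟙 _ ⊗≫ F.hom ◁ (G.hom ◁ C.unit ≫ G.cell) ⊗≫ F.cell ▷ G.hom ⊗≫ 𝟙 _ := by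
        bicategory
      _ = 𝟙 _ ⊗≫ (F.hom ◁ B.unit ≫ F.cell) ▷ G.hom ⊗≫ 𝟙 _ := by
        rw [G.unit_cell]
        bicategory
      _ = _ := by
        rw [F.unit_cell]
        bicategory
  mul_cell := by
    calc
      _ = 𝟙 _ ⊗≫ F.hom ◁ (G.hom ◁ C.mul ≫ G.cell) ⊗≫ F.cell ▷ G.hom ⊗≫ 𝟙 _ := by
        bicategory
      _ = 𝟙 _ ⊗≫ F.hom ◁ G.cell ▷ C.endo ⊗≫ F.hom ◁ B.endo ◁ G.cell ⊗≫
            (F.hom ◁ B.mul ≫ F.cell) ▷ G.hom ⊗≫ 𝟙 _ := by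
        rw [G.mul_cell]
        bicategory
      _ = 𝟙 _ ⊗≫ F.hom ◁ G.cell ▷ C.endo ⊗≫
            ((F.hom ≫ B.endo) ◁ G.cell ≫ F.cell ▷ (B.endo ≫ G.hom)) ⊗≫
              A.endo ◁ F.cell ▷ G.hom ⊗≫ A.mul ▷ F.hom ▷ G.hom ⊗≫ 𝟙 _ := by
        rw [F.mul_cell]
        bicategory
      _ = _ := by
        rw [whisker_exchange]
        bicategory

instance : CategoryStruct (Mnd D) where
  Hom := Hom
  id := Hom.id
  comp := Hom.comp

instance homCategory (A B : Mnd D) : Category (A ⟶ B) where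
  Hom F G := Hom₂ (A := A) (B := B) F G
  id F := ⟨𝟙 (Hom.hom F), by simp⟩
  comp {F G H} σ τ := ⟨Hom₂.hom σ ≫ Hom₂.hom τ, by
    rw [comp_whiskerRight, Category.assoc, τ.comm, ← Category.assoc, σ.comm]
    simp⟩
  id_comp σ := Hom₂.ext (Category.id_comp _)
  comp_id σ := Hom₂.ext (Category.comp_id _)
  assoc σ τ υ := Hom₂.ext (Category.assoc _ _ _)

@[ext]
theorem hom₂_ext {A B : Mnd D} {F G : A ⟶ B} {σ τ : F ⟶ G}
    (h : Hom₂.hom σ = Hom₂.hom τ) : σ = τ := Hom₂.ext h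

@[simp] theorem id_hom (A : Mnd D) : Hom.hom (𝟙 A) = 𝟙 A.obj := rfl
@[simp] theorem id_cell (A : Mnd D) :
    Hom.cell (𝟙 A) = (λ_ A.endo).hom ≫ (ρ_ A.endo).inv := rfl
@[simp] theorem comp_hom {A B C : Mnd D} (F : A ⟶ B) (G : B ⟶ C) :
    Hom.hom (F ≫ G) = Hom.hom F ≫ Hom.hom G := rfl
@[simp] theorem comp_cell {A B C : Mnd D} (F : A ⟶ B) (G : B ⟶ C) :
    Hom.cell (F ≫ G) = (α_ F.hom G.hom C.endo).hom ≫ F.hom ◁ G.cell ≫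
      (α_ F.hom B.endo G.hom).inv ≫ F.cell ▷ G.hom ≫ (α_ A.endo F.hom G.hom).hom := rfl
@[simp] theorem id₂_hom {A B : Mnd D} (F : A ⟶ B) : Hom₂.hom (𝟙 F) = 𝟙 F.hom := rfl
@[simp] theorem comp₂_hom {A B : Mnd D} {F G H : A ⟶ B} (σ : F ⟶ G) (τ : G ⟶ H) :
    Hom₂.hom (σ ≫ τ) = σ.hom ≫ τ.hom := rfl

/-- An invertible 2-cell of `D` compatible with the monad cells is invertible in `Mnd D`. -/
def mkIso {A B : Mnd D} {F G : A ⟶ B} (e : F.hom ≅ G.hom)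
    (h : e.hom ▷ B.endo ≫ G.cell = F.cell ≫ A.endo ◁ e.hom) : F ≅ G where
  hom := ⟨e.hom, h⟩
  inv := ⟨e.inv, by
    rw [← cancel_epi (e.hom ▷ B.endo), ← cancel_mono (A.endo ◁ e.hom)]
    simp [h]⟩
  hom_inv_id := hom₂_ext e.hom_inv_id
  inv_hom_id := hom₂_ext e.inv_hom_id

theorem whiskerLeft_comm {A B C : Mnd D} (F : Hom A B) {G H : Hom B C} (σ : Hom₂ G H) :
    (F.hom ◁ σ.hom) ▷ C.endo ≫ (F.comp H).cell =
      (F.comp G).cell ≫ A.endo ◁ (F.hom ◁ σ.hom) := by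
  dsimp only [Hom.comp]
  calc
    _ = 𝟙 _ ⊗≫ F.hom ◁ (σ.hom ▷ C.endo ≫ H.cell) ⊗≫ F.cell ▷ H.hom ⊗≫ 𝟙 _ := by
      bicategory
    _ = 𝟙 _ ⊗≫ F.hom ◁ G.cell ⊗≫
          ((F.hom ≫ B.endo) ◁ σ.hom ≫ F.cell ▷ H.hom) ⊗≫ 𝟙 _ := by
      rw [σ.comm]
      bicategory
    _ = _ := by
      rw [whisker_exchange]
      bicategory

theorem whiskerRight_comm {A B C : Mnd D} {F G : Hom A B} (σ : Hom₂ F G) (H : Hom B C) :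
    (σ.hom ▷ H.hom) ▷ C.endo ≫ (G.comp H).cell =
      (F.comp H).cell ≫ A.endo ◁ (σ.hom ▷ H.hom) := by
  dsimp only [Hom.comp]
  calc
    _ = 𝟙 _ ⊗≫ (σ.hom ▷ (H.hom ≫ C.endo) ≫ G.hom ◁ H.cell) ⊗≫
          G.cell ▷ H.hom ⊗≫ 𝟙 _ := by
      bicategory
    _ = 𝟙 _ ⊗≫ F.hom ◁ H.cell ⊗≫ (σ.hom ▷ B.endo ≫ G.cell) ▷ H.hom ⊗≫ 𝟙 _ := by
      rw [← whisker_exchange]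
      bicategory
    _ = _ := by
      rw [σ.comm]
      bicategory

/-- The bicategory structure on `Mnd D`, computed on the underlying cells of `D`. -/
instance : Bicategory (Mnd D) where
  homCategory := homCategory
  whiskerLeft {A B C} F G H σ := ⟨Hom.hom F ◁ Hom₂.hom σ, whiskerLeft_comm F σ⟩
  whiskerRight {A B C} F G σ H := ⟨Hom₂.hom σ ▷ Hom.hom H, whiskerRight_comm σ H⟩
  associator F G H := mkIso (α_ (Hom.hom F) (Hom.hom G) (Hom.hom H)) (by
    simp only [comp_cell, comp_hom]
    bicategory)
  leftUnitor F := mkIso (λ_ (Hom.hom F)) (by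
    simp only [comp_cell, comp_hom, id_cell, id_hom]
    bicategory)
  rightUnitor F := mkIso (ρ_ (Hom.hom F)) (by
    simp only [comp_cell, comp_hom, id_cell, id_hom]
    bicategory)
  whiskerLeft_id _ _ := hom₂_ext (whiskerLeft_id _ _)
  whiskerLeft_comp _ _ _ _ _ _ := hom₂_ext (whiskerLeft_comp _ _ _)
  id_whiskerLeft _ := hom₂_ext (id_whiskerLeft _)
  comp_whiskerLeft _ _ _ _ _ := hom₂_ext (comp_whiskerLeft _ _ _)
  id_whiskerRight _ _ := hom₂_ext (id_whiskerRight _ _)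
  comp_whiskerRight _ _ _ := hom₂_ext (comp_whiskerRight _ _ _)
  whiskerRight_id _ := hom₂_ext (whiskerRight_id _)
  whiskerRight_comp _ _ _ := hom₂_ext (whiskerRight_comp _ _ _)
  whisker_assoc _ _ _ _ _ := hom₂_ext (whisker_assoc _ _ _)
  whisker_exchange _ _ := hom₂_ext (whisker_exchange _ _)
  pentagon _ _ _ _ := hom₂_ext (pentagon _ _ _ _)
  triangle _ _ := hom₂_ext (triangle _ _)

@[simp] theorem whiskerLeft_hom {A B C : Mnd D} (F : A ⟶ B) {G H : B ⟶ C} (σ : G ⟶ H) :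
    Hom₂.hom (F ◁ σ) = F.hom ◁ σ.hom := rfl
@[simp] theorem whiskerRight_hom {A B C : Mnd D} {F G : A ⟶ B} (σ : F ⟶ G) (H : B ⟶ C) :
    Hom₂.hom (σ ▷ H) = σ.hom ▷ H.hom := rfl

theorem hom_ext {A B : Mnd D} {F G : A ⟶ B} (h : F.hom = G.hom)
    (hc : F.cell = eqToHom (by rw [h]) ≫ G.cell ≫ eqToHom (by rw [h])) : F = G := by
  obtain ⟨f, c, _, _⟩ := F
  obtain ⟨g, d, _, _⟩ := G
  obtain rfl : f = g := h
  obtain rfl : c = d := by simpa using hc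
  rfl

@[simp] theorem eqToHom_hom₂ {A B : Mnd D} {F G : A ⟶ B} (h : F = G) :
    Hom₂.hom (eqToHom h) = eqToHom (congrArg Hom.hom h) := by
  subst h; rfl

instance [Strict D] : Strict (Mnd D) where
  id_comp F := hom_ext (Strict.id_comp _) (by
    simp [Strict.leftUnitor_eqToIso, Strict.rightUnitor_eqToIso, Strict.associator_eqToIso])
  comp_id F := hom_ext (Strict.comp_id _) (by
    simp [Strict.leftUnitor_eqToIso, Strict.rightUnitor_eqToIso, Strict.associator_eqToIso])
  assoc F G H := hom_ext (Strict.assoc _ _ _) (by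
    simp [Strict.associator_eqToIso]
    erw [eqToHom_trans_assoc, eqToHom_trans])
  leftUnitor_eqToIso F := by
    ext; simp; exact congrArg Iso.hom (Strict.leftUnitor_eqToIso F.hom)
  rightUnitor_eqToIso F := by
    ext; simp; exact congrArg Iso.hom (Strict.rightUnitor_eqToIso F.hom)
  associator_eqToIso F G H := by
    ext; simp; exact congrArg Iso.hom (Strict.associator_eqToIso F.hom G.hom H.hom)

/-- The identity monad on `X`. -/
def idMonad (X : D) : Mnd D where
  obj := X
  endo := 𝟙 X
  unit := 𝟙 (𝟙 X)
  mul := (λ_ (𝟙 X)).hom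
  unit_mul := by simp
  mul_unit := by simp [unitors_equal]
  mul_assoc := by simp [unitors_equal]

end Mnd

end Monads

/-! ### 2-functors between 2-categories of monads -/

section Functors

namespace Mnd

theorem mk_congr {D : Type u} [Bicategory.{w, v} D] {A B : Mnd D} {f : A.obj ⟶ B.obj}
    {c d : f ≫ B.endo ⟶ A.endo ≫ f} (h : c = d) (c₁ c₂ d₁ d₂) :
    Hom.mk (A := A) (B := B) f c c₁ c₂ = Hom.mk f d d₁ d₂ := by
  subst h; rfl

theorem hom₂_conj_eqToHom {D : Type u} [Bicategory.{w, v} D] {A B : Mnd D} {F F' G G' : A ⟶ B}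
    (h : F = F') (σ : F' ⟶ G') (k : G' = G) :
    Hom₂.hom (eqToHom h ≫ σ ≫ eqToHom k) =
      eqToHom (congrArg Hom.hom h) ≫ σ.hom ≫ eqToHom (congrArg Hom.hom k) := by
  subst h k; simp

/-- The lax morphism of identity monads given by a 1-cell. -/
def idMonadMap {D : Type u} [Bicategory.{w, v} D] {X Y : D} (f : X ⟶ Y) :
    idMonad X ⟶ idMonad Y where
  hom := f
  cell := (ρ_ f).hom ≫ (λ_ f).inv
  unit_cell := by
    simp only [idMonad, whiskerLeft_id, id_whiskerRight]
    exact (Category.id_comp ((ρ_ f).hom ≫ (λ_ f).inv)).trans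
      (congrArg ((ρ_ f).hom ≫ ·) (Category.comp_id (λ_ f).inv).symm)
  mul_cell := by
    dsimp only [idMonad]
    bicategory

/-- The embedding 2-functor `ι : D ⟶ Mnd D`, sending `X` to the identity monad on `X`. -/
def iota (D : Type u) [Bicategory.{w, v} D] [Strict D] : StrictPseudofunctor D (Mnd D) :=
  StrictPseudofunctor.mk''
  { obj := idMonad
    map := idMonadMap
    map₂ := fun σ => ⟨σ, by
      dsimp only [idMonad, idMonadMap]
      bicategory⟩
    map₂_id := fun _ => rfl
    map₂_comp := fun _ _ => rfl
    map_id := fun X => mk_congr (by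
      dsimp only [idMonad]
      bicategory) _ _ _ _
    map_comp := fun f g => mk_congr (by
      dsimp only [idMonad, idMonadMap]
      bicategory) _ _ _ _
    map₂_whisker_left := fun f _ _ σ => by
      ext
      exact ((hom₂_conj_eqToHom _ _ _).trans
        ((Category.id_comp _).trans (Category.comp_id _))).symm
    map₂_whisker_right := fun σ g => by
      ext
      exact ((hom₂_conj_eqToHom _ _ _).trans
        ((Category.id_comp _).trans (Category.comp_id _))).symm }

variable {D : Type u} [Bicategory.{w, v} D] {E : Type u'} [Bicategory.{w', v'} E]

/-- The image of a monad under a 2-functor. -/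
def mapObj (G : StrictPseudofunctor D E) (A : Mnd D) : Mnd E where
  obj := G.obj A.obj
  endo := G.map A.endo
  unit := (G.mapId A.obj).inv ≫ G.map₂ A.unit
  mul := (G.mapComp A.endo A.endo).inv ≫ G.map₂ A.mul
  unit_mul := by
    have h := congrArg G.map₂ A.unit_mul
    simp only [PrelaxFunctor.map₂_comp, Pseudofunctor.map₂_whisker_right, Category.assoc,
      Pseudofunctor.map₂_left_unitor] at h
    rw [cancel_epi] at h
    simp only [comp_whiskerRight, Category.assoc, h]
    simp
  mul_unit := by
    have h := congrArg G.map₂ A.mul_unit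
    simp only [PrelaxFunctor.map₂_comp, Pseudofunctor.map₂_whisker_left, Category.assoc,
      Pseudofunctor.map₂_right_unitor] at h
    rw [cancel_epi] at h
    simp only [whiskerLeft_comp, Category.assoc, h]
    simp
  mul_assoc := by
    have h := congrArg G.map₂ A.mul_assoc
    simp only [PrelaxFunctor.map₂_comp, Pseudofunctor.map₂_whisker_left,
      Pseudofunctor.map₂_whisker_right, Category.assoc, Pseudofunctor.map₂_associator] at h
    rw [cancel_epi] at h
    simp only [whiskerLeft_comp, comp_whiskerRight, Category.assoc, h]
    simp

theorem map₂_leftUnitor_inv (G : StrictPseudofunctor D E) {X Y : D} (f : X ⟶ Y) :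
    G.map₂ (λ_ f).inv = (λ_ (G.map f)).inv ≫ (G.mapId X).inv ▷ G.map f ≫
      (G.mapComp (𝟙 X) f).inv := by
  rw [← cancel_epi (G.map₂ (λ_ f).hom), ← PrelaxFunctor.map₂_comp]
  simp

theorem map₂_associator_inv (G : StrictPseudofunctor D E) {X Y Z W : D}
    (f : X ⟶ Y) (g : Y ⟶ Z) (h : Z ⟶ W) :
    G.map₂ (α_ f g h).inv = (G.mapComp f (g ≫ h)).hom ≫ G.map f ◁ (G.mapComp g h).hom ≫
      (α_ (G.map f) (G.map g) (G.map h)).inv ≫ (G.mapComp f g).inv ▷ G.map h ≫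
        (G.mapComp (f ≫ g) h).inv := by
  rw [← cancel_epi (G.map₂ (α_ f g h).hom), ← PrelaxFunctor.map₂_comp]
  simp

theorem map_unit_cell (G : StrictPseudofunctor D E) {A B : Mnd D} (F : A ⟶ B) :
    G.map F.hom ◁ ((G.mapId B.obj).inv ≫ G.map₂ B.unit) ≫
      (G.mapComp F.hom B.endo).inv ≫ G.map₂ F.cell ≫ (G.mapComp A.endo F.hom).hom =
    (ρ_ (G.map F.hom)).hom ≫ (λ_ (G.map F.hom)).inv ≫
      ((G.mapId A.obj).inv ≫ G.map₂ A.unit) ▷ G.map F.hom := by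
  have h := congrArg G.map₂ F.unit_cell
  simp only [PrelaxFunctor.map₂_comp, Pseudofunctor.map₂_whisker_left, map₂_leftUnitor_inv,
    Pseudofunctor.map₂_right_unitor, Pseudofunctor.map₂_whisker_right, Category.assoc] at h
  rw [cancel_epi] at h
  have h' := h =≫ (G.mapComp A.endo F.hom).hom
  simp only [Category.assoc] at h'
  simp only [whiskerLeft_comp, Category.assoc, h']
  simp

theorem map_mul_cell (G : StrictPseudofunctor D E) {A B : Mnd D} (F : A ⟶ B) :
    G.map F.hom ◁ ((G.mapComp B.endo B.endo).inv ≫ G.map₂ B.mul) ≫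
      (G.mapComp F.hom B.endo).inv ≫ G.map₂ F.cell ≫ (G.mapComp A.endo F.hom).hom =
    (α_ (G.map F.hom) (G.map B.endo) (G.map B.endo)).inv ≫
      ((G.mapComp F.hom B.endo).inv ≫ G.map₂ F.cell ≫ (G.mapComp A.endo F.hom).hom) ▷
        G.map B.endo ≫ (α_ (G.map A.endo) (G.map F.hom) (G.map B.endo)).hom ≫
      G.map A.endo ◁
        ((G.mapComp F.hom B.endo).inv ≫ G.map₂ F.cell ≫ (G.mapComp A.endo F.hom).hom) ≫
      (α_ (G.map A.endo) (G.map A.endo) (G.map F.hom)).inv ≫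
        ((G.mapComp A.endo A.endo).inv ≫ G.map₂ A.mul) ▷ G.map F.hom := by
  have h := congrArg G.map₂ F.mul_cell
  simp only [PrelaxFunctor.map₂_comp, Pseudofunctor.map₂_whisker_left, map₂_associator_inv,
    Pseudofunctor.map₂_associator, Pseudofunctor.map₂_whisker_right, Category.assoc,
    Iso.inv_hom_id_assoc] at h
  rw [cancel_epi] at h
  have h' := h =≫ (G.mapComp A.endo F.hom).hom
  simp only [Category.assoc] at h'
  simp only [whiskerLeft_comp, Category.assoc, h']
  simp

/-- The image of a lax morphism of monads under a 2-functor. -/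
def mapHom (G : StrictPseudofunctor D E) {A B : Mnd D} (F : A ⟶ B) :
    mapObj G A ⟶ mapObj G B where
  hom := G.map F.hom
  cell := (G.mapComp F.hom B.endo).inv ≫ G.map₂ F.cell ≫ (G.mapComp A.endo F.hom).hom
  unit_cell := map_unit_cell G F
  mul_cell := map_mul_cell G F

theorem map₂_comm (G : StrictPseudofunctor D E) {A B : Mnd D} {F F' : A ⟶ B} (σ : F ⟶ F') :
    G.map₂ σ.hom ▷ G.map B.endo ≫
      (G.mapComp F'.hom B.endo).inv ≫ G.map₂ F'.cell ≫ (G.mapComp A.endo F'.hom).hom =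
    ((G.mapComp F.hom B.endo).inv ≫ G.map₂ F.cell ≫ (G.mapComp A.endo F.hom).hom) ≫
      G.map A.endo ◁ G.map₂ σ.hom := by
  have h := congrArg G.map₂ σ.comm
  simp only [PrelaxFunctor.map₂_comp, Pseudofunctor.map₂_whisker_left,
    Pseudofunctor.map₂_whisker_right, Category.assoc] at h
  have h' := (G.mapComp F.hom B.endo).inv ≫= h =≫ (G.mapComp A.endo F'.hom).hom
  simpa using h'

theorem map_cell_comp [Strict D] [Strict E] (G : StrictPseudofunctor D E) {A B C : Mnd D}
    (F : A ⟶ B) (H : B ⟶ C) :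
    (G.mapComp (F.hom ≫ H.hom) C.endo).inv ≫ G.map₂ ((α_ F.hom H.hom C.endo).hom ≫
      F.hom ◁ H.cell ≫ (α_ F.hom B.endo H.hom).inv ≫ F.cell ▷ H.hom ≫
        (α_ A.endo F.hom H.hom).hom) ≫ (G.mapComp A.endo (F.hom ≫ H.hom)).hom =
    eqToHom (by rw [G.map_comp]) ≫ ((α_ (G.map F.hom) (G.map H.hom) (G.map C.endo)).hom ≫
      G.map F.hom ◁ ((G.mapComp H.hom C.endo).inv ≫ G.map₂ H.cell ≫
        (G.mapComp B.endo H.hom).hom) ≫ (α_ (G.map F.hom) (G.map B.endo) (G.map H.hom)).inv ≫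
      ((G.mapComp F.hom B.endo).inv ≫ G.map₂ F.cell ≫ (G.mapComp A.endo F.hom).hom) ▷
        G.map H.hom ≫ (α_ (G.map A.endo) (G.map F.hom) (G.map H.hom)).hom) ≫
      eqToHom (by rw [G.map_comp]) := by
  simp [Strict.associator_eqToIso, G.mapComp_eq_eqToIso, PrelaxFunctor.map₂_eqToHom]

theorem map_cell_id [Strict D] [Strict E] (G : StrictPseudofunctor D E) (A : Mnd D) :
    (G.mapComp (𝟙 A.obj) A.endo).inv ≫ G.map₂ ((λ_ A.endo).hom ≫ (ρ_ A.endo).inv) ≫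
      (G.mapComp A.endo (𝟙 A.obj)).hom =
    eqToHom (by rw [G.map_id]) ≫ ((λ_ (G.map A.endo)).hom ≫ (ρ_ (G.map A.endo)).inv) ≫
      eqToHom (by rw [G.map_id]) := by
  simp [Strict.leftUnitor_eqToIso, Strict.rightUnitor_eqToIso, G.mapComp_eq_eqToIso,
    PrelaxFunctor.map₂_eqToHom]

/-- The 2-functor `Mnd G : Mnd D ⟶ Mnd E` induced by a 2-functor `G : D ⟶ E`. -/
def map [Strict D] [Strict E] (G : StrictPseudofunctor D E) :
    StrictPseudofunctor (Mnd D) (Mnd E) :=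
  StrictPseudofunctor.mk''
  { obj := mapObj G
    map := mapHom G
    map₂ := fun σ => ⟨G.map₂ σ.hom, map₂_comm G σ⟩
    map₂_id := fun F => hom₂_ext (G.map₂_id F.hom)
    map₂_comp := fun σ τ => hom₂_ext (G.map₂_comp σ.hom τ.hom)
    map_id := fun A => hom_ext (G.map_id A.obj) (map_cell_id G A)
    map_comp := fun F H => hom_ext (G.map_comp F.hom H.hom) (map_cell_comp G F H)
    map₂_whisker_left := fun F _ _ σ => by
      ext
      rw [comp₂_hom, comp₂_hom, eqToHom_hom₂, eqToHom_hom₂]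
      refine (G.map₂_whisker_left F.hom σ.hom).trans ?_
      simp only [G.mapComp_eq_eqToIso]
      rfl
    map₂_whisker_right := fun σ H => by
      ext
      rw [comp₂_hom, comp₂_hom, eqToHom_hom₂, eqToHom_hom₂]
      refine (G.map₂_whisker_right σ.hom H.hom).trans ?_
      simp only [G.mapComp_eq_eqToIso]
      rfl }

theorem mk_obj_congr {X : D} {s t : X ⟶ X} (h : s = t) {η : 𝟙 X ⟶ s} {η' : 𝟙 X ⟶ t}
    {μ : s ≫ s ⟶ s} {μ' : t ≫ t ⟶ t} (hη : η = η' ≫ eqToHom h.symm)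
    (hμ : μ = eqToHom (by rw [h]) ≫ μ' ≫ eqToHom h.symm) (p₁ p₂ p₃ q₁ q₂ q₃) :
    Mnd.mk X s η μ p₁ p₂ p₃ = Mnd.mk X t η' μ' q₁ q₂ q₃ := by
  subst h
  obtain rfl : η = η' := by simpa using hη
  obtain rfl : μ = μ' := by simpa using hμ
  rfl

/-- The square of 2-functors with `ι` commutes on objects. -/
theorem iota_comm_obj [Strict D] [Strict E] (G : StrictPseudofunctor D E) (X : D) :
    (iota E).obj (G.obj X) = (map G).obj ((iota D).obj X) :=
  mk_obj_congr (G.map_id X).symm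
    (show 𝟙 (𝟙 (G.obj X)) = ((G.mapId X).inv ≫ G.map₂ (𝟙 (𝟙 X))) ≫ eqToHom (G.map_id X) by
      simp [G.mapId_eq_eqToIso])
    (show (λ_ (𝟙 (G.obj X))).hom = eqToHom (by rw [G.map_id]) ≫
        ((G.mapComp (𝟙 X) (𝟙 X)).inv ≫ G.map₂ (λ_ (𝟙 X)).hom) ≫ eqToHom (G.map_id X) by
      simp only [G.mapComp_eq_eqToIso, Strict.leftUnitor_eqToIso, eqToIso.hom, eqToIso.inv,
        PrelaxFunctor.map₂_eqToHom, eqToHom_trans])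
    _ _ _ _ _ _

end Mnd
end Functors

/-! ### 2-natural transformations, 2-adjunctions, Eilenberg-Moore objects -/

section Adjunctions

/-- A (strict) 2-natural transformation between 2-functors. -/
structure NatTrans₂ {B : Type u} [Bicategory.{w, v} B] {C : Type u'} [Bicategory.{w', v'} C]
    (F G : StrictPseudofunctor B C) where
  app (X : B) : F.obj X ⟶ G.obj X
  naturality {X Y : B} (f : X ⟶ Y) : F.map f ≫ app Y = app X ≫ G.map f
  naturality₂ {X Y : B} {f g : X ⟶ Y} (σ : f ⟶ g) :
    F.map₂ σ ▷ app Y =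
      eqToHom (naturality f) ≫ app X ◁ G.map₂ σ ≫ eqToHom (naturality g).symm

/-- A right 2-adjoint of a 2-functor `L`: a 2-functor `right` with 2-natural unit and counit
satisfying the triangle identities. -/
structure RightAdjoint₂ {B : Type u} [Bicategory.{w, v} B] {C : Type u'} [Bicategory.{w', v'} C]
    (L : StrictPseudofunctor B C) where
  right : StrictPseudofunctor C B
  unit : NatTrans₂ (StrictPseudofunctor.id B) (L.comp right)
  counit : NatTrans₂ (right.comp L) (StrictPseudofunctor.id C)
  left_triangle (X : B) : L.map (unit.app X) ≫ counit.app (L.obj X) = 𝟙 (L.obj X)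
  right_triangle (Y : C) : unit.app (right.obj Y) ≫ right.map (counit.app Y) = 𝟙 (right.obj Y)

/-- A choice of Eilenberg-Moore objects: a right 2-adjoint `EM` of `ι : D ⟶ Mnd D`. -/
abbrev EMStructure (D : Type u) [Bicategory.{w, v} D] [Strict D] :=
  RightAdjoint₂ (Mnd.iota D)

/-- `D` admits Eilenberg-Moore objects. -/
def AdmitsEMObjects (D : Type u) [Bicategory.{w, v} D] [Strict D] : Prop :=
  Nonempty (EMStructure D)

section Standard

variable {D : Type u} [Bicategory.{w, v} D] [Strict D]
  {E : Type u'} [Bicategory.{w', v'} E] [Strict E]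

/-- The canonical 1-cell `G (EM S) ⟶ EM (Mnd(G) S)`: the transpose under `ι ⊣ EM` of the lax
morphism `ι (G (EM S)) = Mnd(G) (ι (EM S)) ⟶ Mnd(G) S` which is the image under `Mnd(G)` of the
counit at `S`. -/
def emComparison (G : StrictPseudofunctor D E) (P : EMStructure D) (Q : EMStructure E)
    (S : Mnd D) : G.obj (P.right.obj S) ⟶ Q.right.obj ((Mnd.map G).obj S) :=
  Q.unit.app (G.obj (P.right.obj S)) ≫ Q.right.map
    (eqToHom (Mnd.iota_comm_obj G (P.right.obj S)) ≫ (Mnd.map G).map (P.counit.app S))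

/-- `D` has standard Eilenberg-Moore objects with respect to `G : D ⟶ E`, where `D` and `E` admit
Eilenberg-Moore objects: whatever the right 2-adjoints chosen, the canonical 1-cells
`G (EM S) ⟶ EM (Mnd(G) S)` are the components of a 2-natural isomorphism. -/
def HasStandardEMObjects (G : StrictPseudofunctor D E) : Prop :=
  AdmitsEMObjects D ∧ AdmitsEMObjects E ∧
  ∀ (P : EMStructure D) (Q : EMStructure E),
    ∃ (θ : NatTrans₂ (P.right.comp G) ((Mnd.map G).comp Q.right))
      (θ' : NatTrans₂ ((Mnd.map G).comp Q.right) (P.right.comp G)),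
      (∀ S, θ.app S = emComparison G P Q S) ∧
      (∀ S, θ.app S ≫ θ'.app S = 𝟙 (G.obj (P.right.obj S))) ∧
      (∀ S, θ'.app S ≫ θ.app S = 𝟙 (Q.right.obj ((Mnd.map G).obj S)))

end Standard

end Adjunctions

/-! ### Finite products of 0-cells -/

section StrictLemmas

variable {D : Type u} [Bicategory.{w, v} D]

theorem whiskerRight_congr {a b c : D} {f f' : a ⟶ b} (η : f ⟶ f') {g g' : b ⟶ c} (h : g = g') :
    η ▷ g = eqToHom (by rw [h]) ≫ η ▷ g' ≫ eqToHom (by rw [h]) := by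
  subst h; simp

theorem whiskerLeft_congr {a b c : D} {f f' : a ⟶ b} (h : f = f') {g g' : b ⟶ c} (η : g ⟶ g') :
    f ◁ η = eqToHom (by rw [h]) ≫ f' ◁ η ≫ eqToHom (by rw [h]) := by
  subst h; simp

theorem eqToHom_conj_trans {X Y : D} {a b c a' b' c' : X ⟶ Y} (h : a = a') (σ : a' ⟶ b')
    (k : b' = b) (k' : b = b') (τ : b' ⟶ c') (l : c' = c) :
    (eqToHom h ≫ σ ≫ eqToHom k) ≫ eqToHom k' ≫ τ ≫ eqToHom l =
      eqToHom h ≫ (σ ≫ τ) ≫ eqToHom l := by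
  subst h k l; simp

theorem conj_inj {X Y : D} {a b a' b' : X ⟶ Y} (h : a = a') {σ τ : a' ⟶ b'} (k : b' = b)
    (e : eqToHom h ≫ σ ≫ eqToHom k = eqToHom h ≫ τ ≫ eqToHom k) : σ = τ := by
  subst h k; simpa using e

theorem whiskerRight_conj {X Y Z : D} {a b a' b' : X ⟶ Y} (h : a = a') (σ : a' ⟶ b') (k : b' = b)
    (F : Y ⟶ Z) : (eqToHom h ≫ σ ≫ eqToHom k) ▷ F =
      eqToHom (by rw [h]) ≫ σ ▷ F ≫ eqToHom (by rw [k]) := by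
  subst h k; simp

theorem id_conj {X Y : D} {a a' : X ⟶ Y} (h : a = a') :
    𝟙 a = eqToHom h ≫ 𝟙 a' ≫ eqToHom h.symm := by
  subst h; simp

variable [Strict D]

theorem strict_comp_whiskerLeft {a b c d : D} (f : a ⟶ b) (g : b ⟶ c) {h h' : c ⟶ d}
    (η : h ⟶ h') : (f ≫ g) ◁ η =
      eqToHom (Strict.assoc f g h) ≫ f ◁ g ◁ η ≫ eqToHom (Strict.assoc f g h').symm := by
  simp [Strict.associator_eqToIso]

theorem strict_whiskerRight_comp {a b c d : D} {f f' : a ⟶ b} (η : f ⟶ f') (g : b ⟶ c)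
    (h : c ⟶ d) : η ▷ (g ≫ h) =
      eqToHom (Strict.assoc f g h).symm ≫ η ▷ g ▷ h ≫ eqToHom (Strict.assoc f' g h) := by
  simp [Strict.associator_eqToIso]

theorem strict_whisker_assoc {a b c d : D} (f : a ⟶ b) {g g' : b ⟶ c} (η : g ⟶ g')
    (h : c ⟶ d) : (f ◁ η) ▷ h =
      eqToHom (Strict.assoc f g h) ≫ f ◁ η ▷ h ≫ eqToHom (Strict.assoc f g' h).symm := by
  simp [Strict.associator_eqToIso]

theorem strict_whiskerLeft_whiskerRight {a b c d : D} (f : a ⟶ b) {g g' : b ⟶ c} (η : g ⟶ g')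
    (h : c ⟶ d) : f ◁ η ▷ h =
      eqToHom (Strict.assoc f g h).symm ≫ (f ◁ η) ▷ h ≫ eqToHom (Strict.assoc f g' h) := by
  simp [Strict.associator_eqToIso]

theorem strict_id_whiskerLeft {a b : D} {f g : a ⟶ b} (η : f ⟶ g) : 𝟙 a ◁ η =
    eqToHom (Strict.id_comp f) ≫ η ≫ eqToHom (Strict.id_comp g).symm := by
  simp [Strict.leftUnitor_eqToIso]

theorem strict_whiskerRight_id {a b : D} {f g : a ⟶ b} (η : f ⟶ g) : η ▷ 𝟙 b =
    eqToHom (Strict.comp_id f) ≫ η ≫ eqToHom (Strict.comp_id g).symm := by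
  simp [Strict.rightUnitor_eqToIso]

theorem strict_pentagon {a b c d e : D} (f : a ⟶ b) (g : b ⟶ c) (h : c ⟶ d) (k : d ⟶ e) :
    eqToHom (Strict.assoc f g h) ▷ k ≫ eqToHom (Strict.assoc f (g ≫ h) k) ≫
      f ◁ eqToHom (Strict.assoc g h k) =
    eqToHom (Strict.assoc (f ≫ g) h k) ≫ eqToHom (Strict.assoc f g (h ≫ k)) := by
  simp

theorem strict_triangle {a b c : D} (f : a ⟶ b) (g : b ⟶ c) :
    eqToHom (Strict.assoc f (𝟙 b) g) ≫ f ◁ eqToHom (Strict.id_comp g) =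
      eqToHom (Strict.comp_id f) ▷ g := by
  simp

theorem whiskerLeft_of_comp_eq {a b c d : D} {x : a ⟶ b} {y : b ⟶ c} {z : a ⟶ c} (h : x ≫ y = z)
    {f g : c ⟶ d} (η : f ⟶ g) : x ◁ y ◁ η =
      eqToHom (by rw [← h, Strict.assoc]) ≫ z ◁ η ≫ eqToHom (by rw [← h, Strict.assoc]) := by
  subst h
  simp [Strict.associator_eqToIso]

end StrictLemmas

section Products

/-- Chosen finite products of 0-cells, in the strict 2-categorical sense: a terminal 0-cell `one`
(every hom-category `X ⟶ one` is the terminal category), and binary products `prod A B` with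
projections inducing isomorphisms of categories
`(X ⟶ prod A B) ≅ (X ⟶ A) × (X ⟶ B)`. -/
class FiniteProducts₂ (D : Type u) [Bicategory.{w, v} D] where
  one : D
  toOne (X : D) : X ⟶ one
  toOne_unique {X : D} (f : X ⟶ one) : f = toOne X
  one_hom_ext₂ {X : D} {f g : X ⟶ one} (σ τ : f ⟶ g) : σ = τ
  prod (A B : D) : D
  fst (A B : D) : prod A B ⟶ A
  snd (A B : D) : prod A B ⟶ B
  lift {X A B : D} (a : X ⟶ A) (b : X ⟶ B) : X ⟶ prod A B
  lift_fst {X A B : D} (a : X ⟶ A) (b : X ⟶ B) : lift a b ≫ fst A B = a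
  lift_snd {X A B : D} (a : X ⟶ A) (b : X ⟶ B) : lift a b ≫ snd A B = b
  hom_ext {X A B : D} {f g : X ⟶ prod A B} (h₁ : f ≫ fst A B = g ≫ fst A B)
    (h₂ : f ≫ snd A B = g ≫ snd A B) : f = g
  lift₂ {X A B : D} {f g : X ⟶ prod A B} (σ : f ≫ fst A B ⟶ g ≫ fst A B)
    (τ : f ≫ snd A B ⟶ g ≫ snd A B) : f ⟶ g
  lift₂_fst {X A B : D} {f g : X ⟶ prod A B} (σ : f ≫ fst A B ⟶ g ≫ fst A B)
    (τ : f ≫ snd A B ⟶ g ≫ snd A B) : lift₂ σ τ ▷ fst A B = σ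
  lift₂_snd {X A B : D} {f g : X ⟶ prod A B} (σ : f ≫ fst A B ⟶ g ≫ fst A B)
    (τ : f ≫ snd A B ⟶ g ≫ snd A B) : lift₂ σ τ ▷ snd A B = τ
  hom_ext₂ {X A B : D} {f g : X ⟶ prod A B} {σ τ : f ⟶ g}
    (h₁ : σ ▷ fst A B = τ ▷ fst A B) (h₂ : σ ▷ snd A B = τ ▷ snd A B) : σ = τ

open FiniteProducts₂

variable {D : Type u} [Bicategory.{w, v} D] [FiniteProducts₂ D]

/-- The pairing of 2-cells `⟨σ, τ⟩ : ⟨a, b⟩ ⟶ ⟨a', b'⟩`. -/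
def pair₂ {X A B : D} {a a' : X ⟶ A} {b b' : X ⟶ B} (σ : a ⟶ a') (τ : b ⟶ b') :
    lift a b ⟶ lift a' b' :=
  lift₂ (eqToHom (lift_fst a b) ≫ σ ≫ eqToHom (lift_fst a' b').symm)
    (eqToHom (lift_snd a b) ≫ τ ≫ eqToHom (lift_snd a' b').symm)

theorem pair₂_fst {X A B : D} {a a' : X ⟶ A} {b b' : X ⟶ B} (σ : a ⟶ a') (τ : b ⟶ b') :
    pair₂ σ τ ▷ fst A B = eqToHom (lift_fst a b) ≫ σ ≫ eqToHom (lift_fst a' b').symm :=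
  lift₂_fst _ _

theorem pair₂_snd {X A B : D} {a a' : X ⟶ A} {b b' : X ⟶ B} (σ : a ⟶ a') (τ : b ⟶ b') :
    pair₂ σ τ ▷ snd A B = eqToHom (lift_snd a b) ≫ τ ≫ eqToHom (lift_snd a' b').symm :=
  lift₂_snd _ _

/-- The product `⊗ ∘ ⟨a, b⟩` of two generalized elements of `C`, for `⊗ : C × C ⟶ C`. -/
def tens {X C : D} (m : prod C C ⟶ C) (a b : X ⟶ C) : X ⟶ C := lift a b ≫ m

/-- The 2-cell `⊗⟨σ, τ⟩ : ⊗ ∘ ⟨a, b⟩ ⟶ ⊗ ∘ ⟨a', b'⟩`. -/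
def tens₂ {X C : D} (m : prod C C ⟶ C) {a a' b b' : X ⟶ C} (σ : a ⟶ a') (τ : b ⟶ b') :
    tens m a b ⟶ tens m a' b' := pair₂ σ τ ▷ m

/-- The constant generalized element of `C` at `I : 1 ⟶ C`. -/
def const {C : D} (I : one ⟶ C) (X : D) : X ⟶ C := toOne X ≫ I

theorem pair₂_comp {X A B : D} {a a' a'' : X ⟶ A} {b b' b'' : X ⟶ B} (σ : a ⟶ a')
    (σ' : a' ⟶ a'') (τ : b ⟶ b') (τ' : b' ⟶ b'') :
    pair₂ (σ ≫ σ') (τ ≫ τ') = pair₂ σ τ ≫ pair₂ σ' τ' := by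
  apply hom_ext₂ <;> simp [pair₂_fst, pair₂_snd]

theorem pair₂_eqToHom {X A B : D} {a a' : X ⟶ A} {b b' : X ⟶ B} (h : a = a') (k : b = b') :
    pair₂ (eqToHom h) (eqToHom k) = eqToHom (by rw [h, k]) := by
  subst h k
  apply hom_ext₂ <;> simp [pair₂_fst, pair₂_snd]

theorem tens₂_comp {X C : D} (m : prod C C ⟶ C) {a a' a'' b b' b'' : X ⟶ C} (σ : a ⟶ a')
    (σ' : a' ⟶ a'') (τ : b ⟶ b') (τ' : b' ⟶ b'') :
    tens₂ m (σ ≫ σ') (τ ≫ τ') = tens₂ m σ τ ≫ tens₂ m σ' τ' := by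
  rw [tens₂, pair₂_comp, comp_whiskerRight]; rfl

theorem tens₂_eqToHom {X C : D} (m : prod C C ⟶ C) {a a' b b' : X ⟶ C}
    (h : a = a') (k : b = b') :
    tens₂ m (eqToHom h) (eqToHom k) = eqToHom (by rw [h, k]) := by
  rw [tens₂, pair₂_eqToHom, eqToHom_whiskerRight]; rfl

theorem tens₂_id {X C : D} (m : prod C C ⟶ C) (a b : X ⟶ C) :
    tens₂ m (𝟙 a) (𝟙 b) = 𝟙 _ := tens₂_eqToHom m rfl rfl

theorem tens₂_conj {X C : D} (m : prod C C ⟶ C) {a a' b b' c c' d d' : X ⟶ C}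
    (h : a = a') (σ : a' ⟶ b') (h' : b' = b) (k : c = c') (τ : c' ⟶ d') (k' : d' = d) :
    tens₂ m (eqToHom h ≫ σ ≫ eqToHom h') (eqToHom k ≫ τ ≫ eqToHom k') =
      eqToHom (by rw [h, k]) ≫ tens₂ m σ τ ≫ eqToHom (by rw [h', k']) := by
  subst h h' k k'; simp

theorem tens₂_id_left_conj {X C : D} (m : prod C C ⟶ C) {a a' b b' c c' : X ⟶ C}
    (h : a = a') (k : b = b') (σ : b' ⟶ c') (k' : c' = c) :
    tens₂ m (𝟙 a) (eqToHom k ≫ σ ≫ eqToHom k') =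
      eqToHom (by rw [h, k]) ≫ tens₂ m (𝟙 a') σ ≫ eqToHom (by rw [h, k']) := by
  subst h k k'; simp

theorem tens₂_id_right_conj {X C : D} (m : prod C C ⟶ C) {a a' b b' c c' : X ⟶ C}
    (h : a = a') (k : b = b') (σ : b' ⟶ c') (k' : c' = c) :
    tens₂ m (eqToHom k ≫ σ ≫ eqToHom k') (𝟙 a) =
      eqToHom (by rw [h, k]) ≫ tens₂ m σ (𝟙 a') ≫ eqToHom (by rw [h, k']) := by
  subst h k k'; simp

variable [Strict D]

theorem comp_lift {X Y A B : D} (x : Y ⟶ X) (a : X ⟶ A) (b : X ⟶ B) :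
    x ≫ lift a b = lift (x ≫ a) (x ≫ b) := by
  apply hom_ext
  · rw [Strict.assoc, lift_fst, lift_fst]
  · rw [Strict.assoc, lift_snd, lift_snd]

theorem comp_tens {X Y C : D} (x : Y ⟶ X) (m : prod C C ⟶ C) (a b : X ⟶ C) :
    x ≫ tens m a b = tens m (x ≫ a) (x ≫ b) := by
  rw [tens, ← Strict.assoc, comp_lift]; rfl

theorem comp_const {X Y C : D} (x : Y ⟶ X) (I : one ⟶ C) : x ≫ const I X = const I Y := by
  rw [const, ← Strict.assoc, toOne_unique (x ≫ toOne X)]; rfl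

theorem tens_comp {X C E : D} (m : prod C C ⟶ C) (a b : X ⟶ C) (F : C ⟶ E) :
    tens m a b ≫ F = lift a b ≫ m ≫ F := Strict.assoc _ _ _

theorem const_comp {C E : D} (I : one ⟶ C) (X : D) (F : C ⟶ E) :
    const I X ≫ F = toOne X ≫ I ≫ F := Strict.assoc _ _ _

theorem tens₂_whiskerRight {X C E : D} (m : prod C C ⟶ C) {a a' b b' : X ⟶ C}
    (σ : a ⟶ a') (τ : b ⟶ b') (F : C ⟶ E) :
    tens₂ m σ τ ▷ F = eqToHom (tens_comp m a b F) ≫ pair₂ σ τ ▷ (m ≫ F) ≫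
      eqToHom (tens_comp m a' b' F).symm := by
  rw [strict_whiskerRight_comp]
  simp only [Category.assoc, eqToHom_trans, eqToHom_trans_assoc]
  exact ((Category.id_comp _).trans (Category.comp_id _)).symm

theorem lift_comp_fst {X A B C : D} (a : X ⟶ A) (b : X ⟶ B) (f : A ⟶ C) :
    lift a b ≫ fst A B ≫ f = a ≫ f := by
  rw [← Strict.assoc, lift_fst]

theorem lift_comp_snd {X A B C : D} (a : X ⟶ A) (b : X ⟶ B) (f : B ⟶ C) :
    lift a b ≫ snd A B ≫ f = b ≫ f := by
  rw [← Strict.assoc, lift_snd]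

theorem lift_fst_snd {A B : D} : lift (fst A B) (snd A B) = 𝟙 (prod A B) := by
  apply hom_ext
  · rw [lift_fst, Strict.id_comp]
  · rw [lift_snd, Strict.id_comp]

theorem tens_fst_snd {C : D} (m : prod C C ⟶ C) : tens m (fst C C) (snd C C) = m := by
  rw [tens, lift_fst_snd, Strict.id_comp]

theorem whiskerLeft_pair₂ {X Y A B : D} (x : Y ⟶ X) {a a' : X ⟶ A} {b b' : X ⟶ B}
    (σ : a ⟶ a') (τ : b ⟶ b') :
    x ◁ pair₂ σ τ = eqToHom (comp_lift x a b) ≫ pair₂ (x ◁ σ) (x ◁ τ) ≫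
      eqToHom (comp_lift x a' b').symm := by
  apply hom_ext₂ <;>
  simp [pair₂_fst, pair₂_snd, whisker_assoc, Strict.associator_eqToIso]

theorem whiskerLeft_tens₂ {X Y C : D} (x : Y ⟶ X) (m : prod C C ⟶ C) {a a' b b' : X ⟶ C}
    (σ : a ⟶ a') (τ : b ⟶ b') :
    x ◁ tens₂ m σ τ = eqToHom (comp_tens x m a b) ≫ tens₂ m (x ◁ σ) (x ◁ τ) ≫
      eqToHom (comp_tens x m a' b').symm := by
  have h := congrArg (· ▷ m) (whiskerLeft_pair₂ x σ τ)
  simp only [whisker_assoc, Strict.associator_eqToIso, comp_whiskerRight, eqToIso.hom,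
    eqToIso.inv, eqToHom_whiskerRight] at h
  have h' := eqToHom (Strict.assoc x (lift a b) m).symm ≫= h =≫
    eqToHom (Strict.assoc x (lift a' b') m)
  simp only [Category.assoc, eqToHom_trans, eqToHom_trans_assoc, eqToHom_refl, Category.id_comp,
    Category.comp_id] at h'
  exact h'

theorem pair₂_whisker_lift {X A B C : D} (F : A ⟶ B) (G : A ⟶ C) {a a' b b' : X ⟶ A}
    (σ : a ⟶ a') (τ : b ⟶ b') :
    pair₂ σ τ ▷ lift (fst A A ≫ F) (snd A A ≫ G) =
      eqToHom (by rw [comp_lift, lift_comp_fst, lift_comp_snd]) ≫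
        pair₂ (σ ▷ F) (τ ▷ G) ≫
          eqToHom (by rw [comp_lift, lift_comp_fst, lift_comp_snd]) := by
  apply hom_ext₂
  · have h := whiskerRight_congr (pair₂ σ τ) (lift_fst (fst A A ≫ F) (snd A A ≫ G))
    rw [strict_whiskerRight_comp, strict_whiskerRight_comp, pair₂_fst] at h
    have h' := eqToHom (Strict.assoc _ _ _) ≫= h =≫ eqToHom (Strict.assoc _ _ _).symm
    simpa [pair₂_fst] using h'
  · have h := whiskerRight_congr (pair₂ σ τ) (lift_snd (fst A A ≫ F) (snd A A ≫ G))
    rw [strict_whiskerRight_comp, strict_whiskerRight_comp, pair₂_snd] at h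
    have h' := eqToHom (Strict.assoc _ _ _) ≫= h =≫ eqToHom (Strict.assoc _ _ _).symm
    simpa [pair₂_snd] using h'

/-- Whiskering a pairing of 2-cells with `⊗ ∘ (F × F)`. -/
theorem pair₂_whisker_tens {X A C : D} (m : prod C C ⟶ C) (F : A ⟶ C) {a a' b b' : X ⟶ A}
    (σ : a ⟶ a') (τ : b ⟶ b') :
    pair₂ σ τ ▷ tens m (fst A A ≫ F) (snd A A ≫ F) =
      eqToHom (by rw [comp_tens, lift_comp_fst, lift_comp_snd]) ≫
        tens₂ m (σ ▷ F) (τ ▷ F) ≫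
          eqToHom (by rw [comp_tens, lift_comp_fst, lift_comp_snd]) := by
  change pair₂ σ τ ▷ (lift (fst A A ≫ F) (snd A A ≫ F) ≫ m) = _
  rw [whiskerRight_comp, pair₂_whisker_lift]
  simp [Strict.associator_eqToIso, tens₂]
  rfl

end Products

/-! ### Monoidal objects -/

section Monoidal

open FiniteProducts₂

/-- The data of a monoidal object: a 0-cell `C`, 1-cells `⊗ : C × C ⟶ C` and `I : 1 ⟶ C`, and
invertible 2-cells `α : ⊗ ∘ (1 × ⊗) ⟶ ⊗ ∘ (⊗ × 1)`, `λ : ⊗ ∘ ⟨I, 1⟩ ⟶ 1`, `ρ : ⊗ ∘ ⟨1, I⟩ ⟶ 1`. The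
triple product is `C × (C × C)`. -/
structure MonoidalData (D : Type u) [Bicategory.{w, v} D] [FiniteProducts₂ D] where
  obj : D
  tensor : prod obj obj ⟶ obj
  unit : one ⟶ obj
  assoc : tens tensor (fst obj (prod obj obj))
      (tens tensor (snd obj (prod obj obj) ≫ fst obj obj) (snd obj (prod obj obj) ≫ snd obj obj)) ≅
    tens tensor (tens tensor (fst obj (prod obj obj)) (snd obj (prod obj obj) ≫ fst obj obj))
      (snd obj (prod obj obj) ≫ snd obj obj)
  lam : tens tensor (const unit obj) (𝟙 obj) ≅ 𝟙 obj
  rho : tens tensor (𝟙 obj) (const unit obj) ≅ 𝟙 obj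

namespace MonoidalData

variable {D : Type u} [Bicategory.{w, v} D] [FiniteProducts₂ D] [Strict D]

/-- The component `α_{a,b,c}` at generalized elements: `α` whiskered with `⟨a, b, c⟩`. -/
def assocAt (M : MonoidalData D) {X : D} (a b c : X ⟶ M.obj) :
    tens M.tensor a (tens M.tensor b c) ⟶ tens M.tensor (tens M.tensor a b) c :=
  eqToHom (by simp only [comp_tens, lift_fst, lift_comp_snd, lift_snd]) ≫
    lift a (lift b c) ◁ M.assoc.hom ≫
      eqToHom (by simp only [comp_tens, lift_fst, lift_comp_snd, lift_snd])

/-- The component `λ_a` at a generalized element. -/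
def lamAt (M : MonoidalData D) {X : D} (a : X ⟶ M.obj) :
    tens M.tensor (const M.unit X) a ⟶ a :=
  eqToHom (by rw [comp_tens, comp_const, Strict.comp_id]) ≫ a ◁ M.lam.hom ≫
    eqToHom (Strict.comp_id a)

/-- The component `ρ_a` at a generalized element. -/
def rhoAt (M : MonoidalData D) {X : D} (a : X ⟶ M.obj) :
    tens M.tensor a (const M.unit X) ⟶ a :=
  eqToHom (by rw [comp_tens, comp_const, Strict.comp_id]) ≫ a ◁ M.rho.hom ≫
    eqToHom (Strict.comp_id a)

/-- The pentagon at four generalized elements. -/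
def PentagonAt (M : MonoidalData D) {X : D} (a b c d : X ⟶ M.obj) : Prop :=
  tens₂ M.tensor (𝟙 a) (M.assocAt b c d) ≫ M.assocAt a (tens M.tensor b c) d ≫
      tens₂ M.tensor (M.assocAt a b c) (𝟙 d) =
    M.assocAt a b (tens M.tensor c d) ≫ M.assocAt (tens M.tensor a b) c d

/-- The triangle at two generalized elements. -/
def TriangleAt (M : MonoidalData D) {X : D} (a b : X ⟶ M.obj) : Prop :=
  M.assocAt a (const M.unit X) b ≫ tens₂ M.tensor (M.rhoAt a) (𝟙 b) =
    tens₂ M.tensor (𝟙 a) (M.lamAt b)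

end MonoidalData

/-- A monoidal object in `D`: the pentagon holds at the four projections of `C × C × C × C`, and
the triangle at the two projections of `C × C`. -/
structure MonOp (D : Type u) [Bicategory.{w, v} D] [FiniteProducts₂ D] [Strict D] extends
    MonoidalData D where
  pentagon : toMonoidalData.PentagonAt
    (fst obj (prod obj (prod obj obj)))
    (snd obj (prod obj (prod obj obj)) ≫ fst obj (prod obj obj))
    (snd obj (prod obj (prod obj obj)) ≫ snd obj (prod obj obj) ≫ fst obj obj)
    (snd obj (prod obj (prod obj obj)) ≫ snd obj (prod obj obj) ≫ snd obj obj)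
  triangle : toMonoidalData.TriangleAt (fst obj obj) (snd obj obj)

namespace MonOp

variable {D : Type u} [Bicategory.{w, v} D] [FiniteProducts₂ D] [Strict D]

/-- The data `F : C ⟶ C'`, `φ : F ∘ ⊗ ⟶ ⊗' ∘ (F × F)`, `φ₀ : F ∘ I ⟶ I'` of an oplax monoidal
morphism. -/
structure HomData (M N : MonOp D) where
  hom : M.obj ⟶ N.obj
  cell : M.tensor ≫ hom ⟶ tens N.tensor (fst M.obj M.obj ≫ hom) (snd M.obj M.obj ≫ hom)
  cell₀ : M.unit ≫ hom ⟶ N.unit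

namespace HomData

variable {M N : MonOp D}

/-- The component `φ_{a,b} : F ∘ (a ⊗ b) ⟶ (F ∘ a) ⊗' (F ∘ b)` at generalized elements. -/
def cellAt (F : HomData M N) {X : D} (a b : X ⟶ M.obj) :
    tens M.tensor a b ≫ F.hom ⟶ tens N.tensor (a ≫ F.hom) (b ≫ F.hom) :=
  eqToHom (tens_comp _ a b F.hom) ≫ lift a b ◁ F.cell ≫
    eqToHom (by rw [comp_tens, lift_comp_fst, lift_comp_snd])

/-- The component of `φ₀` at the constant generalized elements. -/
def cell₀At (F : HomData M N) (X : D) : const M.unit X ≫ F.hom ⟶ const N.unit X :=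
  eqToHom (const_comp _ X F.hom) ≫ toOne X ◁ F.cell₀ ≫ eqToHom (by rw [const])

/-- Compatibility with the associativity cells at three generalized elements. -/
def AssocAt (F : HomData M N) {X : D} (a b c : X ⟶ M.obj) : Prop :=
  F.cellAt a (tens M.tensor b c) ≫ tens₂ N.tensor (𝟙 (a ≫ F.hom)) (F.cellAt b c) ≫
      N.assocAt (a ≫ F.hom) (b ≫ F.hom) (c ≫ F.hom) =
    M.assocAt a b c ▷ F.hom ≫ F.cellAt (tens M.tensor a b) c ≫
      tens₂ N.tensor (F.cellAt a b) (𝟙 (c ≫ F.hom))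

/-- Compatibility with the left unit cells at a generalized element. -/
def LamAt (F : HomData M N) {X : D} (a : X ⟶ M.obj) : Prop :=
  F.cellAt (const M.unit X) a ≫ tens₂ N.tensor (F.cell₀At X) (𝟙 (a ≫ F.hom)) ≫
    N.lamAt (a ≫ F.hom) = M.lamAt a ▷ F.hom

/-- Compatibility with the right unit cells at a generalized element. -/
def RhoAt (F : HomData M N) {X : D} (a : X ⟶ M.obj) : Prop :=
  F.cellAt a (const M.unit X) ≫ tens₂ N.tensor (𝟙 (a ≫ F.hom)) (F.cell₀At X) ≫
    N.rhoAt (a ≫ F.hom) = M.rhoAt a ▷ F.hom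

end HomData

/-- An oplax monoidal morphism of monoidal objects: the three coherence diagrams hold at the
projections of `C × C × C` and at `1 : C ⟶ C`. -/
structure Hom (M N : MonOp D) extends HomData M N where
  assoc_cell : toHomData.AssocAt (fst M.obj (prod M.obj M.obj))
    (snd M.obj (prod M.obj M.obj) ≫ fst M.obj M.obj)
    (snd M.obj (prod M.obj M.obj) ≫ snd M.obj M.obj)
  lam_cell : toHomData.LamAt (𝟙 M.obj)
  rho_cell : toHomData.RhoAt (𝟙 M.obj)

/-- A transformation of oplax monoidal morphisms. -/
@[ext]
structure Hom₂ {M N : MonOp D} (F G : Hom M N) where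
  hom : F.hom ⟶ G.hom
  comm : F.cell ≫ tens₂ N.tensor (fst M.obj M.obj ◁ hom) (snd M.obj M.obj ◁ hom) =
    M.tensor ◁ hom ≫ G.cell
  comm₀ : M.unit ◁ hom ≫ G.cell₀ = F.cell₀

/-! Stability of the components under substitution of generalized elements. -/

theorem assocAt_congr (M : MonoidalData D) {X : D} {a b c a' b' c' : X ⟶ M.obj} (ha : a = a')
    (hb : b = b') (hc : c = c') : M.assocAt a b c =
      eqToHom (by rw [ha, hb, hc]) ≫ M.assocAt a' b' c' ≫ eqToHom (by rw [ha, hb, hc]) := by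
  subst ha hb hc; simp

theorem lamAt_congr (M : MonoidalData D) {X : D} {a a' : X ⟶ M.obj} (ha : a = a') :
    M.lamAt a = eqToHom (by rw [ha]) ≫ M.lamAt a' ≫ eqToHom (by rw [ha]) := by
  subst ha; simp

theorem rhoAt_congr (M : MonoidalData D) {X : D} {a a' : X ⟶ M.obj} (ha : a = a') :
    M.rhoAt a = eqToHom (by rw [ha]) ≫ M.rhoAt a' ≫ eqToHom (by rw [ha]) := by
  subst ha; simp

theorem whiskerLeft_assocAt (M : MonoidalData D) {X Y : D} (x : Y ⟶ X) (a b c : X ⟶ M.obj) :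
    x ◁ M.assocAt a b c = eqToHom (by simp only [comp_tens]) ≫
      M.assocAt (x ≫ a) (x ≫ b) (x ≫ c) ≫ eqToHom (by simp only [comp_tens]) := by
  have e : x ≫ lift a (lift b c) = lift (x ≫ a) (lift (x ≫ b) (x ≫ c)) := by
    rw [comp_lift, comp_lift]
  simp only [MonoidalData.assocAt, whiskerLeft_comp, whiskerLeft_eqToHom]
  have h := (strict_comp_whiskerLeft x (lift a (lift b c)) M.assoc.hom).symm.trans
    (whiskerLeft_congr e M.assoc.hom)
  have h' := eqToHom (Strict.assoc _ _ _).symm ≫= h =≫ eqToHom (Strict.assoc _ _ _)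
  simp only [Category.assoc, eqToHom_trans, eqToHom_trans_assoc, eqToHom_refl, Category.id_comp,
    Category.comp_id] at h'
  simp only [h', Category.assoc, eqToHom_trans, eqToHom_trans_assoc]

theorem whiskerLeft_lamAt (M : MonoidalData D) {X Y : D} (x : Y ⟶ X) (a : X ⟶ M.obj) :
    x ◁ M.lamAt a = eqToHom (by rw [comp_tens, comp_const]) ≫ M.lamAt (x ≫ a) := by
  simp [MonoidalData.lamAt, Strict.associator_eqToIso]

theorem whiskerLeft_rhoAt (M : MonoidalData D) {X Y : D} (x : Y ⟶ X) (a : X ⟶ M.obj) :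
    x ◁ M.rhoAt a = eqToHom (by rw [comp_tens, comp_const]) ≫ M.rhoAt (x ≫ a) := by
  simp [MonoidalData.rhoAt, Strict.associator_eqToIso]

namespace HomData

variable {M N : MonOp D}

theorem cellAt_congr (F : HomData M N) {X : D} {a a' b b' : X ⟶ M.obj} (ha : a = a')
    (hb : b = b') : F.cellAt a b =
      eqToHom (by rw [ha, hb]) ≫ F.cellAt a' b' ≫ eqToHom (by rw [ha, hb]) := by
  subst ha hb; simp

theorem whiskerLeft_cellAt (F : HomData M N) {X Y : D} (x : Y ⟶ X) (a b : X ⟶ M.obj) :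
    x ◁ F.cellAt a b = eqToHom (by rw [← Strict.assoc, comp_tens]) ≫
      F.cellAt (x ≫ a) (x ≫ b) ≫ eqToHom (by rw [comp_tens, Strict.assoc, Strict.assoc]) := by
  simp only [cellAt, whiskerLeft_comp, whiskerLeft_eqToHom]
  have h := (strict_comp_whiskerLeft x (lift a b) F.cell).symm.trans
    (whiskerLeft_congr (comp_lift x a b) F.cell)
  have h' := eqToHom (Strict.assoc _ _ _).symm ≫= h =≫ eqToHom (Strict.assoc _ _ _)
  simp only [Category.assoc, eqToHom_trans, eqToHom_trans_assoc, eqToHom_refl, Category.id_comp,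
    Category.comp_id] at h'
  simp only [h', Category.assoc, eqToHom_trans, eqToHom_trans_assoc]

theorem whiskerLeft_cell₀At (F : HomData M N) {X Y : D} (x : Y ⟶ X) :
    x ◁ F.cell₀At X = eqToHom (by rw [← Strict.assoc, comp_const]) ≫ F.cell₀At Y ≫
      eqToHom (comp_const x N.unit).symm := by
  simp only [cell₀At, whiskerLeft_comp, whiskerLeft_eqToHom]
  have h := (strict_comp_whiskerLeft x (toOne X) F.cell₀).symm.trans
    (whiskerLeft_congr (toOne_unique _) F.cell₀)
  have h' := eqToHom (Strict.assoc _ _ _).symm ≫= h =≫ eqToHom (Strict.assoc _ _ _)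
  simp only [Category.assoc, eqToHom_trans, eqToHom_trans_assoc, eqToHom_refl, Category.id_comp,
    Category.comp_id] at h'
  simp only [h', Category.assoc, eqToHom_trans, eqToHom_trans_assoc]

theorem cellAt_naturality (F : HomData M N) {X : D} {a a' b b' : X ⟶ M.obj} (σ : a ⟶ a')
    (τ : b ⟶ b') : tens₂ M.tensor σ τ ▷ F.hom ≫ F.cellAt a' b' =
      F.cellAt a b ≫ tens₂ N.tensor (σ ▷ F.hom) (τ ▷ F.hom) := by
  have h := whisker_exchange (pair₂ σ τ) F.cell
  rw [pair₂_whisker_tens] at h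
  have h' := eqToHom (tens_comp _ a b F.hom) ≫= h.symm =≫
    eqToHom (by rw [comp_tens, lift_comp_fst, lift_comp_snd])
  simp only [Category.assoc, eqToHom_trans, eqToHom_refl, Category.comp_id] at h'
  simp only [cellAt, tens₂_whiskerRight, Category.assoc, eqToHom_trans_assoc, eqToHom_refl,
    Category.id_comp, h']

theorem AssocAt.whisker {F : HomData M N} {X Y : D} (x : Y ⟶ X) {a b c : X ⟶ M.obj}
    (h : F.AssocAt a b c) : F.AssocAt (x ≫ a) (x ≫ b) (x ≫ c) := by
  unfold AssocAt at h ⊢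
  have e := congrArg (x ◁ ·) h
  simp only [whiskerLeft_comp, whiskerLeft_cellAt, whiskerLeft_tens₂, whiskerLeft_assocAt,
    whiskerLeft_id, strict_whiskerLeft_whiskerRight, whiskerRight_conj] at e
  rw [F.cellAt_congr rfl (comp_tens x _ b c), F.cellAt_congr (comp_tens x _ a b) rfl,
    tens₂_id_left_conj _ (Strict.assoc x a F.hom).symm,
    tens₂_id_right_conj _ (Strict.assoc x c F.hom).symm,
    assocAt_congr _ (Strict.assoc x a F.hom).symm (Strict.assoc x b F.hom).symm
      (Strict.assoc x c F.hom).symm] at e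
  simp only [Category.assoc, eqToHom_trans, eqToHom_trans_assoc, eqToHom_refl,
    Category.id_comp] at e
  refine conj_inj (a := x ≫ tens M.tensor a (tens M.tensor b c) ≫ F.hom)
    (b := x ≫ tens N.tensor (tens N.tensor (a ≫ F.hom) (b ≫ F.hom)) (c ≫ F.hom))
    (by simp only [← Strict.assoc, comp_tens]) (by simp only [Strict.assoc, comp_tens]) ?_
  simpa only [Category.assoc] using e

theorem LamAt.whisker {F : HomData M N} {X Y : D} (x : Y ⟶ X) {a : X ⟶ M.obj}
    (h : F.LamAt a) : F.LamAt (x ≫ a) := by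
  unfold LamAt at h ⊢
  have e := congrArg (x ◁ ·) h
  simp only [whiskerLeft_comp, whiskerLeft_cellAt, whiskerLeft_tens₂, whiskerLeft_lamAt,
    whiskerLeft_cell₀At, whiskerLeft_id, strict_whiskerLeft_whiskerRight] at e
  rw [F.cellAt_congr (comp_const x _) rfl,
    tens₂_id_right_conj _ (Strict.assoc x a F.hom).symm,
    lamAt_congr _ (Strict.assoc x a F.hom).symm] at e
  simp only [Category.assoc, eqToHom_trans, eqToHom_trans_assoc, eqToHom_refl,
    Category.id_comp, comp_whiskerRight, eqToHom_whiskerRight] at e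
  refine conj_inj (a := x ≫ tens M.tensor (const M.unit X) a ≫ F.hom)
    (b := x ≫ a ≫ F.hom)
    (by simp only [← Strict.assoc, comp_tens, comp_const]) (by simp only [Strict.assoc]) ?_
  simpa only [Category.assoc] using e

theorem RhoAt.whisker {F : HomData M N} {X Y : D} (x : Y ⟶ X) {a : X ⟶ M.obj}
    (h : F.RhoAt a) : F.RhoAt (x ≫ a) := by
  unfold RhoAt at h ⊢
  have e := congrArg (x ◁ ·) h
  simp only [whiskerLeft_comp, whiskerLeft_cellAt, whiskerLeft_tens₂, whiskerLeft_rhoAt,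
    whiskerLeft_cell₀At, whiskerLeft_id, strict_whiskerLeft_whiskerRight] at e
  rw [F.cellAt_congr rfl (comp_const x _),
    tens₂_id_left_conj _ (Strict.assoc x a F.hom).symm,
    rhoAt_congr _ (Strict.assoc x a F.hom).symm] at e
  simp only [Category.assoc, eqToHom_trans, eqToHom_trans_assoc, eqToHom_refl,
    Category.id_comp, comp_whiskerRight, eqToHom_whiskerRight] at e
  refine conj_inj (a := x ≫ tens M.tensor a (const M.unit X) ≫ F.hom)
    (b := x ≫ a ≫ F.hom)
    (by simp only [← Strict.assoc, comp_tens, comp_const]) (by simp only [Strict.assoc]) ?_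
  simpa only [Category.assoc] using e

end HomData

namespace Hom

variable {M N : MonOp D}

theorem assocAt (F : Hom M N) {X : D} (a b c : X ⟶ M.obj) : F.AssocAt a b c := by
  have h := F.assoc_cell.whisker (lift a (lift b c))
  rwa [lift_fst, lift_comp_snd, lift_comp_snd, lift_fst, lift_snd] at h

theorem lamAt (F : Hom M N) {X : D} (a : X ⟶ M.obj) : F.LamAt a := by
  have h := F.lam_cell.whisker a
  rwa [Strict.comp_id] at h

theorem rhoAt (F : Hom M N) {X : D} (a : X ⟶ M.obj) : F.RhoAt a := by
  have h := F.rho_cell.whisker a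
  rwa [Strict.comp_id] at h

end Hom

namespace HomData

variable {M N P : MonOp D}

/-- The data of the identity morphism. -/
def id (M : MonOp D) : HomData M M where
  hom := 𝟙 M.obj
  cell := eqToHom (by simp only [Strict.comp_id, tens_fst_snd])
  cell₀ := eqToHom (Strict.comp_id _)

/-- The data of the composite morphism: `φ` is `ψ_{F × F} ∘ G(φ)`, and `φ₀` is `ψ₀ ∘ G(φ₀)`. -/
def comp (F : HomData M N) (G : HomData N P) : HomData M P where
  hom := F.hom ≫ G.hom
  cell := eqToHom (Strict.assoc _ _ _).symm ≫ F.cell ▷ G.hom ≫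
    G.cellAt (fst M.obj M.obj ≫ F.hom) (snd M.obj M.obj ≫ F.hom) ≫
      eqToHom (by rw [Strict.assoc, Strict.assoc])
  cell₀ := eqToHom (Strict.assoc _ _ _).symm ≫ F.cell₀ ▷ G.hom ≫ G.cell₀

/-- `H` is the identity, up to equality of the underlying 1-cell. -/
structure IsId (H : HomData M M) : Prop where
  hom : H.hom = 𝟙 M.obj
  cell : H.cell = eqToHom (by simp only [hom, Strict.comp_id, tens_fst_snd])
  cell₀ : H.cell₀ = eqToHom (by rw [hom, Strict.comp_id])

/-- `H` is the composite of `F` and `G`, up to equality of the underlying 1-cell. -/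
structure IsComp (F : HomData M N) (G : HomData N P) (H : HomData M P) : Prop where
  hom : F.hom ≫ G.hom = H.hom
  cell : H.cell = eqToHom (by rw [← hom, Strict.assoc]) ≫ F.cell ▷ G.hom ≫
    G.cellAt (fst M.obj M.obj ≫ F.hom) (snd M.obj M.obj ≫ F.hom) ≫
      eqToHom (by rw [← hom, Strict.assoc, Strict.assoc])
  cell₀ : H.cell₀ = eqToHom (by rw [← hom, Strict.assoc]) ≫ F.cell₀ ▷ G.hom ≫ G.cell₀

theorem isId_id (M : MonOp D) : IsId (id M) := ⟨rfl, rfl, rfl⟩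

theorem isComp_comp (F : HomData M N) (G : HomData N P) : IsComp F G (F.comp G) :=
  ⟨rfl, rfl, rfl⟩

namespace IsId

theorem comp_hom {H : HomData M M} (h : IsId H) {X : D} (a : X ⟶ M.obj) : a ≫ H.hom = a := by rw [h.hom, Strict.comp_id]

theorem cellAt {H : HomData M M} (h : IsId H) {X : D} (a b : X ⟶ M.obj) :
    H.cellAt a b = eqToHom (by simp only [h.comp_hom]) := by
  rw [HomData.cellAt, h.cell]
  simp only [whiskerLeft_eqToHom, eqToHom_trans]

theorem cell₀At {H : HomData M M} (h : IsId H) (X : D) : H.cell₀At X = eqToHom (by simp only [h.comp_hom]) := by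
  rw [HomData.cell₀At, h.cell₀]
  simp only [whiskerLeft_eqToHom, eqToHom_trans]

theorem whiskerRight {H : HomData M M} (h : IsId H) {X : D} {a b : X ⟶ M.obj} (σ : a ⟶ b) : σ ▷ H.hom =
    eqToHom (h.comp_hom a) ≫ σ ≫ eqToHom (h.comp_hom b).symm := by
  rw [whiskerRight_congr σ h.hom, strict_whiskerRight_id]
  simp only [Category.assoc, eqToHom_trans, eqToHom_trans_assoc]

theorem assocAt {H : HomData M M} (h : IsId H) {X : D} (a b c : X ⟶ M.obj) : H.AssocAt a b c := by
  unfold AssocAt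
  rw [h.cellAt, h.cellAt, h.cellAt, h.cellAt, h.whiskerRight,
    assocAt_congr _ (h.comp_hom a) (h.comp_hom b) (h.comp_hom c),
    ← eqToHom_refl _ rfl, ← eqToHom_refl _ rfl, tens₂_eqToHom, tens₂_eqToHom]
  simp only [Category.assoc, eqToHom_trans, eqToHom_trans_assoc]

theorem lamAt {H : HomData M M} (h : IsId H) {X : D} (a : X ⟶ M.obj) : H.LamAt a := by
  unfold LamAt
  rw [h.cellAt, h.cell₀At, h.whiskerRight, lamAt_congr _ (h.comp_hom a),
    ← eqToHom_refl _ rfl, tens₂_eqToHom]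
  simp only [eqToHom_trans_assoc]

theorem rhoAt {H : HomData M M} (h : IsId H) {X : D} (a : X ⟶ M.obj) : H.RhoAt a := by
  unfold RhoAt
  rw [h.cellAt, h.cell₀At, h.whiskerRight, rhoAt_congr _ (h.comp_hom a),
    ← eqToHom_refl _ rfl, tens₂_eqToHom]
  simp only [eqToHom_trans_assoc]

end IsId

namespace IsComp

variable {F : HomData M N} {G : HomData N P} {H : HomData M P}

theorem comp_hom (h : IsComp F G H) {X : D} (a : X ⟶ M.obj) : a ≫ H.hom = (a ≫ F.hom) ≫ G.hom := by
  rw [← h.hom, Strict.assoc]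

theorem cellAt (h : IsComp F G H) {X : D} (a b : X ⟶ M.obj) :
    H.cellAt a b = eqToHom (h.comp_hom _) ≫ F.cellAt a b ▷ G.hom ≫
      G.cellAt (a ≫ F.hom) (b ≫ F.hom) ≫ eqToHom (by simp only [h.comp_hom]) := by
  have e : F.cellAt a b = eqToHom (tens_comp _ a b F.hom) ≫ lift a b ◁ F.cell ≫
    eqToHom (by rw [comp_tens, lift_comp_fst, lift_comp_snd]) := rfl
  rw [HomData.cellAt, h.cell]
  simp only [whiskerLeft_comp, whiskerLeft_cellAt, strict_whiskerLeft_whiskerRight,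
    whiskerLeft_eqToHom]
  rw [G.cellAt_congr (lift_comp_fst a b F.hom) (lift_comp_snd a b F.hom)]
  rw [e, whiskerRight_conj]
  simp only [Category.assoc, eqToHom_trans, eqToHom_trans_assoc]

theorem cell₀At (h : IsComp F G H) (X : D) :
    H.cell₀At X = eqToHom (h.comp_hom _) ≫ F.cell₀At X ▷ G.hom ≫ G.cell₀At X := by
  rw [HomData.cell₀At, h.cell₀]
  simp only [HomData.cell₀At, whiskerLeft_comp, strict_whiskerLeft_whiskerRight,
    whiskerLeft_eqToHom, whiskerRight_conj, Category.assoc, eqToHom_trans_assoc]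

theorem whiskerRight (h : IsComp F G H) {X : D} {a b : X ⟶ M.obj} (σ : a ⟶ b) : σ ▷ H.hom =
    eqToHom (h.comp_hom a) ≫ σ ▷ F.hom ▷ G.hom ≫ eqToHom (h.comp_hom b).symm := by
  rw [whiskerRight_congr σ h.hom.symm, strict_whiskerRight_comp]
  simp only [Category.assoc, eqToHom_trans, eqToHom_trans_assoc]

theorem assocAt (h : IsComp F G H) {X : D} {a b c : X ⟶ M.obj}
    (hF : F.AssocAt a b c) (hG : G.AssocAt (a ≫ F.hom) (b ≫ F.hom) (c ≫ F.hom)) :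
    H.AssocAt a b c := by
  unfold AssocAt at hF hG ⊢
  have n₁ := G.cellAt_naturality (𝟙 (a ≫ F.hom)) (F.cellAt b c)
  have n₂ := G.cellAt_naturality (F.cellAt a b) (𝟙 (c ≫ F.hom))
  have hF' := congrArg (· ▷ G.hom) hF
  simp only [comp_whiskerRight, id_whiskerRight] at n₁ n₂ hF'
  rw [h.cellAt, h.cellAt, h.cellAt, h.cellAt, h.whiskerRight,
    assocAt_congr _ (h.comp_hom a) (h.comp_hom b) (h.comp_hom c),
    ← Category.assoc (F.cellAt b c ▷ G.hom), ← Category.assoc (F.cellAt a b ▷ G.hom),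
    tens₂_id_left_conj _ (h.comp_hom a), tens₂_id_right_conj _ (h.comp_hom c)]
  have s₁ := tens₂_comp P.tensor (𝟙 ((a ≫ F.hom) ≫ G.hom)) (𝟙 ((a ≫ F.hom) ≫ G.hom))
    (F.cellAt b c ▷ G.hom) (G.cellAt (b ≫ F.hom) (c ≫ F.hom))
  have s₂ := tens₂_comp P.tensor (F.cellAt a b ▷ G.hom) (G.cellAt (a ≫ F.hom) (b ≫ F.hom))
    (𝟙 ((c ≫ F.hom) ≫ G.hom)) (𝟙 ((c ≫ F.hom) ≫ G.hom))
  rw [Category.comp_id] at s₁ s₂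
  rw [s₁, s₂]
  simp only [Category.assoc, eqToHom_trans_assoc, eqToHom_refl, Category.id_comp]
  rw [← reassoc_of% n₁, ← reassoc_of% n₂, reassoc_of% hG, reassoc_of% hF']

theorem lamAt (h : IsComp F G H) {X : D} {a : X ⟶ M.obj}
    (hF : F.LamAt a) (hG : G.LamAt (a ≫ F.hom)) : H.LamAt a := by
  unfold LamAt at hF hG ⊢
  have n₁ := G.cellAt_naturality (F.cell₀At X) (𝟙 (a ≫ F.hom))
  have hF' := congrArg (· ▷ G.hom) hF
  simp only [comp_whiskerRight, id_whiskerRight] at n₁ hF'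
  have s₁ := tens₂_comp P.tensor (F.cell₀At X ▷ G.hom) (G.cell₀At X)
    (𝟙 ((a ≫ F.hom) ≫ G.hom)) (𝟙 ((a ≫ F.hom) ≫ G.hom))
  rw [Category.comp_id] at s₁
  have s₂ := tens₂_id_right_conj P.tensor (h.comp_hom a) (h.comp_hom (const M.unit X))
    (F.cell₀At X ▷ G.hom ≫ G.cell₀At X) rfl
  rw [eqToHom_refl, Category.comp_id] at s₂
  rw [h.cellAt, h.cell₀At, h.whiskerRight, lamAt_congr _ (h.comp_hom a), s₂, s₁]
  simp only [Category.assoc, eqToHom_trans_assoc, eqToHom_refl, Category.id_comp]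
  rw [← reassoc_of% n₁, reassoc_of% hG, reassoc_of% hF']

theorem rhoAt (h : IsComp F G H) {X : D} {a : X ⟶ M.obj}
    (hF : F.RhoAt a) (hG : G.RhoAt (a ≫ F.hom)) : H.RhoAt a := by
  unfold RhoAt at hF hG ⊢
  have n₁ := G.cellAt_naturality (𝟙 (a ≫ F.hom)) (F.cell₀At X)
  have hF' := congrArg (· ▷ G.hom) hF
  simp only [comp_whiskerRight, id_whiskerRight] at n₁ hF'
  have s₁ := tens₂_comp P.tensor (𝟙 ((a ≫ F.hom) ≫ G.hom)) (𝟙 ((a ≫ F.hom) ≫ G.hom))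
    (F.cell₀At X ▷ G.hom) (G.cell₀At X)
  rw [Category.comp_id] at s₁
  have s₂ := tens₂_id_left_conj P.tensor (h.comp_hom a) (h.comp_hom (const M.unit X))
    (F.cell₀At X ▷ G.hom ≫ G.cell₀At X) rfl
  rw [eqToHom_refl, Category.comp_id] at s₂
  rw [h.cellAt, h.cell₀At, h.whiskerRight, rhoAt_congr _ (h.comp_hom a), s₂, s₁]
  simp only [Category.assoc, eqToHom_trans_assoc, eqToHom_refl, Category.id_comp]
  rw [← reassoc_of% n₁, reassoc_of% hG, reassoc_of% hF']

end IsComp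

end HomData

/-- The identity oplax monoidal morphism. -/
def Hom.id (M : MonOp D) : Hom M M where
  toHomData := HomData.id M
  assoc_cell := (HomData.isId_id M).assocAt _ _ _
  lam_cell := (HomData.isId_id M).lamAt _
  rho_cell := (HomData.isId_id M).rhoAt _

/-- The composite of oplax monoidal morphisms. -/
def Hom.comp {M N P : MonOp D} (F : Hom M N) (G : Hom N P) : Hom M P where
  toHomData := F.toHomData.comp G.toHomData
  assoc_cell := (HomData.isComp_comp _ _).assocAt F.assoc_cell (G.assocAt _ _ _)
  lam_cell := (HomData.isComp_comp _ _).lamAt F.lam_cell (G.lamAt _)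
  rho_cell := (HomData.isComp_comp _ _).rhoAt F.rho_cell (G.rhoAt _)

theorem hom_ext {M N : MonOp D} {F G : Hom M N} (h : F.hom = G.hom)
    (hc : F.cell = eqToHom (by rw [h]) ≫ G.cell ≫ eqToHom (by rw [h]))
    (hc₀ : F.cell₀ = eqToHom (by rw [h]) ≫ G.cell₀) : F = G := by
  obtain ⟨⟨f, c, c₀⟩, _, _, _⟩ := F
  obtain ⟨⟨g, d, d₀⟩, _, _, _⟩ := G
  obtain rfl : f = g := h
  obtain rfl : c = d := by simpa using hc
  obtain rfl : c₀ = d₀ := by simpa using hc₀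
  rfl

namespace HomData

variable {M N P Q : MonOp D}

theorem cellAt_fst_snd (F : HomData M N) : F.cellAt (fst M.obj M.obj) (snd M.obj M.obj) =
    eqToHom (by rw [tens_fst_snd]) ≫ F.cell := by
  rw [cellAt, whiskerLeft_congr lift_fst_snd, strict_id_whiskerLeft]
  simp only [Category.assoc, eqToHom_trans_assoc, eqToHom_trans, eqToHom_refl, Category.comp_id]

theorem IsComp.id_left_cell {I : HomData M M} (hI : IsId I) {F H : HomData M N}
    (h : IsComp I F H) (e : H.hom = F.hom) :
    H.cell = eqToHom (by rw [e]) ≫ F.cell ≫ eqToHom (by rw [e]) := by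
  rw [h.cell, hI.cell, F.cellAt_congr (hI.comp_hom _) (hI.comp_hom _), cellAt_fst_snd]
  simp only [eqToHom_whiskerRight, Category.assoc, eqToHom_trans_assoc, eqToHom_trans]

theorem IsComp.id_left_cell₀ {I : HomData M M} (hI : IsId I) {F H : HomData M N}
    (h : IsComp I F H) (e : H.hom = F.hom) :
    H.cell₀ = eqToHom (by rw [e]) ≫ F.cell₀ := by
  rw [h.cell₀, hI.cell₀]
  simp only [eqToHom_whiskerRight, eqToHom_trans_assoc]

theorem IsComp.id_right_cell {I : HomData N N} (hI : IsId I) {F H : HomData M N}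
    (h : IsComp F I H) (e : H.hom = F.hom) :
    H.cell = eqToHom (by rw [e]) ≫ F.cell ≫ eqToHom (by rw [e]) := by
  rw [h.cell, hI.whiskerRight, hI.cellAt]
  simp only [Category.assoc, eqToHom_trans_assoc, eqToHom_trans]

theorem IsComp.id_right_cell₀ {I : HomData N N} (hI : IsId I) {F H : HomData M N}
    (h : IsComp F I H) (e : H.hom = F.hom) :
    H.cell₀ = eqToHom (by rw [e]) ≫ F.cell₀ := by
  rw [h.cell₀, hI.whiskerRight, hI.cell₀]
  simp only [Category.assoc, eqToHom_trans_assoc, eqToHom_trans, eqToHom_refl, Category.comp_id]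

theorem IsComp.assoc_cell {F : HomData M N} {G : HomData N P} {K : HomData P Q}
    {FG : HomData M P} {GK : HomData N Q} {L R : HomData M Q} (h₁ : IsComp F G FG)
    (h₂ : IsComp FG K L) (h₃ : IsComp G K GK) (h₄ : IsComp F GK R) (e : L.hom = R.hom) :
    L.cell = eqToHom (by rw [e]) ≫ R.cell ≫ eqToHom (by rw [e]) := by
  rw [h₂.cell, h₁.cell, h₄.cell, h₃.whiskerRight, h₃.cellAt,
    K.cellAt_congr (h₁.comp_hom _) (h₁.comp_hom _)]
  simp only [comp_whiskerRight, eqToHom_whiskerRight, Category.assoc, eqToHom_trans_assoc,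
    eqToHom_trans, eqToHom_refl, Category.id_comp]

theorem IsComp.assoc_cell₀ {F : HomData M N} {G : HomData N P} {K : HomData P Q}
    {FG : HomData M P} {GK : HomData N Q} {L R : HomData M Q} (h₁ : IsComp F G FG)
    (h₂ : IsComp FG K L) (h₃ : IsComp G K GK) (h₄ : IsComp F GK R) (e : L.hom = R.hom) :
    L.cell₀ = eqToHom (by rw [e]) ≫ R.cell₀ := by
  rw [h₂.cell₀, h₁.cell₀, h₄.cell₀, h₃.whiskerRight, h₃.cell₀]
  simp only [comp_whiskerRight, eqToHom_whiskerRight, Category.assoc, eqToHom_trans_assoc,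
    eqToHom_refl, Category.id_comp]

end HomData

open HomData in
theorem id_comp' {M N : MonOp D} (F : Hom M N) : (Hom.id M).comp F = F :=
  hom_ext (Strict.id_comp _)
    ((isComp_comp _ _).id_left_cell (isId_id M) (Strict.id_comp _))
    ((isComp_comp _ _).id_left_cell₀ (isId_id M) (Strict.id_comp _))

open HomData in
theorem comp_id' {M N : MonOp D} (F : Hom M N) : F.comp (Hom.id N) = F :=
  hom_ext (Strict.comp_id _)
    ((isComp_comp _ _).id_right_cell (isId_id N) (Strict.comp_id _))
    ((isComp_comp _ _).id_right_cell₀ (isId_id N) (Strict.comp_id _))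

open HomData in
theorem assoc' {M N P Q : MonOp D} (F : Hom M N) (G : Hom N P) (K : Hom P Q) :
    (F.comp G).comp K = F.comp (G.comp K) :=
  hom_ext (Strict.assoc _ _ _)
    ((isComp_comp _ _).assoc_cell (isComp_comp _ _) (isComp_comp _ _) (isComp_comp _ _)
      (Strict.assoc _ _ _))
    ((isComp_comp _ _).assoc_cell₀ (isComp_comp _ _) (isComp_comp _ _) (isComp_comp _ _)
      (Strict.assoc _ _ _))

theorem Hom₂.commAt {M N : MonOp D} {F G : Hom M N} (σ : Hom₂ F G) {X : D} (a b : X ⟶ M.obj) :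
    F.cellAt a b ≫ tens₂ N.tensor (a ◁ σ.hom) (b ◁ σ.hom) =
      tens M.tensor a b ◁ σ.hom ≫ G.cellAt a b := by
  have h := congrArg (lift a b ◁ ·) σ.comm
  have ha : lift a b ◁ fst M.obj M.obj ◁ σ.hom = eqToHom (lift_comp_fst a b F.hom) ≫
      a ◁ σ.hom ≫ eqToHom (lift_comp_fst a b G.hom).symm :=
    whiskerLeft_of_comp_eq (lift_fst a b) σ.hom
  have hb : lift a b ◁ snd M.obj M.obj ◁ σ.hom = eqToHom (lift_comp_snd a b F.hom) ≫
      b ◁ σ.hom ≫ eqToHom (lift_comp_snd a b G.hom).symm :=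
    whiskerLeft_of_comp_eq (lift_snd a b) σ.hom
  have hm : tens M.tensor a b ◁ σ.hom = eqToHom (tens_comp _ a b F.hom) ≫
      lift a b ◁ M.tensor ◁ σ.hom ≫ eqToHom (tens_comp _ a b G.hom).symm :=
    strict_comp_whiskerLeft _ _ _
  simp only [whiskerLeft_comp, whiskerLeft_tens₂, ha, hb, tens₂_conj] at h
  have h' := eqToHom (tens_comp _ a b F.hom) ≫= h =≫
    eqToHom (by rw [comp_tens, lift_comp_fst, lift_comp_snd])
  simp only [Category.assoc, eqToHom_trans, eqToHom_refl, Category.comp_id] at h'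
  simp only [HomData.cellAt, hm, Category.assoc, eqToHom_trans_assoc, eqToHom_refl,
    Category.id_comp, ← h']

theorem whiskerLeft_comm {M N P : MonOp D} (F : Hom M N) {G H : Hom N P} (σ : Hom₂ G H) :
    (eqToHom (Strict.assoc _ _ _).symm ≫ F.cell ▷ G.hom ≫
      G.cellAt (fst M.obj M.obj ≫ F.hom) (snd M.obj M.obj ≫ F.hom) ≫
        eqToHom (by rw [Strict.assoc, Strict.assoc])) ≫
      tens₂ P.tensor (fst M.obj M.obj ◁ F.hom ◁ σ.hom) (snd M.obj M.obj ◁ F.hom ◁ σ.hom) =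
    M.tensor ◁ F.hom ◁ σ.hom ≫ eqToHom (Strict.assoc _ _ _).symm ≫ F.cell ▷ H.hom ≫
      H.cellAt (fst M.obj M.obj ≫ F.hom) (snd M.obj M.obj ≫ F.hom) ≫
        eqToHom (by rw [Strict.assoc, Strict.assoc]) := by
  have e := whisker_exchange F.cell σ.hom
  rw [strict_comp_whiskerLeft] at e
  have e' := eqToHom (Strict.assoc _ _ _).symm ≫= e
  simp only [Category.assoc, eqToHom_trans_assoc, eqToHom_refl, Category.id_comp] at e'
  rw [whiskerLeft_of_comp_eq rfl σ.hom, whiskerLeft_of_comp_eq rfl σ.hom, tens₂_conj,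
    reassoc_of% e', ← reassoc_of% (σ.commAt (fst M.obj M.obj ≫ F.hom) (snd M.obj M.obj ≫ F.hom))]
  simp only [Category.assoc, eqToHom_trans_assoc, eqToHom_refl, Category.id_comp]

theorem whiskerLeft_comm₀ {M N P : MonOp D} (F : Hom M N) {G H : Hom N P} (σ : Hom₂ G H) :
    M.unit ◁ F.hom ◁ σ.hom ≫ eqToHom (Strict.assoc _ _ _).symm ≫ F.cell₀ ▷ H.hom ≫ H.cell₀ =
      eqToHom (Strict.assoc _ _ _).symm ≫ F.cell₀ ▷ G.hom ≫ G.cell₀ := by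
  have e := whisker_exchange F.cell₀ σ.hom
  rw [strict_comp_whiskerLeft] at e
  have e' := eqToHom (Strict.assoc _ _ _).symm ≫= e
  simp only [Category.assoc, eqToHom_trans_assoc, eqToHom_refl, Category.id_comp] at e'
  rw [reassoc_of% e', σ.comm₀]

theorem whiskerRight_comm {M N P : MonOp D} {F G : Hom M N} (σ : Hom₂ F G) (H : Hom N P) :
    (eqToHom (Strict.assoc _ _ _).symm ≫ F.cell ▷ H.hom ≫
      H.cellAt (fst M.obj M.obj ≫ F.hom) (snd M.obj M.obj ≫ F.hom) ≫
        eqToHom (by rw [Strict.assoc, Strict.assoc])) ≫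
      tens₂ P.tensor (fst M.obj M.obj ◁ σ.hom ▷ H.hom) (snd M.obj M.obj ◁ σ.hom ▷ H.hom) =
    M.tensor ◁ σ.hom ▷ H.hom ≫ eqToHom (Strict.assoc _ _ _).symm ≫ G.cell ▷ H.hom ≫
      H.cellAt (fst M.obj M.obj ≫ G.hom) (snd M.obj M.obj ≫ G.hom) ≫
        eqToHom (by rw [Strict.assoc, Strict.assoc]) := by
  have e := congrArg (· ▷ H.hom) σ.comm
  simp only [comp_whiskerRight] at e
  have n := H.cellAt_naturality (fst M.obj M.obj ◁ σ.hom) (snd M.obj M.obj ◁ σ.hom)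
  rw [strict_whiskerLeft_whiskerRight, strict_whiskerLeft_whiskerRight,
    strict_whiskerLeft_whiskerRight, tens₂_conj]
  simp only [Category.assoc, eqToHom_trans_assoc, eqToHom_refl, Category.id_comp]
  rw [← reassoc_of% n, reassoc_of% e]

theorem whiskerRight_comm₀ {M N P : MonOp D} {F G : Hom M N} (σ : Hom₂ F G) (H : Hom N P) :
    M.unit ◁ σ.hom ▷ H.hom ≫ eqToHom (Strict.assoc _ _ _).symm ≫ G.cell₀ ▷ H.hom ≫ H.cell₀ =
      eqToHom (Strict.assoc _ _ _).symm ≫ F.cell₀ ▷ H.hom ≫ H.cell₀ := by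
  have e := congrArg (· ▷ H.hom) σ.comm₀
  simp only [comp_whiskerRight] at e
  rw [strict_whiskerLeft_whiskerRight]
  simp only [Category.assoc, eqToHom_trans_assoc, eqToHom_refl, Category.id_comp]
  rw [reassoc_of% e]

instance : CategoryStruct (MonOp D) where
  Hom := Hom
  id := Hom.id
  comp := Hom.comp

instance homCategory (M N : MonOp D) : Category (M ⟶ N) where
  Hom F G := Hom₂ (M := M) (N := N) F G
  id F := ⟨𝟙 F.hom, by simp [tens₂_id], by simp⟩
  comp {F G H} σ τ := ⟨Hom₂.hom σ ≫ Hom₂.hom τ, by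
    rw [whiskerLeft_comp, whiskerLeft_comp, tens₂_comp, ← Category.assoc, σ.comm,
      Category.assoc, τ.comm, whiskerLeft_comp, Category.assoc], by
    rw [whiskerLeft_comp, Category.assoc, τ.comm₀, σ.comm₀]⟩
  id_comp σ := Hom₂.ext (Category.id_comp _)
  comp_id σ := Hom₂.ext (Category.comp_id _)
  assoc σ τ υ := Hom₂.ext (Category.assoc _ _ _)

@[ext]
theorem hom₂_ext {M N : MonOp D} {F G : M ⟶ N} {σ τ : F ⟶ G}
    (h : Hom₂.hom σ = Hom₂.hom τ) : σ = τ := Hom₂.ext h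

@[simp] theorem id_hom (M : MonOp D) : HomData.hom (Hom.toHomData (𝟙 M)) = 𝟙 M.obj := rfl
@[simp] theorem comp_hom {M N P : MonOp D} (F : M ⟶ N) (G : N ⟶ P) :
    HomData.hom (Hom.toHomData (F ≫ G)) = F.hom ≫ G.hom := rfl
@[simp] theorem id₂_hom {M N : MonOp D} (F : M ⟶ N) : Hom₂.hom (𝟙 F) = 𝟙 F.hom := rfl
@[simp] theorem comp₂_hom {M N : MonOp D} {F G H : M ⟶ N} (σ : F ⟶ G) (τ : G ⟶ H) :
    Hom₂.hom (σ ≫ τ) = σ.hom ≫ τ.hom := rfl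

theorem hom₂_eqToHom {M N : MonOp D} {F G : M ⟶ N} (h : F = G) :
    Hom₂.hom (eqToHom h) = eqToHom (congrArg (fun K : Hom M N => K.hom) h) := by
  subst h; rfl

theorem hom₂_conj_eqToHom {M N : MonOp D} {F F' G G' : M ⟶ N}
    (h : F = F') (σ : F' ⟶ G') (k : G' = G) :
    Hom₂.hom (eqToHom h ≫ σ ≫ eqToHom k) =
      eqToHom (congrArg (fun K : Hom M N => K.hom) h) ≫ σ.hom ≫
        eqToHom (congrArg (fun K : Hom M N => K.hom) k) := by
  subst h k; simp

theorem id_comp_eq {M N : MonOp D} (F : M ⟶ N) : 𝟙 M ≫ F = F := id_comp' F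

theorem comp_id_eq {M N : MonOp D} (F : M ⟶ N) : F ≫ 𝟙 N = F := comp_id' F

theorem assoc_eq {M N P Q : MonOp D} (F : M ⟶ N) (G : N ⟶ P) (K : P ⟶ Q) :
    (F ≫ G) ≫ K = F ≫ G ≫ K := assoc' F G K

/-- Left whiskering, computed in `D`. -/
def whiskerL {M N P : MonOp D} (F : M ⟶ N) {G H : N ⟶ P} (σ : G ⟶ H) : F ≫ G ⟶ F ≫ H :=
  ⟨F.hom ◁ σ.hom, whiskerLeft_comm F σ, whiskerLeft_comm₀ F σ⟩

/-- Right whiskering, computed in `D`. -/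
def whiskerR {M N P : MonOp D} {F G : M ⟶ N} (σ : F ⟶ G) (H : N ⟶ P) : F ≫ H ⟶ G ≫ H :=
  ⟨σ.hom ▷ H.hom, whiskerRight_comm σ H, whiskerRight_comm₀ σ H⟩

/-- The 2-category `Mon_op(D)` of monoidal objects, oplax monoidal morphisms and their
transformations; whiskerings and compositions of 2-cells are those of `D`. -/
instance : Bicategory (MonOp D) where
  homCategory := homCategory
  whiskerLeft F _ _ σ := whiskerL F σ
  whiskerRight σ H := whiskerR σ H
  associator F G H := eqToIso (assoc_eq F G H)
  leftUnitor F := eqToIso (id_comp_eq F)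
  rightUnitor F := eqToIso (comp_id_eq F)
  whiskerLeft_id _ _ := hom₂_ext (whiskerLeft_id _ _)
  whiskerLeft_comp _ _ _ _ _ _ := hom₂_ext (whiskerLeft_comp _ _ _)
  id_whiskerLeft {_ _ F G} σ := hom₂_ext ((strict_id_whiskerLeft σ.hom).trans
    (hom₂_conj_eqToHom (id_comp_eq F) σ (id_comp_eq G).symm).symm)
  comp_whiskerLeft F G H H' σ := hom₂_ext ((strict_comp_whiskerLeft F.hom G.hom σ.hom).trans
    (hom₂_conj_eqToHom (assoc_eq F G H) (whiskerL F (whiskerL G σ)) (assoc_eq F G H').symm).symm)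
  id_whiskerRight _ _ := hom₂_ext (id_whiskerRight _ _)
  comp_whiskerRight _ _ _ := hom₂_ext (comp_whiskerRight _ _ _)
  whiskerRight_id {_ _ F G} σ := hom₂_ext ((strict_whiskerRight_id σ.hom).trans
    (hom₂_conj_eqToHom (comp_id_eq F) σ (comp_id_eq G).symm).symm)
  whiskerRight_comp {_ _ _ _ F F'} σ G H := hom₂_ext
    ((strict_whiskerRight_comp σ.hom G.hom H.hom).trans
      (hom₂_conj_eqToHom (assoc_eq F G H).symm (whiskerR (whiskerR σ G) H)
        (assoc_eq F' G H)).symm)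
  whisker_assoc F G G' σ H := hom₂_ext ((strict_whisker_assoc F.hom σ.hom H.hom).trans
    (hom₂_conj_eqToHom (assoc_eq F G H) (whiskerL F (whiskerR σ H)) (assoc_eq F G' H).symm).symm)
  whisker_exchange _ _ := hom₂_ext (whisker_exchange _ _)
  pentagon F G H K := hom₂_ext (by
    change Hom₂.hom (eqToHom (assoc_eq F G H)) ▷ K.hom ≫
      Hom₂.hom (eqToHom (assoc_eq F (G ≫ H) K)) ≫
        F.hom ◁ Hom₂.hom (eqToHom (assoc_eq G H K)) =
      Hom₂.hom (eqToHom (assoc_eq (F ≫ G) H K)) ≫ Hom₂.hom (eqToHom (assoc_eq F G (H ≫ K)))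
    rw [hom₂_eqToHom, hom₂_eqToHom, hom₂_eqToHom, hom₂_eqToHom, hom₂_eqToHom]
    exact strict_pentagon _ _ _ _)
  triangle F G := hom₂_ext (by
    change Hom₂.hom (eqToHom (assoc_eq F (𝟙 _) G)) ≫
        F.hom ◁ Hom₂.hom (eqToHom (id_comp_eq G)) =
      Hom₂.hom (eqToHom (comp_id_eq F)) ▷ G.hom
    rw [hom₂_eqToHom, hom₂_eqToHom, hom₂_eqToHom]
    exact strict_triangle _ _)

instance : Strict (MonOp D) where
  id_comp := id_comp_eq
  comp_id := comp_id_eq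
  assoc := assoc_eq
  leftUnitor_eqToIso _ := rfl
  rightUnitor_eqToIso _ := rfl
  associator_eqToIso _ _ _ := rfl

/-- The forgetful 2-functor `Mon_op(D) ⟶ D`. -/
def forget (D : Type u) [Bicategory.{w, v} D] [FiniteProducts₂ D] [Strict D] :
    StrictPseudofunctor (MonOp D) D :=
  StrictPseudofunctor.mk''
  { obj := fun M => M.obj
    map := fun F => HomData.hom (Hom.toHomData F)
    map₂ := fun σ => Hom₂.hom σ
    map₂_id := fun _ => rfl
    map₂_comp := fun _ _ => rfl
    map_id := fun _ => rfl
    map_comp := fun _ _ => rfl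
    map₂_whisker_left := fun _ _ _ _ =>
      ((Category.id_comp _).trans (Category.comp_id _)).symm
    map₂_whisker_right := fun _ _ =>
      ((Category.id_comp _).trans (Category.comp_id _)).symm }

end MonOp

end Monoidal

end TwoCat

/-!
A monad `A` in `Mon_op(D)` is an oplax monoidal monad `T` on a monoidal object `C` of `D`. If `f`
and `g` are `T`-algebras at the stage `Y` (that is, 1-cells `Y ⟶ C` with an action), then so is
`f ⊗ g`, with the action `T (f ⊗ g) ⟶ T f ⊗ T g ⟶ f ⊗ g` built from the oplax structure of `T`; the
unit `I` is an algebra through `T I ⟶ I`, and the cells `α`, `λ`, `ρ` are morphisms of algebras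
(`MonOp.IsAlg`). The Eilenberg-Moore object `X` of `T` in `D` carries a universal algebra
`(U, ξ)`, along which algebras, their morphisms and their isomorphisms lift uniquely
(`MonOp.IsEM`). Applied to `fst ≫ U` and `snd ≫ U` this lifts the tensor product to `X × X ⟶ X`, and
similarly the unit, the associativity and the unit cells; the pentagon and the triangle hold because
`U` is faithful on 2-cells. So `X` becomes a monoidal object and `U` a strict morphism of monoidal
objects (`MonOp.IsStrictLift`).

This monoidal object is the Eilenberg-Moore object of `A` in `Mon_op(D)`: an algebra of `A` is
an oplax monoidal 1-cell `F` with an action that is a transformation of oplax monoidal 1-cells. That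
condition on the action says exactly that the oplax structure cells of `F` are morphisms of
algebras, so they lift to an oplax structure on the 1-cell into `X` induced by `F`
(`MonOp.IsStrictLift.exists_lift`), and the coherence laws follow from faithfulness again.

Eilenberg-Moore objects are handled as universal arrows `ι X ⟶ S` in `Mnd` (`IsUniversal`): a right
2-adjoint of `ι` amounts to a universal arrow to each monad (`RightAdjoint₂.isUniversal`,
`rightAdjointOfUniversal`). The comparison along a 2-functor `G` is a 2-natural isomorphism as soon
as `G` carries universal arrows to universal arrows (`exists_comparison_inverse`), and for this one
universal arrow to each monad suffices (`isUniversal_mapArrow_of_isUniversal`). For the forgetful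
2-functor this holds by construction, since the universal arrow of `Mon_op(D)` lies over the given
one of `D` (`MonOp.exists_isUniversal`).

Equations between 2-cells are proved for total 2-cells (`Cell`), which carry their source and
target, so that no transport along equations between 1-cells appears.
-/

namespace TwoCat

/-! ### Total 2-cells -/

/-- A 2-cell of a 2-category together with its source and target 1-cells. Whiskering such total
2-cells is strictly associative and unital on the nose, and the 2-cells `eqToHom h` become
identities; equations of 2-cells are proved below by passing to total 2-cells.

The basic `simp` lemmas are proved by `(rfl)`, which keeps `dsimp` from using them: definitional
rewriting would change the 1-cells in the proof arguments of `Cell.comp` below only up to unfolding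
and so block further rewriting. -/
structure Cell {D : Type u} [Bicategory.{w, v} D] (X Y : D) where
  src : X ⟶ Y
  tgt : X ⟶ Y
  hom : src ⟶ tgt

namespace Cell

section Basic

variable {D : Type u} [Bicategory.{w, v} D] {W X Y Z : D}

/-- The total 2-cell of a 2-cell. -/
def of {f g : X ⟶ Y} (σ : f ⟶ g) : Cell X Y := ⟨f, g, σ⟩

/-- The identity 2-cell of a 1-cell. -/
def id (f : X ⟶ Y) : Cell X Y := ⟨f, f, 𝟙 f⟩

/-- Vertical composition of total 2-cells, in diagrammatic order. -/
def comp (c d : Cell X Y) (h : c.tgt = d.src) : Cell X Y :=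
  ⟨c.src, d.tgt, c.hom ≫ eqToHom h ≫ d.hom⟩

/-- Left whiskering. -/
def wl (x : W ⟶ X) (c : Cell X Y) : Cell W Y := ⟨x ≫ c.src, x ≫ c.tgt, x ◁ c.hom⟩

/-- Right whiskering. -/
def wr (c : Cell X Y) (y : Y ⟶ Z) : Cell X Z := ⟨c.src ≫ y, c.tgt ≫ y, c.hom ▷ y⟩

@[simp] theorem of_src {f g : X ⟶ Y} (σ : f ⟶ g) : (of σ).src = f := (rfl)
@[simp] theorem of_tgt {f g : X ⟶ Y} (σ : f ⟶ g) : (of σ).tgt = g := (rfl)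
@[simp] theorem id_src (f : X ⟶ Y) : (id f).src = f := (rfl)
@[simp] theorem id_tgt (f : X ⟶ Y) : (id f).tgt = f := (rfl)
@[simp] theorem comp_src (c d : Cell X Y) (h) : (comp c d h).src = c.src := (rfl)
@[simp] theorem comp_tgt (c d : Cell X Y) (h) : (comp c d h).tgt = d.tgt := (rfl)
@[simp] theorem wl_src (x : W ⟶ X) (c : Cell X Y) : (wl x c).src = x ≫ c.src := (rfl)
@[simp] theorem wl_tgt (x : W ⟶ X) (c : Cell X Y) : (wl x c).tgt = x ≫ c.tgt := (rfl)
@[simp] theorem wr_src (c : Cell X Y) (y : Y ⟶ Z) : (wr c y).src = c.src ≫ y := (rfl)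
@[simp] theorem wr_tgt (c : Cell X Y) (y : Y ⟶ Z) : (wr c y).tgt = c.tgt ≫ y := (rfl)

theorem of_injective {f g : X ⟶ Y} {σ τ : f ⟶ g} (h : of σ = of τ) : σ = τ := by
  cases h; rfl

theorem of_inj {f g : X ⟶ Y} {σ τ : f ⟶ g} : of σ = of τ ↔ σ = τ :=
  ⟨of_injective, fun h => h ▸ rfl⟩

@[simp] theorem of_hom (c : Cell X Y) : of c.hom = c := (rfl)

/-- A total 2-cell is determined by its source, its target and a 2-cell between them. -/
theorem exists_of (c : Cell X Y) {f g : X ⟶ Y} (hf : c.src = f) (hg : c.tgt = g) :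
    ∃ σ : f ⟶ g, of σ = c := by
  subst hf hg
  exact ⟨c.hom, rfl⟩

/-- The 2-cell between prescribed 1-cells underlying a total 2-cell. -/
def cast (c : Cell X Y) {f g : X ⟶ Y} (hf : c.src = f) (hg : c.tgt = g) : f ⟶ g :=
  eqToHom hf.symm ≫ c.hom ≫ eqToHom hg

@[simp] theorem of_cast (c : Cell X Y) {f g : X ⟶ Y} (hf : c.src = f) (hg : c.tgt = g) :
    of (c.cast hf hg) = c := by
  subst hf hg
  simp [cast]

@[simp] theorem id_comp (f : X ⟶ Y) (c : Cell X Y) (h : (id f).tgt = c.src) :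
    comp (id f) c h = c := by
  obtain ⟨f', g, σ⟩ := c
  obtain rfl : f = f' := h
  simp [comp, id]

@[simp] theorem comp_id (c : Cell X Y) (f : X ⟶ Y) (h : c.tgt = (id f).src) :
    comp c (id f) h = c := by
  obtain ⟨f', g, σ⟩ := c
  obtain rfl : g = f := h
  simp [comp, id]

@[simp] theorem comp_assoc (c d e : Cell X Y) (h : c.tgt = d.src)
    (k : (comp c d h).tgt = e.src) : comp (comp c d h) e k =
      comp c (comp d e (by simpa using k)) (by simpa using h) := by
  simp [comp]

/-- An equation between composites, composed with a further 2-cell. -/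
theorem reassoc {a b p : Cell X Y} {h : a.tgt = b.src} (E : comp a b h = p) (c : Cell X Y)
    (k : b.tgt = c.src) :
    comp a (comp b c k) (by simpa using h) = comp p c (by simpa [← E] using k) := by
  subst E
  simp

@[simp] theorem of_comp {f g h : X ⟶ Y} (σ : f ⟶ g) (τ : g ⟶ h) :
    of (σ ≫ τ) = comp (of σ) (of τ) (by simp) := by
  change Cell.mk f h (σ ≫ τ) = Cell.mk f h (σ ≫ eqToHom (Eq.refl g) ≫ τ)
  rw [eqToHom_refl, Category.id_comp]

@[simp] theorem of_id (f : X ⟶ Y) : of (𝟙 f) = id f := (rfl)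

@[simp] theorem of_eqToHom {f g : X ⟶ Y} (h : f = g) : of (eqToHom h) = id f := by
  subst h; rfl

@[simp] theorem of_whiskerLeft (x : W ⟶ X) {f g : X ⟶ Y} (σ : f ⟶ g) :
    of (x ◁ σ) = wl x (of σ) := (rfl)

@[simp] theorem of_whiskerRight {f g : X ⟶ Y} (σ : f ⟶ g) (y : Y ⟶ Z) :
    of (σ ▷ y) = wr (of σ) y := (rfl)

@[simp] theorem wl_id (x : W ⟶ X) (f : X ⟶ Y) : wl x (id f) = id (x ≫ f) := by
  simp [wl, id]

@[simp] theorem wr_id (f : X ⟶ Y) (y : Y ⟶ Z) : wr (id f) y = id (f ≫ y) := by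
  simp [wr, id]

@[simp] theorem wl_comp (x : W ⟶ X) (c d : Cell X Y) (h : c.tgt = d.src) :
    wl x (comp c d h) = comp (wl x c) (wl x d) (by simp [h]) := by
  simp [wl, comp]

@[simp] theorem wr_comp (c d : Cell X Y) (h : c.tgt = d.src) (y : Y ⟶ Z) :
    wr (comp c d h) y = comp (wr c y) (wr d y) (by simp [h]) := by
  simp [wr, comp]

theorem comp_wl_congr {f : W ⟶ X} {c c' : Cell X Y} {d : Cell W Y} (h : c = c')
    (k : (wl f c).tgt = d.src) (k' : (wl f c').tgt = d.src) :
    comp (wl f c) d k = comp (wl f c') d k' := by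
  subst h; rfl

/-- Interchange of 2-cells. -/
theorem exchange (c : Cell X Y) (d : Cell Y Z) :
    comp (wl c.src d) (wr c d.tgt) (by simp) = comp (wr c d.src) (wl c.tgt d) (by simp) := by
  simp [wl, wr, comp, whisker_exchange]

theorem comp_eq_id_of_iso {f g : X ⟶ Y} (e : f ≅ g) :
    comp (of e.hom) (of e.inv) (by simp) = id f := by
  rw [← of_comp, e.hom_inv_id, of_id]

theorem comp_eq_id_of_iso' {f g : X ⟶ Y} (e : f ≅ g) :
    comp (of e.inv) (of e.hom) (by simp) = id g := by
  rw [← of_comp, e.inv_hom_id, of_id]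

end Basic

section Strict

variable {D : Type u} [Bicategory.{w, v} D] [Strict D] {V W X Y Z : D}

@[simp] theorem of_associator_hom (f : W ⟶ X) (g : X ⟶ Y) (h : Y ⟶ Z) :
    of (α_ f g h).hom = id (f ≫ g ≫ h) := by
  simp [Strict.associator_eqToIso]

@[simp] theorem of_associator_inv (f : W ⟶ X) (g : X ⟶ Y) (h : Y ⟶ Z) :
    of (α_ f g h).inv = id (f ≫ g ≫ h) := by
  simp [Strict.associator_eqToIso]

@[simp] theorem of_leftUnitor_hom (f : X ⟶ Y) : of (λ_ f).hom = id f := by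
  simp [Strict.leftUnitor_eqToIso]

@[simp] theorem of_leftUnitor_inv (f : X ⟶ Y) : of (λ_ f).inv = id f := by
  simp [Strict.leftUnitor_eqToIso]

@[simp] theorem of_rightUnitor_hom (f : X ⟶ Y) : of (ρ_ f).hom = id f := by
  simp [Strict.rightUnitor_eqToIso]

@[simp] theorem of_rightUnitor_inv (f : X ⟶ Y) : of (ρ_ f).inv = id f := by
  simp [Strict.rightUnitor_eqToIso]

@[simp] theorem wl_comp₁ (x : V ⟶ W) (y : W ⟶ X) (c : Cell X Y) :
    wl (x ≫ y) c = wl x (wl y c) := by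
  have h := congrArg of (strict_comp_whiskerLeft x y c.hom)
  simpa only [of_comp, of_eqToHom, of_whiskerLeft, of_hom, id_comp, comp_id] using h

@[simp] theorem wr_comp₁ (c : Cell W X) (y : X ⟶ Y) (z : Y ⟶ Z) :
    wr c (y ≫ z) = wr (wr c y) z := by
  have h := congrArg of (strict_whiskerRight_comp c.hom y z)
  simpa only [of_comp, of_eqToHom, of_whiskerRight, of_hom, id_comp, comp_id] using h

@[simp] theorem wl_wr (x : W ⟶ X) (c : Cell X Y) (z : Y ⟶ Z) :
    wl x (wr c z) = wr (wl x c) z := by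
  have h := congrArg of (strict_whiskerLeft_whiskerRight x c.hom z)
  simpa only [of_comp, of_eqToHom, of_whiskerRight, of_whiskerLeft, of_hom, id_comp, comp_id]
    using h

@[simp] theorem wl_id₁ (c : Cell X Y) : wl (𝟙 X) c = c := by
  have h := congrArg of (strict_id_whiskerLeft c.hom)
  simpa only [of_comp, of_eqToHom, of_whiskerLeft, of_hom, id_comp, comp_id] using h

@[simp] theorem wr_id₁ (c : Cell X Y) : wr c (𝟙 Y) = c := by
  have h := congrArg of (strict_whiskerRight_id c.hom)
  simpa only [of_comp, of_eqToHom, of_whiskerRight, of_hom, id_comp, comp_id] using h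

end Strict

section Functor

variable {D : Type u} [Bicategory.{w, v} D] {E : Type u'} [Bicategory.{w', v'} E]

/-- The image of a total 2-cell under a 2-functor. -/
def map (G : StrictPseudofunctor D E) {X Y : D} (c : Cell X Y) : Cell (G.obj X) (G.obj Y) :=
  ⟨G.map c.src, G.map c.tgt, G.map₂ c.hom⟩

variable (G : StrictPseudofunctor D E) {W X Y Z : D}

@[simp] theorem map_src (c : Cell X Y) : (map G c).src = G.map c.src := (rfl)
@[simp] theorem map_tgt (c : Cell X Y) : (map G c).tgt = G.map c.tgt := (rfl)

@[simp] theorem of_map₂ {f g : X ⟶ Y} (σ : f ⟶ g) : of (G.map₂ σ) = map G (of σ) := (rfl)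

@[simp] theorem map_id₂ (f : X ⟶ Y) : map G (id f) = id (G.map f) := by
  simp [map, id]

@[simp] theorem map_comp₂ (c d : Cell X Y) (h : c.tgt = d.src) :
    map G (comp c d h) = comp (map G c) (map G d) (by simp [h]) := by
  simp [map, comp, PrelaxFunctor.map₂_eqToHom]

@[simp] theorem map_wl (x : W ⟶ X) (c : Cell X Y) :
    map G (wl x c) = wl (G.map x) (map G c) := by
  have h := congrArg of (G.map₂_whisker_left x c.hom)
  simpa only [G.mapComp_eq_eqToIso, eqToIso.hom, eqToIso.inv, of_comp, of_eqToHom, of_whiskerLeft,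
    of_map₂, of_hom, id_comp, comp_id] using h

@[simp] theorem map_wr (c : Cell X Y) (y : Y ⟶ Z) :
    map G (wr c y) = wr (map G c) (G.map y) := by
  have h := congrArg of (G.map₂_whisker_right c.hom y)
  simpa only [G.mapComp_eq_eqToIso, eqToIso.hom, eqToIso.inv, of_comp, of_eqToHom,
    of_whiskerRight, of_map₂, of_hom, id_comp, comp_id] using h

@[simp] theorem of_mapComp_hom (f : W ⟶ X) (g : X ⟶ Y) :
    of (G.mapComp f g).hom = id (G.map (f ≫ g)) := by
  simp [G.mapComp_eq_eqToIso]

@[simp] theorem of_mapComp_inv (f : W ⟶ X) (g : X ⟶ Y) :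
    of (G.mapComp f g).inv = id (G.map (f ≫ g)) := by
  simp [G.mapComp_eq_eqToIso, G.map_comp]

@[simp] theorem of_mapId_inv (X : D) : of (G.mapId X).inv = id (𝟙 (G.obj X)) := by
  simp [G.mapId_eq_eqToIso]

end Functor

section Products

open FiniteProducts₂

variable {D : Type u} [Bicategory.{w, v} D] [FiniteProducts₂ D] {W X Y A B C : D}

/-- The pairing of two total 2-cells. -/
def pair (c : Cell X A) (d : Cell X B) : Cell X (prod A B) :=
  ⟨lift c.src d.src, lift c.tgt d.tgt, pair₂ c.hom d.hom⟩

/-- The tensor product of two total 2-cells. -/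
def tensor (m : prod C C ⟶ C) (c d : Cell X C) : Cell X C :=
  ⟨tens m c.src d.src, tens m c.tgt d.tgt, tens₂ m c.hom d.hom⟩

@[simp] theorem pair_src (c : Cell X A) (d : Cell X B) : (pair c d).src = lift c.src d.src := (rfl)
@[simp] theorem pair_tgt (c : Cell X A) (d : Cell X B) : (pair c d).tgt = lift c.tgt d.tgt := (rfl)
@[simp] theorem tensor_src (m : prod C C ⟶ C) (c d : Cell X C) :
    (tensor m c d).src = tens m c.src d.src := (rfl)
@[simp] theorem tensor_tgt (m : prod C C ⟶ C) (c d : Cell X C) :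
    (tensor m c d).tgt = tens m c.tgt d.tgt := (rfl)

theorem wr_pair (c : Cell X C) (d : Cell X C) (m : prod C C ⟶ C) :
    wr (pair c d) m = tensor m c d := (rfl)

@[simp] theorem of_tens₂ (m : prod C C ⟶ C) {a a' b b' : X ⟶ C} (σ : a ⟶ a') (τ : b ⟶ b') :
    of (tens₂ m σ τ) = tensor m (of σ) (of τ) := (rfl)

@[simp] theorem wr_pair_fst (c : Cell X A) (d : Cell X B) : wr (pair c d) (fst A B) = c := by
  have h := congrArg of (pair₂_fst c.hom d.hom)
  simp only [of_comp, of_eqToHom, of_hom, id_comp, comp_id] at h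
  exact h

@[simp] theorem wr_pair_snd (c : Cell X A) (d : Cell X B) : wr (pair c d) (snd A B) = d := by
  have h := congrArg of (pair₂_snd c.hom d.hom)
  simp only [of_comp, of_eqToHom, of_hom, id_comp, comp_id] at h
  exact h

theorem pair_ext {c d : Cell X (prod A B)} (h₁ : wr c (fst A B) = wr d (fst A B))
    (h₂ : wr c (snd A B) = wr d (snd A B)) : c = d := by
  obtain ⟨f, g, σ⟩ := c
  obtain ⟨f', g', τ⟩ := d
  obtain rfl : f = f' := hom_ext (congrArg Cell.src h₁) (congrArg Cell.src h₂)
  obtain rfl : g = g' := hom_ext (congrArg Cell.tgt h₁) (congrArg Cell.tgt h₂)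
  obtain rfl : σ = τ := hom_ext₂ (of_injective h₁) (of_injective h₂)
  rfl

/-- Two total 2-cells into the terminal 0-cell are equal. -/
theorem eq_of_one (c d : Cell X (one : D)) : c = d := by
  obtain ⟨f, g, σ⟩ := c
  obtain ⟨f', g', τ⟩ := d
  obtain rfl : f = f' := (toOne_unique _).trans (toOne_unique _).symm
  obtain rfl : g = g' := (toOne_unique _).trans (toOne_unique _).symm
  obtain rfl : σ = τ := one_hom_ext₂ _ _
  rfl

@[simp] theorem tensor_id (m : prod C C ⟶ C) (a b : X ⟶ C) :
    tensor m (id a) (id b) = id (tens m a b) := by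
  simp [tensor, id, tens₂_id]

theorem tensor_comp (m : prod C C ⟶ C) (c c' d d' : Cell X C) (h : c.tgt = c'.src)
    (k : d.tgt = d'.src) : tensor m (comp c c' h) (comp d d' k) =
      comp (tensor m c d) (tensor m c' d') (by simp [h, k]) := by
  simp [tensor, comp, tens₂_comp, tens₂_eqToHom]

theorem tensor_comp_left (m : prod C C ⟶ C) (c c' d : Cell X C) (h : c.tgt = c'.src) :
    tensor m (comp c c' h) d =
      comp (tensor m c (id d.src)) (tensor m c' d) (by simp [h]) := by
  rw [← tensor_comp _ _ _ _ _ _ (by simp), id_comp]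

theorem tensor_comp_right (m : prod C C ⟶ C) (c c' d : Cell X C) (h : c.tgt = c'.src) :
    tensor m d (comp c c' h) =
      comp (tensor m (id d.src) c) (tensor m d c') (by simp [h]) := by
  rw [← tensor_comp _ _ _ _ _ (by simp), id_comp]

variable [Strict D]

@[simp] theorem wl_pair (x : W ⟶ X) (c : Cell X A) (d : Cell X B) :
    wl x (pair c d) = pair (wl x c) (wl x d) := by
  apply pair_ext <;> simp [← wl_wr]

@[simp] theorem wl_tensor (x : W ⟶ X) (m : prod C C ⟶ C) (c d : Cell X C) :
    wl x (tensor m c d) = tensor m (wl x c) (wl x d) := by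
  rw [← wr_pair, wl_wr, wl_pair, wr_pair]

@[simp] theorem wr_lift (c : Cell W X) (a : X ⟶ A) (b : X ⟶ B) :
    wr c (lift a b) = pair (wr c a) (wr c b) := by
  apply pair_ext
  · rw [← wr_comp₁, lift_fst, wr_pair_fst]
  · rw [← wr_comp₁, lift_snd, wr_pair_snd]

@[simp] theorem wr_tens (c : Cell W X) (m : prod C C ⟶ C) (a b : X ⟶ C) :
    wr c (tens m a b) = tensor m (wr c a) (wr c b) := by
  rw [tens, wr_comp₁, wr_lift, wr_pair]

@[simp] theorem wr_const (c : Cell W X) (I : one ⟶ C) :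
    wr c (const I X) = id (const I W) := by
  rw [const, wr_comp₁, eq_of_one (wr c (toOne X)) (id (toOne W)), wr_id]
  rfl

theorem wl_lift_fst (c : Cell A Y) (a : X ⟶ A) (b : X ⟶ B) :
    wl (lift a b) (wl (fst A B) c) = wl a c := by
  rw [← wl_comp₁, lift_fst]

theorem wl_lift_snd (c : Cell B Y) (a : X ⟶ A) (b : X ⟶ B) :
    wl (lift a b) (wl (snd A B) c) = wl b c := by
  rw [← wl_comp₁, lift_snd]

theorem wl_tens (m : prod C C ⟶ C) (a b : X ⟶ C) (c : Cell C Y) :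
    wl (tens m a b) c = wl (lift a b) (wl m c) := by
  rw [tens, wl_comp₁]

theorem wl_const (I : one ⟶ C) (c : Cell C Y) :
    wl (const I X) c = wl (toOne X) (wl I c) := by
  rw [const, wl_comp₁]

end Products

end Cell

/-! ### Universal arrows and right 2-adjoints -/

section Universal

variable {B : Type u} [Bicategory.{w, v} B] {C : Type u'} [Bicategory.{w', v'} C]

/-- `κ : L X ⟶ S` is a universal arrow from the 2-functor `L` to `S`: composition with `κ` is an
isomorphism of categories `B(Z, X) ≅ C(L Z, S)` for every `Z`. This is expressed as a bijection
on total 2-cells, that is, on the morphisms of the two categories. -/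
def IsUniversal (L : StrictPseudofunctor B C) {X : B} {S : C} (κ : L.obj X ⟶ S) : Prop :=
  ∀ Z : B, Function.Bijective (fun d : Cell Z X => Cell.wr (Cell.map L d) κ)

namespace IsUniversal

variable {L : StrictPseudofunctor B C} {X Z : B} {S : C} {κ : L.obj X ⟶ S}

theorem cell_ext (H : IsUniversal L κ) {c d : Cell Z X}
    (h : Cell.wr (Cell.map L c) κ = Cell.wr (Cell.map L d) κ) : c = d :=
  (H Z).1 h

theorem hom_ext (H : IsUniversal L κ) {f g : Z ⟶ X} (h : L.map f ≫ κ = L.map g ≫ κ) : f = g :=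
  congrArg Cell.src (H.cell_ext (c := Cell.id f) (d := Cell.id g) (by simp [h]))

/-- The total 2-cell into `X` corresponding to a total 2-cell into `S`. -/
noncomputable def lift (H : IsUniversal L κ) (c : Cell (L.obj Z) S) : Cell Z X :=
  ((H Z).2 c).choose

theorem lift_spec (H : IsUniversal L κ) (c : Cell (L.obj Z) S) :
    Cell.wr (Cell.map L (H.lift c)) κ = c :=
  ((H Z).2 c).choose_spec

/-- The 1-cell into `X` corresponding to a 1-cell into `S`. -/
noncomputable def liftHom (H : IsUniversal L κ) (f : L.obj Z ⟶ S) : Z ⟶ X :=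
  (H.lift (Cell.id f)).src

theorem liftHom_spec (H : IsUniversal L κ) (f : L.obj Z ⟶ S) : L.map (H.liftHom f) ≫ κ = f :=
  congrArg Cell.src (H.lift_spec (Cell.id f))

theorem lift_src (H : IsUniversal L κ) (c : Cell (L.obj Z) S) :
    (H.lift c).src = H.liftHom c.src :=
  H.hom_ext ((congrArg Cell.src (H.lift_spec c)).trans (H.liftHom_spec _).symm)

theorem lift_tgt (H : IsUniversal L κ) (c : Cell (L.obj Z) S) :
    (H.lift c).tgt = H.liftHom c.tgt :=
  H.hom_ext ((congrArg Cell.tgt (H.lift_spec c)).trans (H.liftHom_spec _).symm)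

/-- The 2-cell into `X` corresponding to a 2-cell into `S`. -/
noncomputable def lift₂ (H : IsUniversal L κ) {f g : L.obj Z ⟶ S} (σ : f ⟶ g) :
    H.liftHom f ⟶ H.liftHom g :=
  (H.lift (Cell.of σ)).cast (H.lift_src _) (H.lift_tgt _)

@[simp] theorem of_lift₂ (H : IsUniversal L κ) {f g : L.obj Z ⟶ S} (σ : f ⟶ g) :
    Cell.of (H.lift₂ σ) = H.lift (Cell.of σ) :=
  Cell.of_cast _ _ _

theorem lift_comp (H : IsUniversal L κ) (c d : Cell (L.obj Z) S) (h : c.tgt = d.src) :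
    H.lift (Cell.comp c d h) = Cell.comp (H.lift c) (H.lift d)
      (by rw [H.lift_tgt, H.lift_src, h]) :=
  H.cell_ext (by simp only [lift_spec, Cell.map_comp₂, Cell.wr_comp])

theorem lift_id (H : IsUniversal L κ) (f : L.obj Z ⟶ S) :
    H.lift (Cell.id f) = Cell.id (H.liftHom f) :=
  H.cell_ext (by simp only [lift_spec, Cell.map_id₂, Cell.wr_id, liftHom_spec])

/-- A universal arrow stays universal after composition with an isomorphism of 0-cells. -/
theorem comp_iso [Strict B] [Strict C] (H : IsUniversal L κ) {X' : B} (e : X' ⟶ X) (e' : X ⟶ X')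
    (h : e ≫ e' = 𝟙 X') (h' : e' ≫ e = 𝟙 X) : IsUniversal L (L.map e ≫ κ) := by
  intro Z
  constructor
  · intro c d hcd
    simp only [Cell.wr_comp₁, ← Cell.map_wr] at hcd
    have := congrArg (Cell.wr · e') (H.cell_ext hcd)
    simpa only [← Cell.wr_comp₁, h, Cell.wr_id₁] using this
  · intro c
    refine ⟨Cell.wr (H.lift c) e', ?_⟩
    simp only [Cell.wr_comp₁, ← Cell.map_wr]
    rw [← Cell.wr_comp₁, h', Cell.wr_id₁, H.lift_spec]

/-- Universality from separate statements about 1-cells and 2-cells. -/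
theorem of_lift_of_injective (h₁ : ∀ Z (f : L.obj Z ⟶ S), ∃ h : Z ⟶ X, L.map h ≫ κ = f)
    (h₂ : ∀ Z (f g : Z ⟶ X) (σ : L.map f ≫ κ ⟶ L.map g ≫ κ),
      ∃ τ : f ⟶ g, Cell.wr (Cell.map L (Cell.of τ)) κ = Cell.of σ)
    (h₃ : ∀ Z (c d : Cell Z X), Cell.wr (Cell.map L c) κ = Cell.wr (Cell.map L d) κ → c = d) :
    IsUniversal L κ := by
  refine fun Z => ⟨fun c d => h₃ Z c d, ?_⟩
  rintro ⟨f, g, σ⟩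
  obtain ⟨f, rfl⟩ := h₁ Z f
  obtain ⟨g, rfl⟩ := h₁ Z g
  obtain ⟨τ, hτ⟩ := h₂ Z f g σ
  exact ⟨Cell.of τ, hτ⟩

end IsUniversal

/-- 2-naturality on total 2-cells. -/
theorem NatTrans₂.cell_naturality {F G : StrictPseudofunctor B C} (θ : NatTrans₂ F G) {X Y : B}
    (c : Cell X Y) :
    Cell.wr (Cell.map F c) (θ.app Y) = Cell.wl (θ.app X) (Cell.map G c) := by
  have h := congrArg Cell.of (θ.naturality₂ c.hom)
  simpa only [Cell.of_comp, Cell.of_eqToHom, Cell.of_whiskerRight, Cell.of_whiskerLeft,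
    Cell.of_map₂, Cell.of_hom, Cell.id_comp, Cell.comp_id] using h

/-- A 2-natural transformation from 2-naturality on total 2-cells. -/
def NatTrans₂.ofCell {F G : StrictPseudofunctor B C} (app : ∀ X, F.obj X ⟶ G.obj X)
    (h : ∀ {X Y : B} (c : Cell X Y),
      Cell.wr (Cell.map F c) (app Y) = Cell.wl (app X) (Cell.map G c)) : NatTrans₂ F G where
  app := app
  naturality f := by simpa using congrArg Cell.src (h (Cell.id f))
  naturality₂ σ := Cell.of_injective (by simpa using h (Cell.of σ))

variable {L : StrictPseudofunctor B C}

namespace RightAdjoint₂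

variable (P : RightAdjoint₂ L)

/-- A component of the unit. -/
def unitApp (Z : B) : Z ⟶ P.right.obj (L.obj Z) := P.unit.app Z

/-- A component of the counit. -/
def counitApp (S : C) : L.obj (P.right.obj S) ⟶ S := P.counit.app S

theorem unitApp_naturality {X Y : B} (c : Cell X Y) :
    Cell.wr c (P.unitApp Y) = Cell.wl (P.unitApp X) (Cell.map P.right (Cell.map L c)) :=
  P.unit.cell_naturality c

theorem counitApp_naturality {S T : C} (c : Cell S T) :
    Cell.wr (Cell.map L (Cell.map P.right c)) (P.counitApp T) = Cell.wl (P.counitApp S) c :=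
  P.counit.cell_naturality c

theorem map_unitApp_counitApp (Z : B) :
    L.map (P.unitApp Z) ≫ P.counitApp (L.obj Z) = 𝟙 (L.obj Z) := P.left_triangle Z

theorem unitApp_map_counitApp (S : C) :
    P.unitApp (P.right.obj S) ≫ P.right.map (P.counitApp S) = 𝟙 (P.right.obj S) :=
  P.right_triangle S

variable [Strict C]

/-- The 1-cell corresponding to `f` under a 2-adjunction. -/
theorem map_unitApp_comp_counitApp {Z : B} {S : C} (f : L.obj Z ⟶ S) :
    L.map (P.unitApp Z ≫ P.right.map f) ≫ P.counitApp S = f := by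
  have h := congrArg Cell.src (P.counitApp_naturality (Cell.id f))
  simp only [Cell.map_id₂, Cell.wr_id, Cell.wl_id, Cell.id_src] at h
  rw [L.map_comp, Strict.assoc, h, ← Strict.assoc, P.map_unitApp_counitApp, Strict.id_comp]

variable [Strict B]

/-- The counit of a right 2-adjoint consists of universal arrows. -/
theorem isUniversal (S : C) : IsUniversal L (P.counitApp S) := by
  intro Z
  constructor
  · intro c d hcd
    have key : ∀ c : Cell Z (P.right.obj S), Cell.wl (P.unitApp Z)
        (Cell.map P.right (Cell.wr (Cell.map L c) (P.counitApp S))) = c := by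
      intro c
      rw [Cell.map_wr, Cell.wl_wr, ← P.unitApp_naturality, ← Cell.wr_comp₁,
        P.unitApp_map_counitApp, Cell.wr_id₁]
    rw [← key c, ← key d]
    exact congrArg (fun c => Cell.wl (P.unitApp Z) (Cell.map P.right c)) hcd
  · intro c
    refine ⟨Cell.wl (P.unitApp Z) (Cell.map P.right c), ?_⟩
    dsimp only
    rw [Cell.map_wl, ← Cell.wl_wr, P.counitApp_naturality, ← Cell.wl_comp₁,
      P.map_unitApp_counitApp, Cell.wl_id₁]

end RightAdjoint₂

variable [Strict B] [Strict C]

variable (obj : C → B) (κ : ∀ S, L.obj (obj S) ⟶ S) (H : ∀ S, IsUniversal L (κ S))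

/-- The 2-functor determined by a universal arrow from `L` to each 0-cell. -/
noncomputable def rightOfUniversal : StrictPseudofunctor C B :=
  StrictPseudofunctor.mk''
  { obj := obj
    map := fun {S S'} F => (H S').liftHom (κ S ≫ F)
    map₂ := fun {S S' F G} σ => (H S').lift₂ (κ S ◁ σ)
    map₂_id := fun {S S'} F => Cell.of_injective (by
      rw [IsUniversal.of_lift₂, whiskerLeft_id, Cell.of_id, IsUniversal.lift_id, Cell.of_id])
    map₂_comp := fun {S S' _ _ _} σ τ => Cell.of_injective (by
      simp only [IsUniversal.of_lift₂, whiskerLeft_comp, Cell.of_comp, IsUniversal.lift_comp])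
    map_id := fun S => (H S).hom_ext (by
      rw [IsUniversal.liftHom_spec, L.map_id, Strict.id_comp, Strict.comp_id])
    map_comp := fun {S S' S''} F G => (H S'').hom_ext (by
      rw [IsUniversal.liftHom_spec, L.map_comp, Strict.assoc, IsUniversal.liftHom_spec,
        ← Strict.assoc (L.map _), IsUniversal.liftHom_spec, Strict.assoc])
    map₂_whisker_left := fun {S S' S''} F _ _ σ => Cell.of_injective ((H S'').cell_ext (by
      simp only [Cell.of_comp, Cell.of_eqToHom, Cell.id_comp, Cell.comp_id, Cell.of_whiskerLeft,
        IsUniversal.of_lift₂, IsUniversal.lift_spec, Cell.map_wl]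
      rw [← Cell.wl_wr, IsUniversal.lift_spec, ← Cell.wl_comp₁, ← Cell.wl_comp₁,
        IsUniversal.liftHom_spec]))
    map₂_whisker_right := fun {S S' S'' _ _} σ G => Cell.of_injective ((H S'').cell_ext (by
      simp only [Cell.of_comp, Cell.of_eqToHom, Cell.id_comp, Cell.comp_id, Cell.of_whiskerLeft,
        Cell.of_whiskerRight, IsUniversal.of_lift₂, IsUniversal.lift_spec, Cell.map_wr]
      rw [← Cell.wr_comp₁, IsUniversal.liftHom_spec, Cell.wr_comp₁, IsUniversal.lift_spec,
        Cell.wl_wr])) }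

theorem map_rightOfUniversal {S S' : C} (c : Cell S S') :
    (Cell.map (rightOfUniversal obj κ H) c : Cell (obj S) (obj S')) =
      (H S').lift (Cell.wl (κ S) c) :=
  (H S').of_lift₂ (κ S ◁ c.hom)

/-- The components of the unit determined by universal arrows. -/
noncomputable def unitOfUniversal (X : B) : X ⟶ obj (L.obj X) := (H (L.obj X)).liftHom (𝟙 (L.obj X))

theorem unitOfUniversal_naturality {X Y : B} (c : Cell X Y) :
    Cell.wr c (unitOfUniversal obj κ H Y) =
      Cell.wl (unitOfUniversal obj κ H X)
        (Cell.map (rightOfUniversal obj κ H) (Cell.map L c)) := by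
  have e : Cell.wr c (unitOfUniversal obj κ H Y) = Cell.wl (unitOfUniversal obj κ H X)
      ((H (L.obj Y)).lift (Cell.wl (κ (L.obj X)) (Cell.map L c))) := by
    refine (H _).cell_ext ?_
    unfold unitOfUniversal
    rw [Cell.map_wr, ← Cell.wr_comp₁, IsUniversal.liftHom_spec, Cell.wr_id₁, Cell.map_wl,
      ← Cell.wl_wr, IsUniversal.lift_spec, ← Cell.wl_comp₁, IsUniversal.liftHom_spec,
      Cell.wl_id₁]
  exact e.trans (congrArg (Cell.wl (unitOfUniversal obj κ H X))
    (map_rightOfUniversal obj κ H (Cell.map L c)).symm)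

/-- A 2-functor has a right 2-adjoint as soon as there is a universal arrow from it to each
0-cell. -/
noncomputable def rightAdjointOfUniversal : RightAdjoint₂ L where
  right := rightOfUniversal obj κ H
  unit := NatTrans₂.ofCell (unitOfUniversal obj κ H)
    (fun c => unitOfUniversal_naturality obj κ H c)
  counit := NatTrans₂.ofCell κ (fun {S S'} c => by
    exact (congrArg (fun c => Cell.wr (Cell.map L c) (κ S')) (map_rightOfUniversal obj κ H c)).trans
      ((H S').lift_spec (Cell.wl (κ S) c)))
  left_triangle X := (H _).liftHom_spec _
  right_triangle S := (H S).hom_ext (by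
    change L.map ((H (L.obj (obj S))).liftHom (𝟙 _) ≫
      (H S).liftHom (κ (L.obj (obj S)) ≫ κ S)) ≫ κ S = L.map (𝟙 (obj S)) ≫ κ S
    rw [L.map_comp, Strict.assoc, IsUniversal.liftHom_spec, ← Strict.assoc,
      IsUniversal.liftHom_spec, L.map_id])

end Universal

/-! ### Total 2-cells of the 2-category of monads -/

namespace Mnd

section

variable {D : Type u} [Bicategory.{w, v} D]

/-- The total 2-cell of `D` underlying a total 2-cell of `Mnd D`. -/
def cell {A B : Mnd D} (c : Cell A B) : Cell A.obj B.obj := Cell.of (Hom₂.hom c.hom)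

@[simp] theorem cell_wl {A B C : Mnd D} (F : A ⟶ B) (c : Cell B C) :
    cell (Cell.wl F c) = Cell.wl F.hom (cell c) := (rfl)
@[simp] theorem cell_wr {A B C : Mnd D} (c : Cell A B) (F : B ⟶ C) :
    cell (Cell.wr c F) = Cell.wr (cell c) F.hom := (rfl)

theorem cell_ext {A B : Mnd D} {c d : Cell A B} (h₁ : c.src = d.src) (h₂ : c.tgt = d.tgt)
    (h : cell c = cell d) : c = d := by
  obtain ⟨f, g, σ⟩ := c
  obtain ⟨f', g', τ⟩ := d
  obtain rfl : f = f' := h₁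
  obtain rfl : g = g' := h₂
  obtain rfl : σ = τ := hom₂_ext (Cell.of_injective h)
  rfl

/-- Equality of lax morphisms in terms of total 2-cells. -/
theorem hom_ext_of {A B : Mnd D} {F G : A ⟶ B} (h : F.hom = G.hom)
    (hc : Cell.of F.cell = Cell.of G.cell) : F = G :=
  hom_ext h (Cell.of_injective (by simpa using hc))

theorem eqToHom_hom {A B : Mnd D} (h : A = B) :
    Hom.hom (eqToHom h) = eqToHom (congrArg Mnd.obj h) := by
  subst h; rfl

variable [Strict D]

@[simp] theorem of_cell_comp {A B C : Mnd D} (F : A ⟶ B) (G : B ⟶ C) :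
    Cell.of (Hom.cell (F ≫ G)) = Cell.comp (Cell.wl F.hom (Cell.of G.cell))
      (Cell.wr (Cell.of F.cell) G.hom) (by simp) := by
  simp [comp_cell]

@[simp] theorem of_cell_id (A : Mnd D) : Cell.of (Hom.cell (𝟙 A)) = Cell.id A.endo := by
  simp [id_cell]

@[simp] theorem of_cell_idMonadMap {X Y : D} (f : X ⟶ Y) :
    Cell.of (idMonadMap f).cell = Cell.id f := by
  refine Eq.trans (b := Cell.of ((ρ_ f).hom ≫ (λ_ f).inv)) rfl ?_
  simp

@[simp] theorem of_cell_iota_map {X Y : D} (f : X ⟶ Y) :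
    Cell.of ((iota D).map f).cell = Cell.id f :=
  of_cell_idMonadMap f

@[simp] theorem cell_map_iota {X Y : D} (c : Cell X Y) : cell (Cell.map (iota D) c) = c := (rfl)

theorem of_cell_eqToHom {A B : Mnd D} (h : A = B) :
    Cell.of (Hom.cell (eqToHom h)) = Cell.id (A.endo ≫ Hom.hom (eqToHom h)) := by
  subst h
  rw [eqToHom_refl, of_cell_id, id_hom, Strict.comp_id]

end

section

variable {D : Type u} [Bicategory.{w, v} D] [Strict D]
  {E : Type u'} [Bicategory.{w', v'} E] [Strict E] (G : StrictPseudofunctor D E)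

theorem of_cell_map_map {A B : Mnd D} (F : A ⟶ B) :
    Cell.of ((Mnd.map G).map F).cell = Cell.map G (Cell.of F.cell) := by
  change Cell.of ((G.mapComp F.hom B.endo).inv ≫ G.map₂ F.cell ≫
    (G.mapComp A.endo F.hom).hom) = _
  simp

theorem cell_map_map {A B : Mnd D} (c : Cell A B) :
    cell (Cell.map (Mnd.map G) c) = Cell.map G (cell c) := (rfl)

/-- The lax morphism `ι (G X) ⟶ Mnd(G) (ι X)` given by the equality of the two monads. -/
def iotaComm (X : D) : (iota E).obj (G.obj X) ⟶ (Mnd.map G).obj ((iota D).obj X) :=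
  eqToHom (iota_comm_obj G X)

theorem iotaComm_hom (X : D) : (iotaComm G X).hom = 𝟙 (G.obj X) :=
  eqToHom_hom (iota_comm_obj G X)

theorem of_cell_iotaComm (X : D) : Cell.of (iotaComm G X).cell = Cell.id (𝟙 (G.obj X)) := by
  refine (of_cell_eqToHom (iota_comm_obj G X)).trans (congrArg Cell.id ?_)
  refine Eq.trans ?_ (Strict.id_comp (𝟙 (G.obj X)))
  exact congrArg (𝟙 (G.obj X) ≫ ·) (iotaComm_hom G X)

theorem iotaComm_naturality₁ {X Y : D} (f : X ⟶ Y) :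
    (iota E).map (G.map f) ≫ iotaComm G Y = iotaComm G X ≫ (Mnd.map G).map ((iota D).map f) := by
  refine hom_ext_of ?_ ?_
  · rw [comp_hom, comp_hom, iotaComm_hom, iotaComm_hom]
    exact (Strict.comp_id (G.map f)).trans (Strict.id_comp (G.map f)).symm
  · rw [of_cell_comp, of_cell_comp]
    simp only [of_cell_iotaComm, iotaComm_hom, of_cell_map_map, of_cell_iota_map]
    have e₁ (h) : Cell.comp (Cell.wl (G.map f) (Cell.id (𝟙 (G.obj Y))))
        (Cell.wr (Cell.id (G.map f)) (𝟙 (G.obj Y))) h = Cell.id (G.map f) := by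
      simp
    have e₂ (h) : Cell.comp (Cell.wl (𝟙 (G.obj X)) (Cell.map G (Cell.id f)))
        (Cell.wr (Cell.id (𝟙 (G.obj X))) (G.map f)) h = Cell.id (G.map f) := by
      simp
    exact (e₁ _).trans (e₂ _).symm

/-- The identity `Mnd(G) ∘ ι = ι ∘ G` on total 2-cells. -/
theorem iotaComm_naturality {X Y : D} (c : Cell X Y) :
    Cell.wr (Cell.map (iota E) (Cell.map G c)) (iotaComm G Y) =
      Cell.wl (iotaComm G X) (Cell.map (Mnd.map G) (Cell.map (iota D) c)) := by
  refine cell_ext (iotaComm_naturality₁ G c.src) (iotaComm_naturality₁ G c.tgt) ?_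
  rw [cell_wr, cell_wl, iotaComm_hom, iotaComm_hom, cell_map_map, cell_map_iota, cell_map_iota]
  exact (Cell.wr_id₁ _).trans (Cell.wl_id₁ _).symm

end

end Mnd

/-! ### Comparison of Eilenberg-Moore objects along a 2-functor -/

section Comparison

variable {D : Type u} [Bicategory.{w, v} D] [Strict D]
  {E : Type u'} [Bicategory.{w', v'} E] [Strict E]

/-- The image under `Mnd(G)` of a lax morphism `ι X ⟶ S`, as a lax morphism out of `ι (G X)`. -/
def mapArrow (G : StrictPseudofunctor D E) {X : D} {S : Mnd D} (F : (Mnd.iota D).obj X ⟶ S) :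
    (Mnd.iota E).obj (G.obj X) ⟶ (Mnd.map G).obj S :=
  Mnd.iotaComm G X ≫ (Mnd.map G).map F

variable (G : StrictPseudofunctor D E) (P : EMStructure D) (Q : EMStructure E)

theorem mapArrow_comp {X Y : D} {S : Mnd D} (f : X ⟶ Y) (F : (Mnd.iota D).obj Y ⟶ S) :
    mapArrow G ((Mnd.iota D).map f ≫ F) = (Mnd.iota E).map (G.map f) ≫ mapArrow G F := by
  rw [mapArrow, mapArrow, ← Strict.assoc, Mnd.iotaComm_naturality₁, Strict.assoc,
    StrictPseudofunctor.map_comp]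

theorem mapArrow_counit_naturality {S T : Mnd D} (c : Cell S T) :
    Cell.wr (Cell.map (Mnd.iota E) (Cell.map G (Cell.map P.right c))) (mapArrow G (P.counitApp T)) =
      Cell.wl (mapArrow G (P.counitApp S)) (Cell.map (Mnd.map G) c) := by
  rw [mapArrow, mapArrow, Cell.wr_comp₁, Mnd.iotaComm_naturality, ← Cell.wl_wr, ← Cell.map_wr,
    P.counitApp_naturality, Cell.map_wl, Cell.wl_comp₁]

/-- The comparison, with its source and target in normal form. -/
def comparison (S : Mnd D) : G.obj (P.right.obj S) ⟶ Q.right.obj ((Mnd.map G).obj S) :=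
  emComparison G P Q S

theorem comparison_spec (S : Mnd D) :
    (Mnd.iota E).map (comparison G P Q S) ≫ Q.counitApp ((Mnd.map G).obj S) =
      mapArrow G (P.counitApp S) :=
  Q.map_unitApp_comp_counitApp (mapArrow G (P.counitApp S))

theorem comparison_naturality {S T : Mnd D} (c : Cell S T) :
    Cell.wr (Cell.map G (Cell.map P.right c)) (comparison G P Q T) =
      Cell.wl (comparison G P Q S) (Cell.map Q.right (Cell.map (Mnd.map G) c)) := by
  refine (Q.isUniversal _).cell_ext ?_
  rw [Cell.map_wr, ← Cell.wr_comp₁, comparison_spec, mapArrow_counit_naturality, Cell.map_wl,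
    ← Cell.wl_wr, Q.counitApp_naturality, ← Cell.wl_comp₁, comparison_spec]

/-- If `G` sends the universal arrows of `D` to universal arrows, then the comparison is a
2-natural isomorphism. -/
theorem exists_comparison_inverse
    (H : ∀ S, IsUniversal (Mnd.iota E) (mapArrow G (P.counitApp S))) :
    ∃ (θ : NatTrans₂ (P.right.comp G) ((Mnd.map G).comp Q.right))
      (θ' : NatTrans₂ ((Mnd.map G).comp Q.right) (P.right.comp G)),
      (∀ S, θ.app S = emComparison G P Q S) ∧
      (∀ S, θ.app S ≫ θ'.app S = 𝟙 (G.obj (P.right.obj S))) ∧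
      (∀ S, θ'.app S ≫ θ.app S = 𝟙 (Q.right.obj ((Mnd.map G).obj S))) := by
  let k (S : Mnd D) : Q.right.obj ((Mnd.map G).obj S) ⟶ G.obj (P.right.obj S) :=
    (H S).liftHom (Q.counitApp ((Mnd.map G).obj S))
  have k_spec (S : Mnd D) : (Mnd.iota E).map (k S) ≫ mapArrow G (P.counitApp S) =
      Q.counitApp ((Mnd.map G).obj S) := (H S).liftHom_spec _
  have h₁ (S : Mnd D) : comparison G P Q S ≫ k S = 𝟙 _ := (H S).hom_ext (by
    rw [StrictPseudofunctor.map_comp, Strict.assoc, k_spec, comparison_spec,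
      StrictlyUnitaryPseudofunctor.map_id, Strict.id_comp])
  have h₂ (S : Mnd D) : k S ≫ comparison G P Q S = 𝟙 _ := (Q.isUniversal _).hom_ext (by
    rw [StrictPseudofunctor.map_comp, Strict.assoc, comparison_spec, k_spec,
      StrictlyUnitaryPseudofunctor.map_id, Strict.id_comp])
  have hk {S T : Mnd D} (c : Cell S T) :
      Cell.wr (Cell.map Q.right (Cell.map (Mnd.map G) c)) (k T) =
        Cell.wl (k S) (Cell.map G (Cell.map P.right c)) := by
    refine (H T).cell_ext ?_
    rw [Cell.map_wr, ← Cell.wr_comp₁, k_spec, Q.counitApp_naturality, Cell.map_wl,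
      ← Cell.wl_wr, mapArrow_counit_naturality, ← Cell.wl_comp₁, k_spec]
  exact ⟨NatTrans₂.ofCell (comparison G P Q) (fun c => comparison_naturality G P Q c),
    NatTrans₂.ofCell k (fun c => hk c), fun _ => rfl, h₁, h₂⟩

/-- If `G` sends one universal arrow from `ι` to `S` to a universal arrow, it does so with every
such universal arrow. -/
theorem isUniversal_mapArrow_of_isUniversal {S : Mnd D} {X X' : D} {F : (Mnd.iota D).obj X ⟶ S}
    {F' : (Mnd.iota D).obj X' ⟶ S} (hF : IsUniversal (Mnd.iota D) F)
    (hF' : IsUniversal (Mnd.iota D) F') (H : IsUniversal (Mnd.iota E) (mapArrow G F)) :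
    IsUniversal (Mnd.iota E) (mapArrow G F') := by
  have h₁ : hF.liftHom F' ≫ hF'.liftHom F = 𝟙 X' := hF'.hom_ext (by
    rw [StrictPseudofunctor.map_comp, Strict.assoc, hF'.liftHom_spec, hF.liftHom_spec,
      StrictlyUnitaryPseudofunctor.map_id, Strict.id_comp])
  have h₂ : hF'.liftHom F ≫ hF.liftHom F' = 𝟙 X := hF.hom_ext (by
    rw [StrictPseudofunctor.map_comp, Strict.assoc, hF.liftHom_spec, hF'.liftHom_spec,
      StrictlyUnitaryPseudofunctor.map_id, Strict.id_comp])
  have h := H.comp_iso (G.map (hF.liftHom F')) (G.map (hF'.liftHom F))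
    (by rw [← G.map_comp, h₁, G.map_id]) (by rw [← G.map_comp, h₂, G.map_id])
  rwa [← mapArrow_comp, hF.liftHom_spec] at h

end Comparison

/-! ### Algebras of a monad -/

namespace Mnd

variable {D : Type u} [Bicategory.{w, v} D] [Strict D]

/-- The action of a lax morphism `(f, a) : ι Y ⟶ S`, that is, of an algebra `f : Y ⟶ C` of the
monad `S` at the stage `Y`, as a total 2-cell `S f ⟶ f`. -/
def act {Y : D} {S : Mnd D} (F : (iota D).obj Y ⟶ S) : Cell Y S.obj :=
  Cell.of (X := Y) (Y := S.obj) (Hom.cell F)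

/-- The 1-cell underlying an algebra. -/
def carrier {Y : D} {S : Mnd D} (F : (iota D).obj Y ⟶ S) : Y ⟶ S.obj := Hom.hom F

/-- The total 2-cell underlying a morphism of algebras. -/
def homCell {Y : D} {S : Mnd D} {F G : (iota D).obj Y ⟶ S} (σ : F ⟶ G) : Cell Y S.obj :=
  Cell.of (X := Y) (Y := S.obj) (Hom₂.hom σ)

section

variable {X Y : D} {S : Mnd D}

@[simp] theorem homCell_src {F G : (iota D).obj Y ⟶ S} (σ : F ⟶ G) :
    (homCell σ).src = carrier F := (rfl)

@[simp] theorem homCell_tgt {F G : (iota D).obj Y ⟶ S} (σ : F ⟶ G) :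
    (homCell σ).tgt = carrier G := (rfl)

@[simp] theorem act_src (F : (iota D).obj Y ⟶ S) : (act F).src = carrier F ≫ S.endo := (rfl)

@[simp] theorem act_tgt (F : (iota D).obj Y ⟶ S) : (act F).tgt = carrier F := Strict.id_comp _

/-- The unit law of a lax morphism out of an identity monad is the unit law of an algebra. -/
theorem unit_iff (f : Y ⟶ S.obj) (a : f ≫ S.endo ⟶ 𝟙 Y ≫ f) :
    f ◁ S.unit ≫ a = (ρ_ f).hom ≫ (λ_ f).inv ≫ 𝟙 (𝟙 Y) ▷ f ↔
      Cell.comp (Cell.wl f (Cell.of S.unit)) (Cell.of a) (by simp) = Cell.id f := by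
  rw [← Cell.of_inj]
  simp

/-- The multiplication law of a lax morphism out of an identity monad is the associativity of an
action. -/
theorem mul_iff (f : Y ⟶ S.obj) (a : f ≫ S.endo ⟶ 𝟙 Y ≫ f) :
    f ◁ S.mul ≫ a = (α_ f S.endo S.endo).inv ≫ a ▷ S.endo ≫ (α_ (𝟙 Y) f S.endo).hom ≫
        𝟙 Y ◁ a ≫ (α_ (𝟙 Y) (𝟙 Y) f).inv ≫ (λ_ (𝟙 Y)).hom ▷ f ↔
      Cell.comp (Cell.wl f (Cell.of S.mul)) (Cell.of a) (by simp) =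
        Cell.comp (Cell.wr (Cell.of a) S.endo) (Cell.of a) (by simp) := by
  rw [← Cell.of_inj]
  simp

/-- A transformation of lax morphisms out of an identity monad is a morphism of algebras. -/
theorem comm_iff {f g : Y ⟶ S.obj} (a : f ≫ S.endo ⟶ 𝟙 Y ≫ f) (b : g ≫ S.endo ⟶ 𝟙 Y ≫ g)
    (c : f ⟶ g) : c ▷ S.endo ≫ b = a ≫ 𝟙 Y ◁ c ↔
      Cell.comp (Cell.wr (Cell.of c) S.endo) (Cell.of b) (by simp) =
        Cell.comp (Cell.of a) (Cell.of c) (by simp) := by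
  rw [← Cell.of_inj]
  simp

theorem unit_act (F : (iota D).obj Y ⟶ S) :
    Cell.comp (Cell.wl (carrier F) (Cell.of S.unit)) (act F) (by simp) = Cell.id (carrier F) :=
  (unit_iff (carrier F) F.cell).1 F.unit_cell

theorem mul_act (F : (iota D).obj Y ⟶ S) :
    Cell.comp (Cell.wl (carrier F) (Cell.of S.mul)) (act F) (by simp) =
      Cell.comp (Cell.wr (act F) S.endo) (act F) (by simp) :=
  (mul_iff (carrier F) F.cell).1 F.mul_cell

/-- An algebra, from its action given as a total 2-cell. -/
theorem exists_act (f : Y ⟶ S.obj) (a : Cell Y S.obj) (hs : a.src = f ≫ S.endo) (ht : a.tgt = f)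
    (hu : Cell.comp (Cell.wl f (Cell.of S.unit)) a (by simp [hs]) = Cell.id f)
    (hm : Cell.comp (Cell.wl f (Cell.of S.mul)) a (by simp [hs]) =
      Cell.comp (Cell.wr a S.endo) a (by simp [hs, ht])) :
    ∃ F : (iota D).obj Y ⟶ S, carrier F = f ∧ act F = a := by
  obtain ⟨a, rfl⟩ := Cell.exists_of a hs (ht.trans (Strict.id_comp f).symm)
  exact ⟨Hom.mk (A := idMonad Y) (B := S) f a ((unit_iff f a).2 hu) ((mul_iff f a).2 hm),
    rfl, rfl⟩

@[simp] theorem carrier_comp (h : Y ⟶ X) (F : (iota D).obj X ⟶ S) :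
    carrier ((iota D).map h ≫ F) = h ≫ carrier F := (rfl)

@[simp] theorem act_comp (h : Y ⟶ X) (F : (iota D).obj X ⟶ S) :
    act ((iota D).map h ≫ F) = Cell.wl h (act F) := by
  refine (of_cell_comp _ _).trans ?_
  have e (k) : Cell.comp (Cell.wl h (act F)) (Cell.wr (Cell.id h) (carrier F)) k =
      Cell.wl h (act F) := by
    simp
  exact Eq.trans (by simp only [of_cell_iota_map]; rfl) (e _)

theorem alg_ext {F G : (iota D).obj Y ⟶ S} (h : carrier F = carrier G) (h' : act F = act G) :
    F = G :=
  hom_ext_of h h'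

/-- A 2-cell compatible with the actions of two algebras, as a 2-cell of lax morphisms. -/
theorem exists_algHom {F G : (iota D).obj Y ⟶ S} (c : Cell Y S.obj) (hs : c.src = carrier F)
    (ht : c.tgt = carrier G)
    (h : Cell.comp (Cell.wr c S.endo) (act G) (by simp [ht]) =
      Cell.comp (act F) c (by simp [hs])) :
    ∃ σ : F ⟶ G, homCell σ = c := by
  obtain ⟨c, rfl⟩ := Cell.exists_of c hs ht
  exact ⟨⟨c, (comm_iff F.cell G.cell c).2 h⟩, rfl⟩

theorem algHom_comm {F G : (iota D).obj Y ⟶ S} (σ : F ⟶ G) :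
    Cell.comp (Cell.wr (homCell σ) S.endo) (act G) (by simp) =
      Cell.comp (act F) (homCell σ) (by simp) :=
  (comm_iff F.cell G.cell σ.hom).1 σ.comm

end

section

variable {E : Type u'} [Bicategory.{w', v'} E] [Strict E] (G : StrictPseudofunctor D E)

theorem carrier_mapArrow {Y : D} {S : Mnd D} (F : (iota D).obj Y ⟶ S) :
    carrier (mapArrow G F) = G.map (carrier F) := by
  refine (congrArg (· ≫ G.map (carrier F)) (iotaComm_hom G Y)).trans ?_
  exact Strict.id_comp _

theorem act_mapArrow {Y : D} {S : Mnd D} (F : (iota D).obj Y ⟶ S) :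
    act (mapArrow G F) = Cell.map G (act F) := by
  refine (of_cell_comp _ _).trans ?_
  simp only [of_cell_iotaComm, iotaComm_hom, of_cell_map_map]
  have e (h) : Cell.comp (Cell.wl (𝟙 (G.obj Y)) (Cell.map G (act F)))
      (Cell.wr (Cell.id (𝟙 (G.obj Y))) (G.map (carrier F))) h = Cell.map G (act F) := by
    simp
  exact e _

end

/-! ### The universal algebra -/

section EM

variable {X Y : D} {S : Mnd D} {κ : (iota D).obj X ⟶ S}

/-- Algebras lift along the universal algebra. -/
theorem exists_lift (H : IsUniversal (iota D) κ) (f : Y ⟶ S.obj) (a : Cell Y S.obj)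
    (hs : a.src = f ≫ S.endo) (ht : a.tgt = f)
    (hu : Cell.comp (Cell.wl f (Cell.of S.unit)) a (by simp [hs]) = Cell.id f)
    (hm : Cell.comp (Cell.wl f (Cell.of S.mul)) a (by simp [hs]) =
      Cell.comp (Cell.wr a S.endo) a (by simp [hs, ht])) :
    ∃ h : Y ⟶ X, h ≫ carrier κ = f ∧ Cell.wl h (act κ) = a := by
  obtain ⟨F, rfl, rfl⟩ := exists_act f a hs ht hu hm
  have e := H.liftHom_spec F
  exact ⟨H.liftHom F, by rw [← carrier_comp, e], by rw [← act_comp, e]⟩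

/-- The forgetful 1-cell of the universal algebra is faithful. -/
theorem cell_ext_of_wr (H : IsUniversal (iota D) κ) {c d : Cell Y X} (hs : c.src = d.src)
    (ht : c.tgt = d.tgt) (h : Cell.wr c (carrier κ) = Cell.wr d (carrier κ)) : c = d := by
  refine H.cell_ext (cell_ext ?_ ?_ h)
  · simp only [Cell.wr_src, Cell.map_src, hs]
  · simp only [Cell.wr_tgt, Cell.map_tgt, ht]

/-- Morphisms of algebras lift along the universal algebra. -/
theorem exists_lift₂ (H : IsUniversal (iota D) κ) (f g : Y ⟶ X) (c : Cell Y S.obj)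
    (hs : c.src = f ≫ carrier κ) (ht : c.tgt = g ≫ carrier κ)
    (h : Cell.comp (Cell.wr c S.endo) (Cell.wl g (act κ)) (by simp [ht]) =
      Cell.comp (Cell.wl f (act κ)) c (by simp [hs])) :
    ∃ τ : f ⟶ g, Cell.wr (Cell.of τ) (carrier κ) = c := by
  obtain ⟨σ, rfl⟩ := exists_algHom (F := (iota D).map f ≫ κ) (G := (iota D).map g ≫ κ) c
    (by rw [hs, carrier_comp]) (by rw [ht, carrier_comp]) (by simpa only [act_comp] using h)
  have e := H.lift_spec (Cell.of σ)
  have h₁ : (H.lift (Cell.of σ)).src = f := H.hom_ext (congrArg Cell.src e)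
  have h₂ : (H.lift (Cell.of σ)).tgt = g := H.hom_ext (congrArg Cell.tgt e)
  obtain ⟨τ, hτ⟩ := Cell.exists_of _ h₁ h₂
  exact ⟨τ, by rw [hτ]; exact congrArg cell e⟩

/-- Isomorphisms of algebras lift along the universal algebra. -/
theorem exists_liftIso (H : IsUniversal (iota D) κ) (f g : Y ⟶ X)
    (i : f ≫ carrier κ ≅ g ≫ carrier κ)
    (h : Cell.comp (Cell.wr (Cell.of i.hom) S.endo) (Cell.wl g (act κ)) (by simp) =
      Cell.comp (Cell.wl f (act κ)) (Cell.of i.hom) (by simp)) :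
    ∃ τ : f ≅ g, Cell.wr (Cell.of τ.hom) (carrier κ) = Cell.of i.hom := by
  -- The inverse of an isomorphism of algebras is a morphism of algebras.
  have h' : Cell.comp (Cell.wr (Cell.of i.inv) S.endo) (Cell.wl f (act κ))
      (by simp) = Cell.comp (Cell.wl g (act κ)) (Cell.of i.inv) (by simp) := by
    have k : Cell.comp (Cell.comp (Cell.wr (Cell.of i.inv) S.endo)
        (Cell.comp (Cell.wr (Cell.of i.hom) S.endo) (Cell.wl g (act κ)) (by simp))
          (by simp)) (Cell.of i.inv) (by simp) =
        Cell.comp (Cell.comp (Cell.wr (Cell.of i.inv) S.endo)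
          (Cell.comp (Cell.wl f (act κ)) (Cell.of i.hom) (by simp)) (by simp))
            (Cell.of i.inv) (by simp) := by
      simp only [h]
    have e₁ : Cell.comp (Cell.wr (Cell.of i.inv) S.endo) (Cell.wr (Cell.of i.hom) S.endo)
        (by simp) = Cell.id ((g ≫ carrier κ) ≫ S.endo) := by
      rw [← Cell.wr_id, ← Cell.comp_eq_id_of_iso' i, Cell.wr_comp]
    simp only [Cell.comp_assoc, Cell.reassoc e₁, Cell.comp_eq_id_of_iso, Cell.id_comp] at k
    rw [k]
    simp
  obtain ⟨τ, hτ⟩ := exists_lift₂ H f g (Cell.of i.hom) rfl rfl h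
  obtain ⟨τ', hτ'⟩ := exists_lift₂ H g f (Cell.of i.inv) rfl rfl h'
  refine ⟨⟨τ, τ', Cell.of_injective (cell_ext_of_wr H rfl rfl ?_),
    Cell.of_injective (cell_ext_of_wr H rfl rfl ?_)⟩, hτ⟩
  · simp [hτ, hτ', Cell.comp_eq_id_of_iso]
  · simp [hτ, hτ', Cell.comp_eq_id_of_iso']

end EM

end Mnd

/-! ### Coherence cells of monoidal objects as total 2-cells -/

namespace MonOp

open FiniteProducts₂ Cell

variable {D : Type u} [Bicategory.{w, v} D] [FiniteProducts₂ D] [Strict D]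

section Data

variable (M : MonoidalData D) {X Y : D}

/-- The total 2-cell `α_{a,b,c}`. -/
def assocCell (a b c : X ⟶ M.obj) : Cell X M.obj := of (M.assocAt a b c)

/-- The total 2-cell `λ_a`. -/
def lamCell (a : X ⟶ M.obj) : Cell X M.obj := of (M.lamAt a)

/-- The total 2-cell `ρ_a`. -/
def rhoCell (a : X ⟶ M.obj) : Cell X M.obj := of (M.rhoAt a)

@[simp] theorem of_assocAt (a b c : X ⟶ M.obj) : of (M.assocAt a b c) = assocCell M a b c := (rfl)
@[simp] theorem of_lamAt (a : X ⟶ M.obj) : of (M.lamAt a) = lamCell M a := (rfl)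
@[simp] theorem of_rhoAt (a : X ⟶ M.obj) : of (M.rhoAt a) = rhoCell M a := (rfl)

@[simp] theorem assocCell_src (a b c : X ⟶ M.obj) :
    (assocCell M a b c).src = tens M.tensor a (tens M.tensor b c) := (rfl)
@[simp] theorem assocCell_tgt (a b c : X ⟶ M.obj) :
    (assocCell M a b c).tgt = tens M.tensor (tens M.tensor a b) c := (rfl)
@[simp] theorem lamCell_src (a : X ⟶ M.obj) :
    (lamCell M a).src = tens M.tensor (const M.unit X) a := (rfl)
@[simp] theorem lamCell_tgt (a : X ⟶ M.obj) : (lamCell M a).tgt = a := (rfl)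
@[simp] theorem rhoCell_src (a : X ⟶ M.obj) :
    (rhoCell M a).src = tens M.tensor a (const M.unit X) := (rfl)
@[simp] theorem rhoCell_tgt (a : X ⟶ M.obj) : (rhoCell M a).tgt = a := (rfl)

theorem assocCell_eq (a b c : X ⟶ M.obj) :
    assocCell M a b c = wl (lift a (lift b c)) (of M.assoc.hom) := by
  simp [assocCell, MonoidalData.assocAt, -of_assocAt]

theorem lamCell_eq (a : X ⟶ M.obj) : lamCell M a = wl a (of M.lam.hom) := by
  simp [lamCell, MonoidalData.lamAt, -of_lamAt]

theorem rhoCell_eq (a : X ⟶ M.obj) : rhoCell M a = wl a (of M.rho.hom) := by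
  simp [rhoCell, MonoidalData.rhoAt, -of_rhoAt]

@[simp] theorem wl_assocCell (x : Y ⟶ X) (a b c : X ⟶ M.obj) :
    wl x (assocCell M a b c) = assocCell M (x ≫ a) (x ≫ b) (x ≫ c) := by
  rw [assocCell_eq, assocCell_eq, ← wl_comp₁, comp_lift, comp_lift]

@[simp] theorem wl_lamCell (x : Y ⟶ X) (a : X ⟶ M.obj) :
    wl x (lamCell M a) = lamCell M (x ≫ a) := by
  rw [lamCell_eq, lamCell_eq, ← wl_comp₁]

@[simp] theorem wl_rhoCell (x : Y ⟶ X) (a : X ⟶ M.obj) :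
    wl x (rhoCell M a) = rhoCell M (x ≫ a) := by
  rw [rhoCell_eq, rhoCell_eq, ← wl_comp₁]

/-- Naturality of the associativity cell in the generalized elements. -/
theorem assocCell_naturality (c d e : Cell X M.obj) :
    comp (tensor M.tensor c (tensor M.tensor d e)) (assocCell M c.tgt d.tgt e.tgt) (by simp) =
      comp (assocCell M c.src d.src e.src) (tensor M.tensor (tensor M.tensor c d) e)
        (by simp) := by
  have h := exchange (pair c (pair d e)) (of M.assoc.hom)
  simpa [assocCell_eq] using h.symm

theorem lamCell_naturality (c : Cell X M.obj) :
    comp (tensor M.tensor (id (const M.unit X)) c) (lamCell M c.tgt) (by simp) =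
      comp (lamCell M c.src) c (by simp) := by
  have h := exchange c (of M.lam.hom)
  simpa [lamCell_eq] using h.symm

theorem rhoCell_naturality (c : Cell X M.obj) :
    comp (tensor M.tensor c (id (const M.unit X))) (rhoCell M c.tgt) (by simp) =
      comp (rhoCell M c.src) c (by simp) := by
  have h := exchange c (of M.rho.hom)
  simpa [rhoCell_eq] using h.symm

instance isIso_assocCell (a b c : X ⟶ M.obj) : IsIso (assocCell M a b c).hom := by
  change IsIso (M.assocAt a b c)
  unfold MonoidalData.assocAt
  infer_instance

instance isIso_lamCell (a : X ⟶ M.obj) : IsIso (lamCell M a).hom := by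
  change IsIso (M.lamAt a)
  unfold MonoidalData.lamAt
  infer_instance

instance isIso_rhoCell (a : X ⟶ M.obj) : IsIso (rhoCell M a).hom := by
  change IsIso (M.rhoAt a)
  unfold MonoidalData.rhoAt
  infer_instance

theorem pentagonAt_iff (a b c d : X ⟶ M.obj) : M.PentagonAt a b c d ↔
    comp (tensor M.tensor (id a) (assocCell M b c d))
      (comp (assocCell M a (tens M.tensor b c) d) (tensor M.tensor (assocCell M a b c) (id d))
        (by simp)) (by simp) =
    comp (assocCell M a b (tens M.tensor c d)) (assocCell M (tens M.tensor a b) c d)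
      (by simp) := by
  rw [MonoidalData.PentagonAt, ← of_inj]
  simp

theorem triangleAt_iff (a b : X ⟶ M.obj) : M.TriangleAt a b ↔
    comp (assocCell M a (const M.unit X) b) (tensor M.tensor (rhoCell M a) (id b)) (by simp) =
      tensor M.tensor (id a) (lamCell M b) := by
  rw [MonoidalData.TriangleAt, ← of_inj]
  simp

end Data

/-- The pentagon holds at arbitrary generalized elements. -/
theorem pentagonAt (M : MonOp D) {X : D} (a b c d : X ⟶ M.obj) : M.PentagonAt a b c d := by
  have h := congrArg (wl (lift a (lift b (lift c d)))) ((pentagonAt_iff _ _ _ _ _).1 M.pentagon)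
  rw [pentagonAt_iff]
  simpa [comp_tens, lift_fst, lift_snd, lift_comp_fst, lift_comp_snd] using h

/-- The triangle holds at arbitrary generalized elements. -/
theorem triangleAt (M : MonOp D) {X : D} (a b : X ⟶ M.obj) : M.TriangleAt a b := by
  have h := congrArg (wl (lift a b)) ((triangleAt_iff _ _ _).1 M.triangle)
  rw [triangleAt_iff]
  simpa [comp_const, lift_fst, lift_snd] using h

section Hom

variable {M N P : MonOp D} {X Y : D}

/-- The total 2-cell `φ_{a,b}`. -/
def tensorCell (F : HomData M N) (a b : X ⟶ M.obj) : Cell X N.obj := of (F.cellAt a b)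

/-- The total 2-cell `φ₀` at the stage `X`. -/
def unitCell (F : HomData M N) (X : D) : Cell X N.obj := of (F.cell₀At X)

@[simp] theorem of_cellAt (F : HomData M N) (a b : X ⟶ M.obj) :
    of (F.cellAt a b) = tensorCell F a b := (rfl)
@[simp] theorem of_cell₀At (F : HomData M N) : of (F.cell₀At X) = unitCell F X := (rfl)

@[simp] theorem tensorCell_src (F : HomData M N) (a b : X ⟶ M.obj) :
    (tensorCell F a b).src = tens M.tensor a b ≫ F.hom := (rfl)
@[simp] theorem tensorCell_tgt (F : HomData M N) (a b : X ⟶ M.obj) :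
    (tensorCell F a b).tgt = tens N.tensor (a ≫ F.hom) (b ≫ F.hom) := (rfl)
@[simp] theorem unitCell_src (F : HomData M N) :
    (unitCell F X).src = const M.unit X ≫ F.hom := (rfl)
@[simp] theorem unitCell_tgt (F : HomData M N) : (unitCell F X).tgt = const N.unit X := (rfl)

theorem tensorCell_eq (F : HomData M N) (a b : X ⟶ M.obj) :
    tensorCell F a b = wl (lift a b) (of F.cell) := by
  simp [tensorCell, HomData.cellAt, -of_cellAt]

theorem unitCell_eq (F : HomData M N) : unitCell F X = wl (toOne X) (of F.cell₀) := by
  simp [unitCell, HomData.cell₀At, -of_cell₀At]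

theorem of_cell (F : HomData M N) :
    of F.cell = tensorCell F (fst M.obj M.obj) (snd M.obj M.obj) := by
  rw [tensorCell_eq, lift_fst_snd, wl_id₁]

theorem of_cell₀ (F : HomData M N) : of F.cell₀ = unitCell F one := by
  rw [unitCell_eq, ← toOne_unique (𝟙 one), wl_id₁]

@[simp] theorem wl_tensorCell (F : HomData M N) (x : Y ⟶ X) (a b : X ⟶ M.obj) :
    wl x (tensorCell F a b) = tensorCell F (x ≫ a) (x ≫ b) := by
  rw [tensorCell_eq, tensorCell_eq, ← wl_comp₁, comp_lift]

@[simp] theorem wl_unitCell (F : HomData M N) (x : Y ⟶ X) :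
    wl x (unitCell F X) = unitCell F Y := by
  rw [unitCell_eq, unitCell_eq, ← wl_comp₁, toOne_unique (x ≫ toOne X)]

theorem tensorCell_naturality (F : HomData M N) (c d : Cell X M.obj) :
    comp (wr (tensor M.tensor c d) F.hom) (tensorCell F c.tgt d.tgt) (by simp) =
      comp (tensorCell F c.src d.src) (tensor N.tensor (wr c F.hom) (wr d F.hom)) (by simp) := by
  have h := congrArg of (F.cellAt_naturality c.hom d.hom)
  simpa using h

theorem assocAt_iff (F : HomData M N) (a b c : X ⟶ M.obj) : F.AssocAt a b c ↔
    comp (tensorCell F a (tens M.tensor b c))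
      (comp (tensor N.tensor (id (a ≫ F.hom)) (tensorCell F b c))
        (assocCell N.toMonoidalData (a ≫ F.hom) (b ≫ F.hom) (c ≫ F.hom)) (by simp)) (by simp) =
    comp (wr (assocCell M.toMonoidalData a b c) F.hom)
      (comp (tensorCell F (tens M.tensor a b) c)
        (tensor N.tensor (tensorCell F a b) (id (c ≫ F.hom))) (by simp)) (by simp) := by
  rw [HomData.AssocAt, ← of_inj]
  simp

theorem lamAt_iff (F : HomData M N) (a : X ⟶ M.obj) : F.LamAt a ↔
    comp (tensorCell F (const M.unit X) a)
      (comp (tensor N.tensor (unitCell F X) (id (a ≫ F.hom)))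
        (lamCell N.toMonoidalData (a ≫ F.hom)) (by simp)) (by simp) =
      wr (lamCell M.toMonoidalData a) F.hom := by
  rw [HomData.LamAt, ← of_inj]
  simp

theorem rhoAt_iff (F : HomData M N) (a : X ⟶ M.obj) : F.RhoAt a ↔
    comp (tensorCell F a (const M.unit X))
      (comp (tensor N.tensor (id (a ≫ F.hom)) (unitCell F X))
        (rhoCell N.toMonoidalData (a ≫ F.hom)) (by simp)) (by simp) =
      wr (rhoCell M.toMonoidalData a) F.hom := by
  rw [HomData.RhoAt, ← of_inj]
  simp

@[simp] theorem tensorCell_id (a b : X ⟶ M.obj) :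
    tensorCell (Hom.toHomData (𝟙 M)) a b = Cell.id (tens M.tensor a b) := by
  refine (congrArg of ((HomData.isId_id M).cellAt a b)).trans ?_
  exact (of_eqToHom _).trans (congrArg Cell.id (Strict.comp_id _))

@[simp] theorem unitCell_id :
    unitCell (Hom.toHomData (𝟙 M)) X = Cell.id (const M.unit X) := by
  refine (congrArg of ((HomData.isId_id M).cell₀At X)).trans ?_
  exact (of_eqToHom _).trans (congrArg Cell.id (Strict.comp_id _))

@[simp] theorem tensorCell_comp (F : M ⟶ N) (G : N ⟶ P) (a b : X ⟶ M.obj) :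
    tensorCell (Hom.toHomData (F ≫ G)) a b =
      comp (wr (tensorCell F.toHomData a b) G.hom)
        (tensorCell G.toHomData (a ≫ F.hom) (b ≫ F.hom)) (by simp) := by
  have h := congrArg of ((HomData.isComp_comp F.toHomData G.toHomData).cellAt a b)
  refine h.trans ?_
  simp

@[simp] theorem unitCell_comp (F : M ⟶ N) (G : N ⟶ P) :
    unitCell (Hom.toHomData (F ≫ G)) X =
      comp (wr (unitCell F.toHomData X) G.hom) (unitCell G.toHomData X) (by simp) := by
  refine (congrArg of ((HomData.isComp_comp F.toHomData G.toHomData).cell₀At X)).trans ?_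
  simp

/-- The total 2-cell of `D` underlying a transformation of oplax monoidal morphisms. -/
def cell₂ {F G : M ⟶ N} (σ : F ⟶ G) : Cell M.obj N.obj := of (Hom₂.hom σ)

@[simp] theorem cell₂_src {F G : M ⟶ N} (σ : F ⟶ G) : (cell₂ σ).src = F.hom := (rfl)

@[simp] theorem cell₂_tgt {F G : M ⟶ N} (σ : F ⟶ G) : (cell₂ σ).tgt = G.hom := (rfl)

theorem cell₂_comm {F G : M ⟶ N} (σ : F ⟶ G) (a b : X ⟶ M.obj) :
    comp (tensorCell F.toHomData a b) (tensor N.tensor (wl a (cell₂ σ)) (wl b (cell₂ σ)))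
        (by simp) =
      comp (wl (tens M.tensor a b) (cell₂ σ)) (tensorCell G.toHomData a b) (by simp) := by
  have h := congrArg of (Hom₂.commAt σ a b)
  simp at h
  exact h

theorem cell₂_comm₀ {F G : M ⟶ N} (σ : F ⟶ G) :
    comp (wl (const M.unit X) (cell₂ σ)) (unitCell G.toHomData X) (by simp) =
      unitCell F.toHomData X := by
  have h := congrArg (fun c => wl (toOne X) (of c)) σ.comm₀
  simp [← unitCell_eq] at h
  simp only [wl_const]
  exact h

theorem hom_ext_of {F G : M ⟶ N} (h : F.hom = G.hom) (hc : of F.cell = of G.cell)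
    (hc₀ : of F.cell₀ = of G.cell₀) : F = G :=
  hom_ext h (of_injective (by simpa using hc)) (of_injective (by simpa using hc₀))

end Hom

end MonOp

/-! ### Algebras of an oplax monoidal monad -/

namespace MonOp

open FiniteProducts₂ Cell

variable {D : Type u} [Bicategory.{w, v} D] [FiniteProducts₂ D] [Strict D]

/-- The total 2-cell `a : T f ⟶ f` is an algebra structure on the generalized element `f`, for the
monad on a 0-cell of `D` underlying a monad `T` in `Mon_op(D)`. -/
structure IsAlg (A : Mnd (MonOp D)) {Y : D} (f : Y ⟶ A.obj.obj) (a : Cell Y A.obj.obj) :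
    Prop where
  src : a.src = f ≫ A.endo.hom
  tgt : a.tgt = f
  unit : comp (wl f (cell₂ A.unit)) a (by simp [src]) = Cell.id f
  mul : comp (wl f (cell₂ A.mul)) a (by simp [src]) =
    comp (wr a A.endo.hom) a (by simp [src, tgt])

namespace IsAlg

variable {A : Mnd (MonOp D)} {X Y : D}

/-- The tensor product of two algebras of an oplax monoidal monad. The unit and associativity laws
hold because the unit and the multiplication of the monad are transformations of oplax monoidal
morphisms. -/
theorem tensor {f g : Y ⟶ A.obj.obj} {a b : Cell Y A.obj.obj} (ha : IsAlg A f a)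
    (hb : IsAlg A g b) : IsAlg A (tens A.obj.tensor f g)
      (comp (tensorCell A.endo.toHomData f g) (Cell.tensor A.obj.tensor a b)
        (by simp [ha.src, hb.src])) where
  src := by simp
  tgt := by simp [ha.tgt, hb.tgt]
  unit := by
    have h := cell₂_comm A.unit f g
    have e := tensor_comp A.obj.tensor (wl f (cell₂ A.unit)) a (wl g (cell₂ A.unit)) b
      (by simp [ha.src]) (by simp [hb.src])
    simp only [tensorCell_id, id_comp] at h
    simp only [ha.unit, hb.unit, tensor_id] at e
    simp only [reassoc h.symm, ← e]
  mul := by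
    have h := cell₂_comm A.mul f g
    have e := tensor_comp A.obj.tensor (wl f (cell₂ A.mul)) a (wl g (cell₂ A.mul)) b
      (by simp [ha.src]) (by simp [hb.src])
    have e' := tensor_comp A.obj.tensor (wr a A.endo.hom) a (wr b A.endo.hom) b
      (by simp [ha.src, ha.tgt]) (by simp [hb.src, hb.tgt])
    have n := tensorCell_naturality A.endo.toHomData a b
    simp only [tensorCell_comp, comp_assoc] at h
    simp only [ha.mul, hb.mul, e'] at e
    simp only [ha.src, hb.src, ha.tgt, hb.tgt] at n
    simp only [reassoc h.symm, wr_comp, comp_assoc, ← e, reassoc n]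

/-- The monoidal unit is an algebra of an oplax monoidal monad. -/
theorem unitAlg (A : Mnd (MonOp D)) (X : D) :
    IsAlg A (const A.obj.unit X) (unitCell A.endo.toHomData X) where
  src := by simp
  tgt := by simp
  unit := by
    have h := cell₂_comm₀ (X := X) A.unit
    simpa using h
  mul := by
    have h := cell₂_comm₀ (X := X) A.mul
    simpa using h

/-- Algebras are stable under substitution of generalized elements. -/
theorem wl {f : Y ⟶ A.obj.obj} {a : Cell Y A.obj.obj} (ha : IsAlg A f a) (x : X ⟶ Y) :
    IsAlg A (x ≫ f) (Cell.wl x a) where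
  src := by simp [ha.src]
  tgt := by simp [ha.tgt]
  unit := by
    have h := congrArg (Cell.wl x) ha.unit
    simpa using h
  mul := by
    have h := congrArg (Cell.wl x) ha.mul
    simpa using h

variable {f g k : Y ⟶ A.obj.obj} {a b c : Cell Y A.obj.obj}

/-- The associativity cell is a morphism of algebras: this is the compatibility of the oplax
structure of the monad with `α`. -/
theorem assocCell_comm (ha : IsAlg A f a) (hb : IsAlg A g b) (hc : IsAlg A k c) :
    comp (wr (assocCell A.obj.toMonoidalData f g k) A.endo.hom)
      (comp (tensorCell A.endo.toHomData (tens A.obj.tensor f g) k) (Cell.tensor A.obj.tensor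
        (comp (tensorCell A.endo.toHomData f g) (Cell.tensor A.obj.tensor a b)
          (by simp [ha.src, hb.src])) c) (by simp [hc.src])) (by simp) =
    comp (comp (tensorCell A.endo.toHomData f (tens A.obj.tensor g k))
      (Cell.tensor A.obj.tensor a (comp (tensorCell A.endo.toHomData g k)
        (Cell.tensor A.obj.tensor b c) (by simp [hb.src, hc.src]))) (by simp [ha.src]))
      (assocCell A.obj.toMonoidalData f g k) (by simp [ha.tgt, hb.tgt, hc.tgt]) := by
  have h := (assocAt_iff _ f g k).1 (Hom.assocAt A.endo f g k)
  have n := assocCell_naturality A.obj.toMonoidalData a b c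
  have h' := reassoc h.symm (Cell.tensor A.obj.tensor (Cell.tensor A.obj.tensor a b) c)
    (by simp [ha.src, hb.src, hc.src])
  simp only [ha.src, hb.src, hc.src, ha.tgt, hb.tgt, hc.tgt, comp_assoc] at n h'
  simp only [tensor_comp_left, tensor_comp_right, comp_assoc, ha.src, hc.src, h', n]

/-- The left unit cell is a morphism of algebras. -/
theorem lamCell_comm (ha : IsAlg A f a) :
    comp (wr (lamCell A.obj.toMonoidalData f) A.endo.hom) a (by simp [ha.src]) =
      comp (comp (tensorCell A.endo.toHomData (const A.obj.unit Y) f)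
        (Cell.tensor A.obj.tensor (unitCell A.endo.toHomData Y) a) (by simp [ha.src]))
        (lamCell A.obj.toMonoidalData f) (by simp [ha.tgt]) := by
  have h := (lamAt_iff _ f).1 (Hom.lamAt A.endo f)
  have n := lamCell_naturality A.obj.toMonoidalData a
  simp only [ha.src, ha.tgt] at n
  have k := tensor_comp A.obj.tensor (unitCell A.endo.toHomData Y) (Cell.id (const A.obj.unit Y))
    (Cell.id (f ≫ A.endo.hom)) a (by simp) (by simp [ha.src])
  simp only [comp_id, id_comp] at k
  simp only [← h, k, comp_assoc, n]

/-- The right unit cell is a morphism of algebras. -/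
theorem rhoCell_comm (ha : IsAlg A f a) :
    comp (wr (rhoCell A.obj.toMonoidalData f) A.endo.hom) a (by simp [ha.src]) =
      comp (comp (tensorCell A.endo.toHomData f (const A.obj.unit Y))
        (Cell.tensor A.obj.tensor a (unitCell A.endo.toHomData Y)) (by simp [ha.src]))
        (rhoCell A.obj.toMonoidalData f) (by simp [ha.tgt]) := by
  have h := (rhoAt_iff _ f).1 (Hom.rhoAt A.endo f)
  have n := rhoCell_naturality A.obj.toMonoidalData a
  simp only [ha.src, ha.tgt] at n
  have k := tensor_comp A.obj.tensor (Cell.id (f ≫ A.endo.hom)) a (unitCell A.endo.toHomData Y)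
    (Cell.id (const A.obj.unit Y)) (by simp [ha.src]) (by simp)
  simp only [comp_id, id_comp] at k
  simp only [← h, k, comp_assoc, n]

end IsAlg

end MonOp

/-! ### Lifting the monoidal structure to the universal algebra -/

namespace MonOp

open FiniteProducts₂ Cell

variable {D : Type u} [Bicategory.{w, v} D] [FiniteProducts₂ D] [Strict D]

/-- `(U, ξ)` is a universal algebra of the monad on `A.obj.obj` underlying a monad `A` in
`Mon_op(D)`: algebras, their morphisms and their isomorphisms lift along it, and `U` is faithful on
2-cells. The proofs of composability in the compatibility with the actions are quantified over. -/
structure IsEM (A : Mnd (MonOp D)) {X : D} (U : X ⟶ A.obj.obj) (ξ : Cell X A.obj.obj) :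
    Prop where
  alg : IsAlg A U ξ
  exists_lift : ∀ {Y : D} {f : Y ⟶ A.obj.obj} {a : Cell Y A.obj.obj}, IsAlg A f a →
    ∃ h : Y ⟶ X, h ≫ U = f ∧ wl h ξ = a
  cell_ext : ∀ {Y : D} {c d : Cell Y X}, c.src = d.src → c.tgt = d.tgt →
    wr c U = wr d U → c = d
  exists_lift₂ : ∀ {Y : D} (f g : Y ⟶ X) (c : Cell Y A.obj.obj), c.src = f ≫ U →
    c.tgt = g ≫ U → (∀ k₁ k₂, comp (wr c A.endo.hom) (wl g ξ) k₁ = comp (wl f ξ) c k₂) →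
    ∃ τ : f ⟶ g, wr (of τ) U = c
  exists_liftIso : ∀ {Y : D} (f g : Y ⟶ X) (c : Cell Y A.obj.obj), c.src = f ≫ U →
    c.tgt = g ≫ U → (∀ k₁ k₂, comp (wr c A.endo.hom) (wl g ξ) k₁ = comp (wl f ξ) c k₂) →
    IsIso c.hom → ∃ τ : f ≅ g, wr (of τ.hom) U = c

/-- The unit of the monad of `D` underlying `A`, free of the unit comparison of the 2-functor. -/
theorem of_map_forget_unit (A : Mnd (MonOp D)) :
    of (X := A.obj.obj) (Y := A.obj.obj) ((Mnd.map (forget D)).obj A).unit = cell₂ A.unit := by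
  have e : of (((forget D).mapId A.obj).inv ≫ (forget D).map₂ A.unit) =
      comp (of ((forget D).mapId A.obj).inv) (of ((forget D).map₂ A.unit))
        ((forget D).map_id A.obj).symm :=
    of_comp _ _
  refine e.trans ?_
  simp only [of_mapId_inv]
  exact id_comp _ _ _

theorem of_map_forget_mul (A : Mnd (MonOp D)) :
    of (X := A.obj.obj) (Y := A.obj.obj) ((Mnd.map (forget D)).obj A).mul = cell₂ A.mul := by
  have e : of (((forget D).mapComp A.endo A.endo).inv ≫ (forget D).map₂ A.mul) =
      comp (of ((forget D).mapComp A.endo A.endo).inv) (of ((forget D).map₂ A.mul)) (by simp) :=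
    of_comp _ _
  refine e.trans ?_
  simp only [of_mapComp_inv]
  exact id_comp _ _ _

/-- A universal arrow from `ι` to the monad underlying `A` is a universal algebra. -/
theorem isEM_of_isUniversal (A : Mnd (MonOp D)) {X : D}
    {κ : (Mnd.iota D).obj X ⟶ (Mnd.map (forget D)).obj A} (H : IsUniversal (Mnd.iota D) κ) :
    IsEM A (X := X) (Mnd.carrier κ) (Mnd.act κ) where
  alg :=
    { src := Mnd.act_src κ
      tgt := Mnd.act_tgt κ
      unit := by
        exact (comp_wl_congr (of_map_forget_unit A).symm _ _).trans (Mnd.unit_act κ)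
      mul := by
        exact (comp_wl_congr (of_map_forget_mul A).symm _ _).trans (Mnd.mul_act κ) }
  exists_lift {Y f a} ha := by
    refine Mnd.exists_lift H f a ha.src ha.tgt ?_ ?_
    · exact (comp_wl_congr (of_map_forget_unit A) _ _).trans ha.unit
    · exact (comp_wl_congr (of_map_forget_mul A) _ _).trans ha.mul
  cell_ext hs ht h := Mnd.cell_ext_of_wr H hs ht h
  exists_lift₂ f g c hs ht h := Mnd.exists_lift₂ H f g c hs ht (h _ _)
  exists_liftIso f g c hs ht h hc := by
    obtain ⟨c, rfl⟩ := Cell.exists_of c hs ht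
    exact Mnd.exists_liftIso H f g (@asIso _ _ _ _ c hc) (h _ _)

/-- The monoidal data `N` lift those of `A.obj` strictly along the universal algebra `(U, ξ)`, the
tensor product and the unit being equipped with the algebra structures `IsAlg.tensor` and
`IsAlg.unitAlg`. In `act_tensor` the proof that the two cells are composable is quantified over, as
it depends on the source of `ξ`. -/
structure IsStrictLift (A : Mnd (MonOp D)) (N : MonoidalData D) (U : N.obj ⟶ A.obj.obj)
    (ξ : Cell N.obj A.obj.obj) : Prop where
  em : IsEM A U ξ
  tensor_comp : N.tensor ≫ U =
    tens A.obj.tensor (fst N.obj N.obj ≫ U) (snd N.obj N.obj ≫ U)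
  unit_comp : N.unit ≫ U = A.obj.unit
  act_tensor : ∀ k, wl N.tensor ξ =
    comp (tensorCell A.endo.toHomData (fst N.obj N.obj ≫ U) (snd N.obj N.obj ≫ U))
      (tensor A.obj.tensor (wl (fst N.obj N.obj) ξ) (wl (snd N.obj N.obj) ξ)) k
  act_unit : wl N.unit ξ = unitCell A.endo.toHomData one
  assoc : wr (of N.assoc.hom) U = assocCell A.obj.toMonoidalData
    (fst N.obj (prod N.obj N.obj) ≫ U)
    ((snd N.obj (prod N.obj N.obj) ≫ fst N.obj N.obj) ≫ U)
    ((snd N.obj (prod N.obj N.obj) ≫ snd N.obj N.obj) ≫ U)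
  lam : wr (of N.lam.hom) U = lamCell A.obj.toMonoidalData U
  rho : wr (of N.rho.hom) U = rhoCell A.obj.toMonoidalData U

section Lift

variable {A : Mnd (MonOp D)} {X Y : D} {U : X ⟶ A.obj.obj} {ξ : Cell X A.obj.obj}

theorem tens_comp_of_lift {t : prod X X ⟶ X}
    (ht : t ≫ U = tens A.obj.tensor (fst X X ≫ U) (snd X X ≫ U)) (x y : Y ⟶ X) :
    tens t x y ≫ U = tens A.obj.tensor (x ≫ U) (y ≫ U) := by
  rw [TwoCat.tens_comp, ht, comp_tens, lift_comp_fst, lift_comp_snd]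

theorem const_comp_of_lift {i : one ⟶ X} (hi : i ≫ U = A.obj.unit) :
    const i Y ≫ U = const A.obj.unit Y := by
  rw [const_comp, hi]; rfl

theorem wr_tensor_of_lift {t : prod X X ⟶ X}
    (ht : t ≫ U = tens A.obj.tensor (fst X X ≫ U) (snd X X ≫ U)) (c d : Cell Y X) :
    wr (tensor t c d) U = tensor A.obj.tensor (wr c U) (wr d U) := by
  rw [← wr_pair, ← wr_comp₁, ht, wr_tens, wr_comp₁, wr_comp₁, wr_pair_fst, wr_pair_snd]

theorem wl_tens_of_lift (h : IsAlg A U ξ) {t : prod X X ⟶ X}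
    (ht : ∀ k, wl t ξ = comp (tensorCell A.endo.toHomData (fst X X ≫ U) (snd X X ≫ U))
      (tensor A.obj.tensor (wl (fst X X) ξ) (wl (snd X X) ξ)) k) (x y : Y ⟶ X) :
    wl (tens t x y) ξ = comp (tensorCell A.endo.toHomData (x ≫ U) (y ≫ U))
      (tensor A.obj.tensor (wl x ξ) (wl y ξ)) (by simp [h.src]) := by
  rw [wl_tens, ht (by simp [h.src])]
  simp [wl_lift_fst, wl_lift_snd, lift_comp_fst, lift_comp_snd]

theorem wl_const_of_lift {i : one ⟶ X} (hi : wl i ξ = unitCell A.endo.toHomData one) :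
    wl (const i Y) ξ = unitCell A.endo.toHomData Y := by
  rw [wl_const, hi, wl_unitCell]

/-- The monoidal data lift to a universal algebra `(U, ξ)`: the tensor product and the unit because
they are algebras, the coherence cells because they are isomorphisms of algebras. -/
theorem IsEM.exists_strictLift (H : IsEM A U ξ) :
    ∃ t i α l r, IsStrictLift A ⟨X, t, i, α, l, r⟩ U ξ := by
  obtain ⟨t, ht, ht'⟩ := H.exists_lift ((H.alg.wl (fst X X)).tensor (H.alg.wl (snd X X)))
  obtain ⟨i, hi, hi'⟩ := H.exists_lift (IsAlg.unitAlg A one)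
  have hi₀ : i ≫ U = A.obj.unit := by
    rw [hi, const, ← toOne_unique (𝟙 one), Strict.id_comp]
  have ht₁ := fun (Y : D) (x y : Y ⟶ X) => tens_comp_of_lift ht x y
  have ht₂ := fun (Y : D) (x y : Y ⟶ X) => wl_tens_of_lift H.alg (fun _ => ht') x y
  have hi₁ := fun (Y : D) => const_comp_of_lift (Y := Y) hi₀
  have hi₂ := fun (Y : D) => wl_const_of_lift (Y := Y) hi'
  have hα (Y : D) (x y z : Y ⟶ X) : ∃ τ : tens t x (tens t y z) ≅ tens t (tens t x y) z,
      wr (of τ.hom) U = assocCell A.obj.toMonoidalData (x ≫ U) (y ≫ U) (z ≫ U) := by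
    refine H.exists_liftIso _ _ _ (by simp [ht₁]) (by simp [ht₁]) ?_ (isIso_assocCell _ _ _ _)
    simp only [ht₂, ht₁]
    intro _ _
    exact (H.alg.wl x).assocCell_comm (H.alg.wl y) (H.alg.wl z)
  have hl (Y : D) (x : Y ⟶ X) : ∃ τ : tens t (const i Y) x ≅ x,
      wr (of τ.hom) U = lamCell A.obj.toMonoidalData (x ≫ U) := by
    refine H.exists_liftIso _ _ _ (by simp [ht₁, hi₁]) (by simp) ?_ (isIso_lamCell _ _)
    simp only [ht₂, hi₁, hi₂]
    intro _ _
    exact (H.alg.wl x).lamCell_comm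
  have hr (Y : D) (x : Y ⟶ X) : ∃ τ : tens t x (const i Y) ≅ x,
      wr (of τ.hom) U = rhoCell A.obj.toMonoidalData (x ≫ U) := by
    refine H.exists_liftIso _ _ _ (by simp [ht₁, hi₁]) (by simp) ?_ (isIso_rhoCell _ _)
    simp only [ht₂, hi₁, hi₂]
    intro _ _
    exact (H.alg.wl x).rhoCell_comm
  obtain ⟨α, hα⟩ := hα _ (fst X (prod X X)) (snd X (prod X X) ≫ fst X X)
    (snd X (prod X X) ≫ snd X X)
  obtain ⟨l, hl⟩ := hl _ (𝟙 X)
  obtain ⟨r, hr⟩ := hr _ (𝟙 X)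
  rw [Strict.id_comp] at hl hr
  exact ⟨t, i, α, l, r, ⟨H, ht, hi₀, fun _ => ht', hi', hα, hl, hr⟩⟩

end Lift

namespace IsStrictLift

variable {A : Mnd (MonOp D)} {N : MonoidalData D} {U : N.obj ⟶ A.obj.obj}
  {ξ : Cell N.obj A.obj.obj} {X : D}

theorem tens_comp (H : IsStrictLift A N U ξ) (x y : X ⟶ N.obj) :
    tens N.tensor x y ≫ U = tens A.obj.tensor (x ≫ U) (y ≫ U) :=
  tens_comp_of_lift H.tensor_comp x y

theorem const_comp (H : IsStrictLift A N U ξ) : const N.unit X ≫ U = const A.obj.unit X :=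
  const_comp_of_lift H.unit_comp

theorem wr_tensor (H : IsStrictLift A N U ξ) (c d : Cell X N.obj) :
    wr (tensor N.tensor c d) U = tensor A.obj.tensor (wr c U) (wr d U) :=
  wr_tensor_of_lift H.tensor_comp c d

theorem wl_tens (H : IsStrictLift A N U ξ) (x y : X ⟶ N.obj) :
    wl (tens N.tensor x y) ξ = comp (tensorCell A.endo.toHomData (x ≫ U) (y ≫ U))
      (tensor A.obj.tensor (wl x ξ) (wl y ξ)) (by simp [H.em.alg.src]) :=
  wl_tens_of_lift H.em.alg H.act_tensor x y

theorem wl_const (H : IsStrictLift A N U ξ) :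
    wl (const N.unit X) ξ = unitCell A.endo.toHomData X :=
  wl_const_of_lift H.act_unit

theorem wr_assocCell (H : IsStrictLift A N U ξ) (x y z : X ⟶ N.obj) :
    wr (assocCell N x y z) U = assocCell A.obj.toMonoidalData (x ≫ U) (y ≫ U) (z ≫ U) := by
  rw [assocCell_eq, ← wl_wr, H.assoc, wl_assocCell]
  simp only [← Strict.assoc, lift_fst, lift_snd]

theorem wr_lamCell (H : IsStrictLift A N U ξ) (x : X ⟶ N.obj) :
    wr (lamCell N x) U = lamCell A.obj.toMonoidalData (x ≫ U) := by
  rw [lamCell_eq, ← wl_wr, H.lam, wl_lamCell]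

theorem wr_rhoCell (H : IsStrictLift A N U ξ) (x : X ⟶ N.obj) :
    wr (rhoCell N x) U = rhoCell A.obj.toMonoidalData (x ≫ U) := by
  rw [rhoCell_eq, ← wl_wr, H.rho, wl_rhoCell]

theorem pentagonAt (H : IsStrictLift A N U ξ) (a b c d : X ⟶ N.obj) : N.PentagonAt a b c d := by
  rw [pentagonAt_iff]
  refine H.em.cell_ext (by simp) (by simp) ?_
  have h := (pentagonAt_iff _ _ _ _ _).1 (A.obj.pentagonAt (a ≫ U) (b ≫ U) (c ≫ U) (d ≫ U))
  simpa [H.wr_tensor, H.wr_assocCell, H.tens_comp] using h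

theorem triangleAt (H : IsStrictLift A N U ξ) (a b : X ⟶ N.obj) : N.TriangleAt a b := by
  rw [triangleAt_iff]
  refine H.em.cell_ext (by simp) (by simp) ?_
  have h := (triangleAt_iff _ _ _).1 (A.obj.triangleAt (a ≫ U) (b ≫ U))
  simpa [H.wr_tensor, H.wr_assocCell, H.wr_rhoCell, H.wr_lamCell, H.const_comp] using h

end IsStrictLift

/-- A universal algebra inherits the structure of a monoidal object. -/
theorem IsEM.exists_monOp {A : Mnd (MonOp D)} {X : D} {U : X ⟶ A.obj.obj} {ξ : Cell X A.obj.obj}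
    (H : IsEM A U ξ) : ∃ t i α l r p q,
      IsStrictLift A (⟨⟨X, t, i, α, l, r⟩, p, q⟩ : MonOp D).toMonoidalData U ξ := by
  obtain ⟨t, i, α, l, r, h⟩ := H.exists_strictLift
  exact ⟨t, i, α, l, r, h.pentagonAt _ _ _ _, h.triangleAt _ _, h⟩

end MonOp

/-! ### Universality of the lifted monoidal object -/

namespace MonOp

open FiniteProducts₂ Cell

variable {D : Type u} [Bicategory.{w, v} D] [FiniteProducts₂ D] [Strict D]

section Under

variable {L M N : MonOp D} {X : D}

/-- The total 2-cell of `D` underlying a total 2-cell of `Mon_op(D)`. -/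
def under (c : Cell M N) : Cell M.obj N.obj := cell₂ c.hom

@[simp] theorem under_src (c : Cell M N) : (under c).src = c.src.hom := (rfl)
@[simp] theorem under_tgt (c : Cell M N) : (under c).tgt = c.tgt.hom := (rfl)
@[simp] theorem under_of {F G : M ⟶ N} (σ : F ⟶ G) : under (of σ) = cell₂ σ := (rfl)
@[simp] theorem under_id (F : M ⟶ N) : under (Cell.id F) = Cell.id F.hom := (rfl)
@[simp] theorem under_wl (F : L ⟶ M) (c : Cell M N) : under (wl F c) = wl F.hom (under c) := (rfl)
@[simp] theorem under_wr (c : Cell L M) (F : M ⟶ N) : under (wr c F) = wr (under c) F.hom := (rfl)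

@[simp] theorem under_comp (c d : Cell M N) (h : c.tgt = d.src) :
    under (comp c d h) = comp (under c) (under d) (by simp [h]) := by
  obtain ⟨f, g, σ⟩ := c
  obtain ⟨g', k, τ⟩ := d
  obtain rfl : g = g' := h
  have e : comp (of σ) (of τ) rfl = of (σ ≫ τ) := (of_comp σ τ).symm
  exact (congrArg under e).trans (of_comp _ _)

theorem under_ext {c d : Cell M N} (h₁ : c.src = d.src) (h₂ : c.tgt = d.tgt)
    (h : under c = under d) : c = d := by
  obtain ⟨f, g, σ⟩ := c
  obtain ⟨f', g', τ⟩ := d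
  obtain rfl : f = f' := h₁
  obtain rfl : g = g' := h₂
  obtain rfl : σ = τ := hom₂_ext (of_injective h)
  rfl

/-- A total 2-cell of `Mon_op(D)` is compatible with the tensor products at generalized elements. -/
theorem under_comm (c : Cell M N) (a b : X ⟶ M.obj) :
    comp (tensorCell c.src.toHomData a b) (tensor N.tensor (wl a (under c)) (wl b (under c)))
        (by simp) =
      comp (wl (tens M.tensor a b) (under c)) (tensorCell c.tgt.toHomData a b) (by simp) :=
  cell₂_comm c.hom a b

theorem under_comm₀ (c : Cell M N) :
    comp (wl (const M.unit X) (under c)) (unitCell c.tgt.toHomData X) (by simp) =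
      unitCell c.src.toHomData X :=
  cell₂_comm₀ c.hom

/-- A total 2-cell of `D` compatible with the oplax structures, as a 2-cell of `Mon_op(D)`. -/
theorem exists_cell₂ {F G : M ⟶ N} (c : Cell M.obj N.obj) (hs : c.src = F.hom)
    (ht : c.tgt = G.hom)
    (h : ∀ k₁ k₂, comp (tensorCell F.toHomData (fst M.obj M.obj) (snd M.obj M.obj))
        (tensor N.tensor (wl (fst M.obj M.obj) c) (wl (snd M.obj M.obj) c)) k₁ =
      comp (wl (tens M.tensor (fst M.obj M.obj) (snd M.obj M.obj)) c)
        (tensorCell G.toHomData (fst M.obj M.obj) (snd M.obj M.obj)) k₂)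
    (h₀ : ∀ k, comp (wl (const M.unit one) c) (unitCell G.toHomData one) k =
      unitCell F.toHomData one) :
    ∃ σ : F ⟶ G, cell₂ σ = c := by
  obtain ⟨τ, rfl⟩ := exists_of c hs ht
  refine ⟨⟨τ, of_injective ?_, of_injective ?_⟩, rfl⟩
  · simpa [of_cell, tens_fst_snd] using h (by simp) (by simp)
  · have e : const M.unit one = M.unit := by rw [const, ← toOne_unique (𝟙 one), Strict.id_comp]
    simp only [e] at h₀
    simpa [of_cell₀] using h₀ (by simp [e])

theorem hom_ext_of_tensorCell {F G : M ⟶ N} (h : F.hom = G.hom)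
    (hc : tensorCell F.toHomData (fst M.obj M.obj) (snd M.obj M.obj) =
      tensorCell G.toHomData (fst M.obj M.obj) (snd M.obj M.obj))
    (hc₀ : unitCell F.toHomData one = unitCell G.toHomData one) : F = G :=
  hom_ext_of h (by rw [of_cell, of_cell, hc]) (by rw [of_cell₀, of_cell₀, hc₀])

end Under

/-- An algebra in `Mon_op(D)` has an underlying algebra in `D`. -/
theorem isAlg_under {A : Mnd (MonOp D)} {Z : MonOp D} (F : (Mnd.iota (MonOp D)).obj Z ⟶ A) :
    IsAlg A (HomData.hom (Hom.toHomData (Mnd.carrier F))) (under (Mnd.act F)) where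
  src := by simp
  tgt := by simp
  unit := by
    have h := congrArg under (Mnd.unit_act F)
    simpa using h
  mul := by
    have h := congrArg under (Mnd.mul_act F)
    simpa using h

namespace IsStrictLift

variable {A : Mnd (MonOp D)} {N : MonOp D} {U : N.obj ⟶ A.obj.obj}
  {ξ : Cell N.obj A.obj.obj}

/-- The strict oplax monoidal morphism underlying the lifted monoidal object. -/
def homData (H : IsStrictLift A N.toMonoidalData U ξ) : HomData N A.obj where
  hom := U
  cell := eqToHom H.tensor_comp
  cell₀ := eqToHom H.unit_comp

section

variable (H : IsStrictLift A N.toMonoidalData U ξ) {X : D}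

@[simp] theorem homData_hom : H.homData.hom = U := (rfl)

@[simp] theorem tensorCell_homData (a b : X ⟶ N.obj) :
    tensorCell H.homData a b = Cell.id (tens A.obj.tensor (a ≫ U) (b ≫ U)) := by
  have e : of H.homData.cell = Cell.id (N.tensor ≫ U) := of_eqToHom H.tensor_comp
  rw [tensorCell_eq, e, wl_id, ← TwoCat.tens_comp, H.tens_comp]

@[simp] theorem unitCell_homData :
    unitCell H.homData X = Cell.id (const A.obj.unit X) := by
  have e : of H.homData.cell₀ = Cell.id (N.unit ≫ U) := of_eqToHom H.unit_comp
  rw [unitCell_eq, e, wl_id, ← TwoCat.const_comp, H.const_comp]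

/-- The underlying 1-cell of the lifted monoidal object, as an oplax monoidal morphism. -/
def hom : N ⟶ A.obj := Hom.mk (M := N) (N := A.obj) H.homData
  (by rw [assocAt_iff]; simp [H.wr_assocCell, H.tens_comp])
  (by rw [lamAt_iff]; simp [H.wr_lamCell])
  (by rw [rhoAt_iff]; simp [H.wr_rhoCell])

@[simp] theorem hom_toHomData : Hom.toHomData H.hom = H.homData := (rfl)

/-- The universal algebra of `D`, as an algebra of `Mon_op(D)`. -/
theorem exists_alg : ∃ κ : (Mnd.iota (MonOp D)).obj N ⟶ A,
    Mnd.carrier κ = H.hom ∧ under (Mnd.act κ) = ξ := by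
  obtain ⟨σ, hσ⟩ := exists_cell₂ (F := H.hom ≫ A.endo) (G := H.hom) ξ
    (by simp [H.em.alg.src]) (by simp [H.em.alg.tgt])
    (by
      intro k₁ k₂
      simp [H.wl_tens])
    (by
      intro k
      simp [H.wl_const])
  obtain ⟨κ, h₁, h₂⟩ := Mnd.exists_act (S := A) H.hom (of σ) rfl rfl
    (under_ext (by simp) (by simp) (by simpa [hσ] using H.em.alg.unit))
    (under_ext (by simp) (by simp) (by simpa [hσ] using H.em.alg.mul))
  exact ⟨κ, h₁, by rw [h₂, under_of, hσ]⟩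

/-- Algebras in `Mon_op(D)` lift along the universal algebra as oplax monoidal morphisms: the
oplax structure of the lift exists because the action is a transformation of oplax monoidal
morphisms. -/
theorem exists_lift {Z : MonOp D} (F : (Mnd.iota (MonOp D)).obj Z ⟶ A) :
    ∃ h : Z ⟶ N, h ≫ H.hom = Mnd.carrier F ∧ wl h.hom ξ = under (Mnd.act F) := by
  have ha := isAlg_under F
  obtain ⟨f, hf⟩ : ∃ f : Z ⟶ A.obj, f = Mnd.carrier F := ⟨_, rfl⟩
  obtain ⟨a, ha'⟩ : ∃ a, a = under (Mnd.act F) := ⟨_, rfl⟩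
  have hc := fun x y => under_comm (X := prod Z.obj Z.obj) (Mnd.act F) x y
  have hc₀ := under_comm₀ (X := one) (Mnd.act F)
  simp only [Mnd.act_src, Mnd.act_tgt, ← hf, ← ha'] at ha hc hc₀ ⊢
  obtain ⟨h, hh, hξ⟩ := H.em.exists_lift ha
  have hξ' {Y : D} (x : Y ⟶ Z.obj) : wl (x ≫ h) ξ = wl x a := by rw [wl_comp₁, hξ]
  -- `under_comm` for the action says that the oplax structure of `f` consists of algebra morphisms.
  obtain ⟨φ, hφ⟩ := H.em.exists_lift₂ (tens Z.tensor (fst Z.obj Z.obj) (snd Z.obj Z.obj) ≫ h)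
    (tens N.tensor (fst Z.obj Z.obj ≫ h) (snd Z.obj Z.obj ≫ h))
    (tensorCell f.toHomData (fst Z.obj Z.obj) (snd Z.obj Z.obj))
    (by simp [hh]) (by simp [H.tens_comp, hh])
    (by
      intro k₁ k₂
      have := hc (fst Z.obj Z.obj) (snd Z.obj Z.obj)
      simp only [H.wl_tens, hξ', Strict.assoc, hh]
      simpa using this)
  obtain ⟨φ₀, hφ₀⟩ := H.em.exists_lift₂ (const Z.unit one ≫ h) (const N.unit one)
    (unitCell f.toHomData one) (by simp [hh]) (by simp [H.const_comp])
    (by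
      intro k₁ k₂
      simp only [H.wl_const, hξ']
      simpa using hc₀.symm)
  have s : (of φ).src = Z.tensor ≫ h := by rw [of_src, tens_fst_snd]
  have s₀ : (of φ₀).src = Z.unit ≫ h := by
    rw [of_src, const, ← toOne_unique (𝟙 one), Strict.id_comp]
  have e' : const N.unit one = N.unit := by rw [const, ← toOne_unique (𝟙 one), Strict.id_comp]
  obtain ⟨k, rfl, hk, hk₀⟩ : ∃ k : HomData Z N, k.hom = h ∧ of k.cell = of φ ∧
      of k.cell₀ = of φ₀ :=
    ⟨⟨h, (of φ).cast s rfl, (of φ₀).cast s₀ e'⟩, rfl, of_cast _ s rfl, of_cast _ s₀ e'⟩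
  have hφk {Y : D} (x y : Y ⟶ Z.obj) : wr (tensorCell k x y) U = tensorCell f.toHomData x y := by
    rw [tensorCell_eq, hk, ← wl_wr, hφ, wl_tensorCell, lift_fst, lift_snd]
  have hφk₀ {Y : D} : wr (unitCell k Y) U = unitCell f.toHomData Y := by
    rw [unitCell_eq, hk₀, ← wl_wr, hφ₀, wl_unitCell]
  -- The coherence laws hold after whiskering with `U`, where they are those of `f`.
  have hkU {Y : D} (c : Cell Y Z.obj) : wr (wr c k.hom) U = wr c f.hom := by rw [← wr_comp₁, hh]
  refine ⟨Hom.mk (M := Z) (N := N) k ?_ ?_ ?_, ?_, hξ⟩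
  · rw [assocAt_iff]
    refine H.em.cell_ext (by simp) (by simp) ?_
    have := (assocAt_iff _ _ _ _).1 f.assoc_cell
    simpa [hφk, H.wr_tensor, H.wr_assocCell, hh, hkU] using this
  · rw [lamAt_iff]
    refine H.em.cell_ext (by simp) (by simp) ?_
    have := (lamAt_iff _ _).1 f.lam_cell
    simpa [hφk, hφk₀, H.wr_tensor, H.wr_lamCell, hh, hkU] using this
  · rw [rhoAt_iff]
    refine H.em.cell_ext (by simp) (by simp) ?_
    have := (rhoAt_iff _ _).1 f.rho_cell
    simpa [hφk, hφk₀, H.wr_tensor, H.wr_rhoCell, hh, hkU] using this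
  · refine hom_ext_of_tensorCell hh ?_ ?_
    · simp [hφk, hh]
    · simp [hφk₀]

/-- The oplax structure of a 1-cell into `N` is determined by that of its composite with the
forgetful 1-cell. -/
theorem hom_ext {Z : MonOp D} {F G : Z ⟶ N} (h : F.hom = G.hom) (h' : F ≫ H.hom = G ≫ H.hom) :
    F = G := by
  have e (F : Z ⟶ N) {Y : D} (x y : Y ⟶ Z.obj) :
      wr (tensorCell F.toHomData x y) U = tensorCell (Hom.toHomData (F ≫ H.hom)) x y := by
    simp
  have e₀ (F : Z ⟶ N) {Y : D} :
      wr (unitCell F.toHomData Y) U = unitCell (Hom.toHomData (F ≫ H.hom)) Y := by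
    simp
  refine hom_ext_of_tensorCell h (H.em.cell_ext ?_ ?_ ?_) (H.em.cell_ext ?_ ?_ ?_)
  · simp [h]
  · simp [h]
  · rw [e, e, h']
  · simp [h]
  · simp
  · rw [e₀, e₀, h']

theorem cell_ext (H : IsStrictLift A N.toMonoidalData U ξ) {Z : MonOp D} {c d : Cell Z N}
    (hs : c.src = d.src) (ht : c.tgt = d.tgt)
    (h : wr (under c) U = wr (under d) U) : c = d :=
  under_ext hs ht (H.em.cell_ext (by simp [hs]) (by simp [ht]) h)

/-- Morphisms of algebras in `Mon_op(D)` lift along the universal algebra. -/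
theorem exists_lift₂ {Z : MonOp D} {F G : Z ⟶ N} (c : Cell Z A.obj) (hs : c.src = F ≫ H.hom)
    (ht : c.tgt = G ≫ H.hom)
    (h : ∀ k₁ k₂, comp (wr (under c) A.endo.hom) (wl G.hom ξ) k₁ =
      comp (wl F.hom ξ) (under c) k₂) :
    ∃ σ : F ⟶ G, wr (cell₂ σ) U = under c := by
  have hc := fun x y => under_comm (X := prod Z.obj Z.obj) c x y
  have hc₀ := under_comm₀ (X := one) c
  obtain ⟨τ, hτ⟩ := H.em.exists_lift₂ F.hom G.hom (under c) (by simp [hs]) (by simp [ht]) h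
  simp only [← hτ, hs, ht] at hc hc₀
  obtain ⟨σ, hσ⟩ := exists_cell₂ (F := F) (G := G) (of τ) rfl rfl
    (fun _ _ => H.em.cell_ext (by simp) (by simp) (by
      simpa [H.wr_tensor] using hc (fst Z.obj Z.obj) (snd Z.obj Z.obj)))
    (fun _ => H.em.cell_ext (by simp) (by simp) (by
      simpa using hc₀))
  exact ⟨σ, by rw [hσ, hτ]⟩

end

/-- If `(U, ξ)` is a universal arrow from `ι` to the monad of `D` underlying `A`, then the lifted
monoidal object carries a universal arrow from `ι` to `A`, whose image in `D` is `(U, ξ)`. -/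
theorem exists_isUniversal {κ : (Mnd.iota D).obj N.obj ⟶ (Mnd.map (forget D)).obj A}
    (hκ : IsUniversal (Mnd.iota D) κ)
    (H : IsStrictLift A N.toMonoidalData (Mnd.carrier κ) (Mnd.act κ)) :
    ∃ κ' : (Mnd.iota (MonOp D)).obj N ⟶ A,
      IsUniversal (Mnd.iota (MonOp D)) κ' ∧ mapArrow (forget D) κ' = κ := by
  obtain ⟨κ', h₁, h₂⟩ := H.exists_alg
  have e : mapArrow (forget D) κ' = κ := by
    refine Mnd.alg_ext ?_ ?_
    · exact (Mnd.carrier_mapArrow (forget D) κ').trans (congrArg (forget D).map h₁)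
    · exact (Mnd.act_mapArrow (forget D) κ').trans h₂
  refine ⟨κ', IsUniversal.of_lift_of_injective ?_ ?_ ?_, e⟩
  · intro Z F
    obtain ⟨h, hF, hξ⟩ := H.exists_lift F
    refine ⟨h, Mnd.alg_ext ?_ (under_ext ?_ ?_ ?_)⟩
    · rw [Mnd.carrier_comp, h₁, hF]
    · simp [h₁, ← hF]
    · simp [h₁, hF]
    · rw [Mnd.act_comp, under_wl, h₂, hξ]
  · intro Z F G σ
    obtain ⟨τ, hτ⟩ := H.exists_lift₂ (F := F) (G := G) (Mnd.homCell σ) (by simp [h₁])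
      (by simp [h₁]) (by
        have h := congrArg under (Mnd.algHom_comm σ)
        intro _ _
        simpa [h₂] using h)
    refine ⟨τ, Mnd.cell_ext rfl rfl (under_ext rfl rfl ?_)⟩
    refine Eq.trans ?_ hτ
    exact congrArg (fun k : N ⟶ A.obj => wr (cell₂ τ) k.hom) h₁
  · intro Z c d h
    have key {F G : Z ⟶ N} (h : (Mnd.iota (MonOp D)).map F ≫ κ' =
        (Mnd.iota (MonOp D)).map G ≫ κ') : F = G := by
      refine H.hom_ext ?_ ?_
      · refine hκ.hom_ext (f := F.hom) (g := G.hom) ?_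
        have k := congrArg (mapArrow (forget D)) h
        rw [mapArrow_comp, mapArrow_comp, e] at k
        exact k
      · have k := congrArg Mnd.carrier h
        rwa [Mnd.carrier_comp, Mnd.carrier_comp, h₁] at k
    refine H.cell_ext (key (congrArg Cell.src h)) (key (congrArg Cell.tgt h)) ?_
    have k : wr (under c) (HomData.hom (Hom.toHomData (Mnd.carrier κ'))) =
        wr (under d) (HomData.hom (Hom.toHomData (Mnd.carrier κ'))) :=
      congrArg (fun c => under (Mnd.cell c)) h
    rw [h₁] at k
    exact k

end IsStrictLift

/-- If there is a universal arrow from `ι` to the monad of `D` underlying `A`, then there is a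
universal arrow from `ι` to `A`, and the forgetful 2-functor preserves it. -/
theorem exists_isUniversal (A : Mnd (MonOp D)) {X : D}
    {κ : (Mnd.iota D).obj X ⟶ (Mnd.map (forget D)).obj A} (hκ : IsUniversal (Mnd.iota D) κ) :
    ∃ (N : MonOp D) (κ' : (Mnd.iota (MonOp D)).obj N ⟶ A),
      IsUniversal (Mnd.iota (MonOp D)) κ' ∧
        IsUniversal (Mnd.iota D) (mapArrow (forget D) κ') := by
  obtain ⟨t, i, α, l, r, p, q, H⟩ := (isEM_of_isUniversal A hκ).exists_monOp
  obtain ⟨κ', h, e⟩ := IsStrictLift.exists_isUniversal (N := ⟨⟨X, t, i, α, l, r⟩, p, q⟩) hκ H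
  exact ⟨_, κ', h, e ▸ hκ⟩

end MonOp

end TwoCat

theorem mainTheorem3 {D : Type u} [Bicategory.{w, v} D] [Bicategory.Strict D]
    [TwoCat.FiniteProducts₂ D] (hD : TwoCat.AdmitsEMObjects D) :
    TwoCat.AdmitsEMObjects (TwoCat.MonOp D) ∧
      TwoCat.HasStandardEMObjects (TwoCat.MonOp.forget D) := by
  obtain ⟨R⟩ := hD
  choose N κ h h' using fun A : TwoCat.Mnd (TwoCat.MonOp D) =>
    TwoCat.MonOp.exists_isUniversal A
      (R.isUniversal ((TwoCat.Mnd.map (TwoCat.MonOp.forget D)).obj A))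
  have hM : TwoCat.AdmitsEMObjects (TwoCat.MonOp D) :=
    ⟨TwoCat.rightAdjointOfUniversal N κ h⟩
  exact ⟨hM, hM, ⟨R⟩, fun P Q => TwoCat.exists_comparison_inverse _ P Q fun A =>
    TwoCat.isUniversal_mapArrow_of_isUniversal _ (h A) (P.isUniversal A) (h' A)⟩
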